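/- Let $k$ be a field (of any characteristic) and $\hbar$ a formal variable. For a $k[\hbar]$-algebra $A$ put $\Gamma_\ell=\hbar^\ell A$; for an algebra with a given generating space $V$ let $F_n$ be the span (over the ground ring) of the monomials of degree $\le n$ in elements of $V$, with $F_{-1}=0$. (1) Let $V$ be a $k$-vector space with a basis $(x_i)_{i\in I}$, $I$ totally ordered, let $\ell_{ij}\in V$ $(i<j)$ be arbitrary, and let $A=T(V)[\hbar]/(x_i\otimes x_j-x_j\otimes x_i-\hbar\,\ell_{ij})_{i<j}$. Then $\bigcap_{\ell\ge0}\Gamma_\ell=0$. Now let $\mathfrak g$ be a Lie algebra over $k$ (of any dimension) and $A=T(\mathfrak g)[\hbar]/(x\otimes y-y\otimes x-\hbar[x,y])_{x,y\in\mathfrak g}$. (2) Let $\Lambda^+(\mathfrak g)=\bigoplus_{n\ge1}\Lambda^n(\mathfrak g)$, and let $\mathcal R=T(\Lambda^+(\mathfrak g)[-1])$ be the free graded algebra on generators $[\omega]$ of degree $1-n$ for $\omega\in\Lambda^n(\mathfrak g)$. Let $d_0$ be the Koszul differential, i.e. the odd derivation with $d_0[\omega]=\sum(-1)^{|\omega'|-1}[\omega']\otimes[\omega'']$,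 where $\sum\omega'\otimes\omega''$ is the reduced (shuffle) coproduct of $\omega$ and $|\omega'|$ is the exterior degree, and let $d_1$ be the odd derivation with $d_1[\omega]=[\partial\omega]$, where $\partial(v_1\wedge\dots\wedge v_n)=\sum_{i<j}(-1)^{i+j}[v_i,v_j]\wedge v_1\wedge\dots\hat v_i\dots\hat v_j\dots\wedge v_n$ is the Chevalley–Eilenberg differential. Then $d_\hbar=d_0+\hbar d_1$ is a derivation (with signs) of degree $+1$ of the $\mathbb Z_{\le 0}$-graded algebra $\mathcal R[\hbar]$, and $d_\hbar^2=0$. Moreover, writing $x$ for $[x]$, $d_\hbar[x\wedge y]=x\otimes y-y\otimes x-\hbar[x,y]_{\mathfrak g}$, and $d_\hbar[x\wedge y\wedge z]$ is the sum over the cyclic permutations of $(x,y,z)$ of $x\otimes[y\wedge z]-[y\wedge z]\otimes x-\hbar\,\big[[x,y]_{\mathfrak g}\wedge z\big]$. (3) $\bigoplus_{\ell\ge0}\Gamma_\ell/\Gamma_{\ell+1}\simeq S(\mathfrak g)[\hbar]$ as graded $k[\hbar]$-algebras, with $\Gamma_\ell/\Gamma_{\ell+1}$ corresponding to $\hbar^\ell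 S(\mathfrak g)$ (here $\hbar$ acts on the left-hand side by multiplication by its class in $\Gamma_1/\Gamma_2$), compatibly with the generators $x\in\mathfrak g$. (4) $\bigcap_{\ell\ge0}\Gamma_\ell=0$ in $A$. (5) $\bigoplus_{n\ge0}F_n/F_{n-1}\simeq S(\mathfrak g)[\hbar]$ as graded $k[\hbar]$-algebras, with $F_n/F_{n-1}$ corresponding to $S^n(\mathfrak g)[\hbar]$, compatibly with the generators $x\in\mathfrak g$. (6) For every $a\in k$, the specialization $A_a=A\otimes_{k[\hbar]}k[\hbar]/(\hbar-a)$ is isomorphic, compatibly with the generators, to $T(\mathfrak g)/(x\otimes y-y\otimes x-a[x,y])_{x,y\in\mathfrak g}$, and $\operatorname{gr}_FA_a\simeq S(\mathfrak g)$ as graded algebras, compatibly with the generators. In particular (the classical Poincaré–Birkhoff–Witt theorem), $\operatorname{gr}_F\mathcal U(\mathfrak g)\simeq S(\mathfrak g)$ as graded algebras, compatibly with the generators $x\in\mathfrak g$, for the universal enveloping algebra $\mathcal U(\mathfrak g)$. -/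

import Mathlib

open scoped TensorProduct DirectSum Polynomial

noncomputable section

/-! ### Filtrations of algebras and associated graded algebras -/

/-- The data needed to form the associated graded algebra `⨁ top n / bot n` of a filtration of an
`R`-algebra `A` by `R`-submodules. For an ascending filtration `F` one takes `top n = F n`,
`bot n = F (n - 1)` (with `F (-1) = 0`); for a descending filtration `Γ` one takes
`top n = Γ n`, `bot n = Γ (n + 1)`. -/
structure FiltData (R A : Type*) [CommRing R] [Ring A] [Algebra R A] where
  top : ℕ → Submodule R A
  bot : ℕ → Submodule R A
  bot_le : ∀ n, bot n ≤ top n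
  one_mem : (1 : A) ∈ top 0
  mul_mem : ∀ {m n : ℕ} {a b : A}, a ∈ top m → b ∈ top n → a * b ∈ top (m + n)
  bot_mul : ∀ {m n : ℕ} {a b : A}, a ∈ bot m → b ∈ top n → a * b ∈ bot (m + n)
  mul_bot : ∀ {m n : ℕ} {a b : A}, a ∈ top m → b ∈ bot n → a * b ∈ bot (m + n)

namespace FiltData

variable {R A : Type*} [CommRing R] [Ring A] [Algebra R A]

/-- The `n`-th graded piece `top n / bot n`. -/
def piece (D : FiltData R A) (n : ℕ) : Type _ := ↥(D.top n) ⧸ (D.bot n).submoduleOf (D.top n)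

instance (D : FiltData R A) (n : ℕ) : AddCommGroup (D.piece n) :=
  inferInstanceAs (AddCommGroup (↥(D.top n) ⧸ (D.bot n).submoduleOf (D.top n)))

instance (D : FiltData R A) (n : ℕ) : Module R (D.piece n) :=
  inferInstanceAs (Module R (↥(D.top n) ⧸ (D.bot n).submoduleOf (D.top n)))

/-- The class in `top n / bot n` of an element of `top n`. -/
def cls (D : FiltData R A) (n : ℕ) : ↥(D.top n) →ₗ[R] D.piece n :=
  ((D.bot n).submoduleOf (D.top n)).mkQ

theorem cls_surjective (D : FiltData R A) (n : ℕ) : Function.Surjective (D.cls n) :=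
  Submodule.mkQ_surjective _

theorem cls_eq (D : FiltData R A) {n : ℕ} {a b : ↥(D.top n)} (h : (a : A) - b ∈ D.bot n) :
    D.cls n a = D.cls n b :=
  (Submodule.Quotient.eq _).2 h

/-- Multiplication `top m / bot m × top n / bot n → top (m + n) / bot (m + n)`. -/
def mulPiece (D : FiltData R A) {m n : ℕ} (x : D.piece m) (y : D.piece n) : D.piece (m + n) :=
  Quotient.liftOn₂ x y
    (fun (a : ↥(D.top m)) (b : ↥(D.top n)) =>
      D.cls (m + n) ⟨(a : A) * (b : A), D.mul_mem a.2 b.2⟩)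
    (by
      intro a b a' b' ha hb
      have ha' : (a : A) - a' ∈ D.bot m :=
        (Submodule.Quotient.eq ((D.bot m).submoduleOf (D.top m)) (x := a) (y := a')).1
          (Quotient.sound ha)
      have hb' : (b : A) - b' ∈ D.bot n :=
        (Submodule.Quotient.eq ((D.bot n).submoduleOf (D.top n)) (x := b) (y := b')).1
          (Quotient.sound hb)
      refine D.cls_eq ?_
      have : (a : A) * b - a' * b' = (a - a') * b + a' * (b - b') := by noncomm_ring
      rw [this]
      exact add_mem (D.bot_mul ha' b.2) (D.mul_bot a'.2 hb'))

theorem mulPiece_cls (D : FiltData R A) {m n : ℕ} (a : ↥(D.top m)) (b : ↥(D.top n)) :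
    D.mulPiece (D.cls m a) (D.cls n b) = D.cls (m + n) ⟨(a : A) * b, D.mul_mem a.2 b.2⟩ := rfl

theorem mk_cls_congr (D : FiltData R A) {m n : ℕ} (h : m = n) (a : ↥(D.top m)) (b : ↥(D.top n))
    (hab : (a : A) = b) :
    (GradedMonoid.mk m (D.cls m a) : GradedMonoid D.piece) = GradedMonoid.mk n (D.cls n b) := by
  subst h
  rw [Subtype.ext hab]

instance (D : FiltData R A) : GradedMonoid.GMul D.piece := ⟨fun x y => D.mulPiece x y⟩

instance (D : FiltData R A) : GradedMonoid.GOne D.piece := ⟨D.cls 0 ⟨1, D.one_mem⟩⟩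

instance (D : FiltData R A) : GradedMonoid.GMonoid D.piece where
  one_mul := by
    rintro ⟨n, x⟩
    obtain ⟨a, rfl⟩ := D.cls_surjective n x
    exact D.mk_cls_congr (zero_add n) ⟨1 * a, D.mul_mem D.one_mem a.2⟩ a (one_mul _)
  mul_one := by
    rintro ⟨n, x⟩
    obtain ⟨a, rfl⟩ := D.cls_surjective n x
    exact D.mk_cls_congr (add_zero n) ⟨a * 1, D.mul_mem a.2 D.one_mem⟩ a (mul_one _)
  mul_assoc := by
    rintro ⟨l, x⟩ ⟨m, y⟩ ⟨n, z⟩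
    obtain ⟨a, rfl⟩ := D.cls_surjective l x
    obtain ⟨b, rfl⟩ := D.cls_surjective m y
    obtain ⟨c, rfl⟩ := D.cls_surjective n z
    exact D.mk_cls_congr (add_assoc l m n)
      ⟨a * b * c, D.mul_mem (D.mul_mem a.2 b.2) c.2⟩
      ⟨a * (b * c), D.mul_mem a.2 (D.mul_mem b.2 c.2)⟩ (mul_assoc _ _ _)

instance (D : FiltData R A) : DirectSum.GRing D.piece where
  mul_zero := by
    intro i j x
    obtain ⟨a, rfl⟩ := D.cls_surjective i x
    refine (D.mulPiece_cls a 0).trans (D.cls_eq (b := 0) ?_)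
    simp
  zero_mul := by
    intro i j x
    obtain ⟨a, rfl⟩ := D.cls_surjective j x
    refine (D.mulPiece_cls 0 a).trans (D.cls_eq (b := 0) ?_)
    simp
  mul_add := by
    intro i j x y z
    obtain ⟨a, rfl⟩ := D.cls_surjective i x
    obtain ⟨b, rfl⟩ := D.cls_surjective j y
    obtain ⟨c, rfl⟩ := D.cls_surjective j z
    refine (D.mulPiece_cls a (b + c)).trans (D.cls_eq (b := ⟨a * b, D.mul_mem a.2 b.2⟩ +
      ⟨a * c, D.mul_mem a.2 c.2⟩) ?_)
    simp [mul_add]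
  add_mul := by
    intro i j x y z
    obtain ⟨a, rfl⟩ := D.cls_surjective i x
    obtain ⟨b, rfl⟩ := D.cls_surjective i y
    obtain ⟨c, rfl⟩ := D.cls_surjective j z
    refine (D.mulPiece_cls (a + b) c).trans (D.cls_eq (b := ⟨a * c, D.mul_mem a.2 c.2⟩ +
      ⟨b * c, D.mul_mem b.2 c.2⟩) ?_)
    simp [add_mul]
  natCast n := n • D.cls 0 ⟨1, D.one_mem⟩
  natCast_zero := zero_smul _ _
  natCast_succ n := succ_nsmul _ _
  intCast n := n • D.cls 0 ⟨1, D.one_mem⟩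
  intCast_ofNat n := natCast_zsmul _ _
  intCast_negSucc_ofNat n := negSucc_zsmul _ _

instance (D : FiltData R A) : DirectSum.GAlgebra R D.piece where
  toFun := ((LinearMap.toSpanSingleton R (D.piece 0) (D.cls 0 ⟨1, D.one_mem⟩)).toAddMonoidHom)
  map_one := one_smul R (D.cls 0 ⟨1, D.one_mem⟩)
  map_mul r s := by
    exact D.mk_cls_congr (zero_add 0).symm ((r * s) • ⟨1, D.one_mem⟩)
      ⟨(r • (1 : A)) * (s • (1 : A)), D.mul_mem (Submodule.smul_mem _ _ D.one_mem)
        (Submodule.smul_mem _ _ D.one_mem)⟩ (by simp [mul_smul, smul_comm r s])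
  commutes := by
    rintro r ⟨n, x⟩
    obtain ⟨a, rfl⟩ := D.cls_surjective n x
    exact D.mk_cls_congr (add_comm 0 n)
      ⟨(r • (1 : A)) * a, D.mul_mem (Submodule.smul_mem _ _ D.one_mem) a.2⟩
      ⟨a * (r • (1 : A)), D.mul_mem a.2 (Submodule.smul_mem _ _ D.one_mem)⟩ (by simp)
  smul_def := by
    rintro r ⟨n, x⟩
    obtain ⟨a, rfl⟩ := D.cls_surjective n x
    exact D.mk_cls_congr (zero_add n).symm (r • a)
      ⟨(r • (1 : A)) * a, D.mul_mem (Submodule.smul_mem _ _ D.one_mem) a.2⟩ (by simp)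

/-- The associated graded algebra `⨁ n, top n / bot n`. -/
abbrev gr (D : FiltData R A) : Type _ := ⨁ n, D.piece n

/-- The summand `top n / bot n` of the associated graded algebra. -/
def grPiece (D : FiltData R A) (n : ℕ) : Submodule R D.gr :=
  LinearMap.range (DirectSum.lof R ℕ D.piece n)

/-- The class in degree `n` of the associated graded algebra of an element of `top n`. -/
def symb (D : FiltData R A) (n : ℕ) (a : A) (ha : a ∈ D.top n) : D.gr :=
  DirectSum.lof R ℕ D.piece n (D.cls n ⟨a, ha⟩)

end FiltData

/-- `F n`: the `R`-span of the monomials `x₁ ⋯ x_m` of degree `m ≤ n` in the generators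
`gen v`, `v : V`. -/
def wordFilt (R : Type*) {V A : Type*} [CommRing R] [Ring A] [Algebra R A] (gen : V → A) (n : ℕ) :
    Submodule R A :=
  Submodule.span R {a | ∃ l : List V, l.length ≤ n ∧ (l.map gen).prod = a}

theorem wordFilt_mul_mem (R : Type*) {V A : Type*} [CommRing R] [Ring A] [Algebra R A]
    (gen : V → A) {m n : ℕ} {a b : A} (ha : a ∈ wordFilt R gen m) (hb : b ∈ wordFilt R gen n) :
    a * b ∈ wordFilt R gen (m + n) := by
  refine (Submodule.mul_le.1 ?_) a ha b hb
  rw [wordFilt, wordFilt, Submodule.span_mul_span, Submodule.span_le]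
  rintro _ ⟨_, ⟨l, hl, rfl⟩, _, ⟨l', hl', rfl⟩, rfl⟩
  exact Submodule.subset_span ⟨l ++ l', by simp; omega, by simp⟩

theorem wordFilt_mono (R : Type*) {V A : Type*} [CommRing R] [Ring A] [Algebra R A]
    (gen : V → A) {m n : ℕ} (h : m ≤ n) : wordFilt R gen m ≤ wordFilt R gen n :=
  Submodule.span_mono fun _ ⟨l, hl, e⟩ => ⟨l, hl.trans h, e⟩

theorem gen_mem_wordFilt (R : Type*) {V A : Type*} [CommRing R] [Ring A] [Algebra R A]
    (gen : V → A) (v : V) : gen v ∈ wordFilt R gen 1 :=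
  Submodule.subset_span ⟨[v], by simp, by simp⟩

/-- The ascending filtration by the degree in the generators: `F_n / F_{n-1}` with `F_{-1} = 0`. -/
def ascData (R : Type*) {V A : Type*} [CommRing R] [Ring A] [Algebra R A] (gen : V → A) :
    FiltData R A where
  top := wordFilt R gen
  bot
    | 0 => ⊥
    | n + 1 => wordFilt R gen n
  bot_le
    | 0 => bot_le
    | n + 1 => wordFilt_mono R gen n.le_succ
  one_mem := Submodule.subset_span ⟨[], by simp, by simp⟩
  mul_mem := wordFilt_mul_mem R gen
  bot_mul {m n a b} ha hb := by
    cases m with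
    | zero =>
      rw [(Submodule.mem_bot R).1 ha, zero_mul]
      exact zero_mem _
    | succ m =>
      rw [Nat.succ_add]
      exact wordFilt_mul_mem R gen ha hb
  mul_bot {m n a b} ha hb := by
    cases n with
    | zero =>
      rw [(Submodule.mem_bot R).1 hb, mul_zero]
      exact zero_mem _
    | succ n => exact wordFilt_mul_mem R gen ha hb

/-- `Γ_ℓ = ħ^ℓ A`, for a `k[ħ]`-algebra `A` (`ħ` is the polynomial variable). -/
def hFilt (k A : Type*) [Field k] [Ring A] [Algebra k A] [Algebra k[X] A] (l : ℕ) :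
    Submodule k A :=
  LinearMap.range (LinearMap.mulLeft k (algebraMap k[X] A (Polynomial.X ^ l)))

theorem mem_hFilt {k A : Type*} [Field k] [Ring A] [Algebra k A] [Algebra k[X] A] {l : ℕ} {a : A} :
    a ∈ hFilt k A l ↔ ∃ b, algebraMap k[X] A (Polynomial.X ^ l) * b = a := Iff.rfl

theorem hFilt_mul_mem {k A : Type*} [Field k] [Ring A] [Algebra k A] [Algebra k[X] A]
    {m n : ℕ} {a b : A} (ha : a ∈ hFilt k A m) (hb : b ∈ hFilt k A n) :
    a * b ∈ hFilt k A (m + n) := by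
  obtain ⟨a, rfl⟩ := ha
  obtain ⟨b, rfl⟩ := hb
  refine ⟨a * b, ?_⟩
  simp only [LinearMap.mulLeft_apply, pow_add, map_mul, mul_assoc]
  rw [← mul_assoc a, ← Algebra.commutes (Polynomial.X ^ n : k[X]) a, mul_assoc]

/-- The descending filtration by powers of `ħ`: `Γ_ℓ / Γ_{ℓ+1}`. -/
def descData (k A : Type*) [Field k] [Ring A] [Algebra k A] [Algebra k[X] A] : FiltData k A where
  top := hFilt k A
  bot l := hFilt k A (l + 1)
  bot_le l := by
    rintro _ ⟨a, rfl⟩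
    refine ⟨algebraMap k[X] A Polynomial.X * a, ?_⟩
    simp [pow_succ]
  one_mem := ⟨1, by simp⟩
  mul_mem := hFilt_mul_mem
  bot_mul {m n a b} ha hb := by
    rw [Nat.add_right_comm]
    exact hFilt_mul_mem ha hb
  mul_bot {m n a b} ha hb := by
    rw [Nat.add_assoc]
    exact hFilt_mul_mem ha hb

theorem mem_hFilt_zero {k A : Type*} [Field k] [Ring A] [Algebra k A] [Algebra k[X] A] (a : A) :
    a ∈ hFilt k A 0 := ⟨a, by simp⟩

theorem h_mem_hFilt {k A : Type*} [Field k] [Ring A] [Algebra k A] [Algebra k[X] A] :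
    algebraMap k[X] A Polynomial.X ∈ hFilt k A 1 := ⟨1, by simp⟩

/-! ### The three PBW properties -/

/-- The `n`-th symmetric power `S^n(V)`, as a subspace of `S(V)`. -/
def symPow (k V : Type*) [Field k] [AddCommGroup V] [Module k V] (n : ℕ) :
    Submodule k (SymmetricAlgebra k V) :=
  LinearMap.range (SymmetricAlgebra.ι k V) ^ n

/-- PBW property of a `k`-algebra `B` with generators `gen v`, `v : V`: there is an isomorphism of
graded algebras `gr_F B ≃ S(V)`, taking the class of `gen v` in `F_1 / F_0` to `v`. -/
def HasPBW (k : Type*) {V B : Type*} [Field k] [AddCommGroup V] [Module k V] [Ring B] [Algebra k B]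
    (gen : V → B) : Prop :=
  ∃ e : (ascData k gen).gr ≃ₐ[k] SymmetricAlgebra k V,
    (∀ n, ((ascData k gen).grPiece n).map e.toLinearMap = symPow k V n) ∧
    ∀ v, e ((ascData k gen).symb 1 (gen v) (gen_mem_wordFilt k gen v)) = SymmetricAlgebra.ι k V v

/-- `ħ`-linear PBW property of a `k[ħ]`-algebra `A` with generators `gen v`, `v : V`: there is an
isomorphism of graded `k[ħ]`-algebras `gr_F A ≃ S(V)[ħ]`, taking `F_n / F_{n-1}` onto `S^n(V)[ħ]`
and the class of `gen v` in `F_1 / F_0` to `v`. Here `S(V)[ħ] = k[ħ] ⊗ S(V)`. -/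
def HasHPBW (k : Type*) {V A : Type*} [Field k] [AddCommGroup V] [Module k V] [Ring A]
    [Algebra k[X] A] (gen : V → A) : Prop :=
  ∃ e : (ascData k[X] gen).gr ≃ₐ[k[X]] k[X] ⊗[k] SymmetricAlgebra k V,
    (∀ n, ((ascData k[X] gen).grPiece n).map e.toLinearMap = (symPow k V n).baseChange k[X]) ∧
    ∀ v, e ((ascData k[X] gen).symb 1 (gen v) (gen_mem_wordFilt k[X] gen v)) =
      1 ⊗ₜ SymmetricAlgebra.ι k V v

/-- PBW-like property for the descending filtration `Γ_ℓ = ħ^ℓ A`: there is an isomorphism of graded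
algebras `gr_Γ A ≃ S(V)[ħ]`, taking `Γ_ℓ / Γ_{ℓ+1}` onto `ħ^ℓ S(V)`, the class of `gen v` in
`Γ_0 / Γ_1` to `v`, and the class of `ħ` in `Γ_1 / Γ_2` to `ħ`. The last clause says that the
isomorphism is `k[ħ]`-linear, as `ħ` acts on `gr_Γ A` by multiplication by its class in
`Γ_1 / Γ_2`. -/
def HasDescPBW (k : Type*) {V A : Type*} [Field k] [AddCommGroup V] [Module k V] [Ring A]
    [Algebra k A] [Algebra k[X] A] (gen : V → A) : Prop :=
  ∃ e : (descData k A).gr ≃ₐ[k] k[X] ⊗[k] SymmetricAlgebra k V,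
    (∀ l, ((descData k A).grPiece l).map e.toLinearMap =
      LinearMap.range (TensorProduct.mk k k[X] (SymmetricAlgebra k V) (Polynomial.X ^ l))) ∧
    (∀ v, e ((descData k A).symb 0 (gen v) (mem_hFilt_zero (gen v))) =
      1 ⊗ₜ SymmetricAlgebra.ι k V v) ∧
    e ((descData k A).symb 1 (algebraMap k[X] A Polynomial.X) h_mem_hFilt) = Polynomial.X ⊗ₜ 1

/-! ### The algebras `T(V)[ħ] / (relators)` and their specializations -/

/-- `T(V)[ħ] = k[ħ] ⊗ T(V)`. -/
abbrev HTensor (k V : Type*) [Field k] [AddCommGroup V] [Module k V] : Type _ :=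
  k[X] ⊗[k] TensorAlgebra k V

/-- `v : V` as an element of `T(V)[ħ]`. -/
def hvec (k : Type*) {V : Type*} [Field k] [AddCommGroup V] [Module k V] (v : V) : HTensor k V :=
  1 ⊗ₜ TensorAlgebra.ι k v

/-- The quotient of an algebra by the two-sided ideal generated by a set `S`. -/
abbrev QuotBy {T : Type*} [Ring T] (S : Set T) : Type _ := RingQuot fun a b : T => a ∈ S ∧ b = 0

/-- The relators `x_i ⊗ x_j - x_j ⊗ x_i - φ_ij`, `i < j`. -/
def pairRelators {k V I : Type*} [Field k] [AddCommGroup V] [Module k V] [LinearOrder I]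
    (x : I → V) (φ : I → I → HTensor k V) : Set (HTensor k V) :=
  {t | ∃ i j, i < j ∧
    t = hvec k (x i) * hvec k (x j) - hvec k (x j) * hvec k (x i) - φ i j}

section Lie

variable (k g : Type*) [Field k] [LieRing g] [LieAlgebra k g]

/-- The relators `x ⊗ y - y ⊗ x - ħ [x, y]`, `x, y ∈ g`. -/
def hLieRelators : Set (HTensor k g) :=
  {t | ∃ x y : g, t = hvec k x * hvec k y - hvec k y * hvec k x
    - (Polynomial.X : k[X]) • hvec k ⁅x, y⁆}

/-- The `ħ`-algebra `T(g)[ħ] / (x ⊗ y - y ⊗ x - ħ [x, y])`. -/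
abbrev HEnv : Type _ := QuotBy (hLieRelators k g)

/-- The generator of `HEnv k g` given by `x ∈ g`. -/
def HEnv.gen (x : g) : HEnv k g := RingQuot.mkAlgHom k[X] _ (hvec k x)

/-- The specialization `A_a = A ⊗_{k[ħ]} k[ħ]/(ħ - a)` of `A = HEnv k g`
(with the two factors interchanged). -/
abbrev SpecEnv (a : k) : Type _ :=
  (k[X] ⧸ Ideal.span {(Polynomial.X - Polynomial.C a : k[X])}) ⊗[k[X]] HEnv k g

/-- The generator of `SpecEnv k g a` given by `x ∈ g`. -/
def SpecEnv.gen (a : k) (x : g) : SpecEnv k g a := 1 ⊗ₜ HEnv.gen k g x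

/-- The relators `x ⊗ y - y ⊗ x - a [x, y]`, `x, y ∈ g`. -/
def lieRelators (a : k) : Set (TensorAlgebra k g) :=
  {t | ∃ x y : g, t = TensorAlgebra.ι k x * TensorAlgebra.ι k y
    - TensorAlgebra.ι k y * TensorAlgebra.ι k x - a • TensorAlgebra.ι k ⁅x, y⁆}

/-- The `k`-algebra `T(g) / (x ⊗ y - y ⊗ x - a [x, y])`. -/
abbrev ScaledEnv (a : k) : Type _ := QuotBy (lieRelators k g a)

/-- The generator of `ScaledEnv k g a` given by `x ∈ g`. -/
def ScaledEnv.gen (a : k) (x : g) : ScaledEnv k g a :=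
  RingQuot.mkAlgHom k _ (TensorAlgebra.ι k x)

end Lie

/-! ### The coalgebra `Λ(V)` and the Koszul resolution -/

section Koszul

variable (k V : Type*) [Field k] [AddCommGroup V] [Module k V]

/-- One step of the recursion for the coproduct of the exterior algebra:
`Δ(v ∧ ω) = (v ⊗ 1 + 1 ⊗ v) Δ(ω)`, the product being that of graded algebras, i.e.
`(1 ⊗ v) (a ⊗ b) = (-1)^|a| a ⊗ (v ∧ b)`. -/
def coprodStep : V →ₗ[k] (ExteriorAlgebra k V ⊗[k] ExteriorAlgebra k V) →ₗ[k]
    (ExteriorAlgebra k V ⊗[k] ExteriorAlgebra k V) :=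
  (LinearMap.rTensorHom (ExteriorAlgebra k V)).comp
      ((LinearMap.mul k (ExteriorAlgebra k V)).comp (ExteriorAlgebra.ι k)) +
    (TensorProduct.mapBilinear (.id k) (ExteriorAlgebra k V) (ExteriorAlgebra k V)
      (ExteriorAlgebra k V) (ExteriorAlgebra k V)
      (CliffordAlgebra.involute (Q := (0 : QuadraticForm k V))).toLinearMap).comp
      ((LinearMap.mul k (ExteriorAlgebra k V)).comp (ExteriorAlgebra.ι k))

theorem coprodStep_tmul (v : V) (a b : ExteriorAlgebra k V) :
    coprodStep k V v (a ⊗ₜ b) = (ExteriorAlgebra.ι k v * a) ⊗ₜ b +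
      (CliffordAlgebra.involute (Q := (0 : QuadraticForm k V)) a) ⊗ₜ (ExteriorAlgebra.ι k v * b) :=
  rfl

theorem coprodStep_sq (v : V) (t : ExteriorAlgebra k V ⊗[k] ExteriorAlgebra k V) :
    coprodStep k V v (coprodStep k V v t) = (0 : QuadraticForm k V) v • t := by
  have h : ∀ a : ExteriorAlgebra k V, ExteriorAlgebra.ι k v * (ExteriorAlgebra.ι k v * a) = 0 := by
    intro a
    rw [← mul_assoc, ExteriorAlgebra.ι_sq_zero, zero_mul]
  have hi : CliffordAlgebra.involute (Q := (0 : QuadraticForm k V)) (ExteriorAlgebra.ι k v) =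
      - ExteriorAlgebra.ι k v :=
    CliffordAlgebra.involute_ι v
  induction t with
  | zero => simp
  | add s t hs ht => simp only [map_add, hs, ht, smul_add]
  | tmul a b =>
    simp only [coprodStep_tmul, map_add, map_mul, h, hi, TensorProduct.zero_tmul,
      TensorProduct.tmul_zero, neg_mul, TensorProduct.neg_tmul, zero_add, add_zero]
    simp

/-- The (unreduced) coproduct of the exterior algebra, given on `v₁ ∧ ⋯ ∧ v_n` by the sum over
shuffles with signs: it is the map of graded algebras `Λ(V) → Λ(V) ⊗ Λ(V)` with
`v ↦ v ⊗ 1 + 1 ⊗ v`. -/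
def coprod : ExteriorAlgebra k V →ₗ[k] ExteriorAlgebra k V ⊗[k] ExteriorAlgebra k V :=
  CliffordAlgebra.foldr (0 : QuadraticForm k V) (coprodStep k V) (coprodStep_sq k V) (1 ⊗ₜ 1)

/-- `Λ⁺(V) = ⨁_{n ≥ 1} Λ^n(V)`: the kernel of the augmentation of the exterior algebra. -/
abbrev extPos : Submodule k (ExteriorAlgebra k V) :=
  LinearMap.ker (ExteriorAlgebra.algebraMapInv (R := k) (M := V)).toLinearMap

/-- The projection `Λ(V) → Λ⁺(V)` along the scalars. -/
def toPos : ExteriorAlgebra k V →ₗ[k] extPos k V :=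
  LinearMap.codRestrict _ (LinearMap.id -
    (Algebra.linearMap k (ExteriorAlgebra k V)).comp
      (ExteriorAlgebra.algebraMapInv (R := k) (M := V)).toLinearMap)
    (by
      intro ω
      simp [ExteriorAlgebra.algebraMap_leftInverse (R := k) V _])

/-- The underlying algebra `T(Λ⁺(V)[-1])` of the Koszul resolution of `S(V)`. The generator
given by `ω ∈ Λ^n(V)`, `n ≥ 1`, has degree `1 - n`. -/
abbrev Koszul : Type _ := TensorAlgebra k (extPos k V)

/-- The generator `[ω]` of `T(Λ⁺(V)[-1])` given by `ω`. It is extended to all `ω ∈ Λ(V)`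
by `[1] = 0`. -/
def kgen : ExteriorAlgebra k V →ₗ[k] Koszul k V :=
  (TensorAlgebra.ι k).comp (toPos k V)

/-- The component of degree `-m`: the span of the words `[ω₁] ⋯ [ω_r]`, where
`ω_s` is a product of `n_s + 1` vectors and `n_1 + ⋯ + n_r = m`. -/
def koszulDeg (m : ℕ) : Submodule k (Koszul k V) :=
  Submodule.span k {t | ∃ l : List (Σ n : ℕ, (Fin (n + 1) → V)),
    (l.map Sigma.fst).sum = m ∧
    (l.map fun p => kgen k V (ExteriorAlgebra.ιMulti k (p.1 + 1) p.2)).prod = t}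

/-- The algebra automorphism which is `(-1)^m` in degree `-m`: as `[ω]` has degree
`1 - n` for `ω ∈ Λ^n(V)`, it sends `[ω]` to `(-1)^(n-1) [ω]`. -/
def koszulSign : Koszul k V →ₐ[k] Koszul k V :=
  TensorAlgebra.lift k (-((kgen k V).comp
    ((CliffordAlgebra.involute (Q := (0 : QuadraticForm k V))).toLinearMap.comp
      (extPos k V).subtype)))

variable {k V}

/-- The algebra map `a ↦ !![s(a), d(a); 0, a]` whose upper right entry is the odd derivation `d`
extending `D`. Multiplicativity is the rule `d(a b) = d(a) b + s(a) d(b)`, where `s(a)` is `a`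
with the sign of its degree. -/
def oddDerivMatrix (D : extPos k V →ₗ[k] Koszul k V) :
    Koszul k V →ₐ[k] Matrix (Fin 2) (Fin 2) (Koszul k V) :=
  TensorAlgebra.lift k
    { toFun := fun w => !![koszulSign k V (TensorAlgebra.ι k w), D w; 0, TensorAlgebra.ι k w]
      map_add' := by
        intro v w
        ext i j
        fin_cases i <;> fin_cases j <;> simp
      map_smul' := by
        intro c w
        ext i j
        fin_cases i <;> fin_cases j <;> simp }

/-- The extension of `D : Λ⁺(V) → T(Λ⁺(V)[-1])` to an odd derivation of `T(Λ⁺(V)[-1])` by the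
Leibniz rule with signs. -/
def oddDeriv (D : extPos k V →ₗ[k] Koszul k V) : Koszul k V →ₗ[k] Koszul k V :=
  (Matrix.entryLinearMap k (Koszul k V) 0 1).comp (oddDerivMatrix D).toLinearMap

variable (k V)

/-- The Koszul differential `d_0`: the odd derivation with
`d_0 [ω] = ∑ (-1)^(|ω'| - 1) [ω'] ⊗ [ω'']`, where `Δ ω = ∑ ω' ⊗ ω''`. (As `[1] = 0`, only the reduced
coproduct contributes; the sign is the one coming from the shift, so that
`d_0 [u ∧ v] = u ⊗ v - v ⊗ u`, and `d_0 [u ∧ v ∧ w]` is the cyclic sum of `u ⊗ [v ∧ w] - [v ∧ w] ⊗ u`.) -/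
def koszulD₀ : Koszul k V →ₗ[k] Koszul k V :=
  oddDeriv ((-((LinearMap.mul' k (Koszul k V)).comp
    ((TensorProduct.map
      ((kgen k V).comp (CliffordAlgebra.involute (Q := (0 : QuadraticForm k V))).toLinearMap)
      (kgen k V)).comp (coprod k V)))).comp (extPos k V).subtype)

end Koszul

/-! ### The Chevalley–Eilenberg differential and the perturbed Koszul differential -/

section ChevalleyEilenberg

variable (k g : Type*) [Field k] [LieRing g] [LieAlgebra k g]

/-- One step of the recursion for the adjoint action on `Λ(g)`:
`(ω, x ↦ ad_x ω) ↦ (v ∧ ω, x ↦ [x, v] ∧ ω + v ∧ ad_x ω)`. -/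
def adStep : g →ₗ[k] (ExteriorAlgebra k g × (g →ₗ[k] ExteriorAlgebra k g)) →ₗ[k]
    (ExteriorAlgebra k g × (g →ₗ[k] ExteriorAlgebra k g)) :=
  LinearMap.mk₂ k
    (fun v p => (ExteriorAlgebra.ι k v * p.1,
      (LinearMap.mulRight k p.1).comp
        ((ExteriorAlgebra.ι k).comp (-(LieAlgebra.ad k g v : g →ₗ[k] g))) +
      (LinearMap.mulLeft k (ExteriorAlgebra.ι k v)).comp p.2))
    (by
      intro v w p
      ext <;> simp [add_mul, -lie_skew]; abel)
    (by
      intro c v p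
      ext <;> simp)
    (by
      intro v p q
      ext <;> simp [mul_add, -lie_skew]; abel)
    (by
      intro c v p
      ext <;> simp)

theorem adStep_sq (v : g) (p : ExteriorAlgebra k g × (g →ₗ[k] ExteriorAlgebra k g)) :
    adStep k g v (adStep k g v p) = (0 : QuadraticForm k g) v • p := by
  have h : ∀ a : ExteriorAlgebra k g, ExteriorAlgebra.ι k v * (ExteriorAlgebra.ι k v * a) = 0 := by
    intro a
    rw [← mul_assoc, ExteriorAlgebra.ι_sq_zero, zero_mul]
  ext x
  · simp [adStep, h]
  · have h2 := ExteriorAlgebra.ι_add_mul_swap (R := k) ⁅v, x⁆ v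
    simp [adStep, h, mul_add, ← mul_assoc]
    rw [← neg_add, ← add_mul, h2]
    simp

theorem adStep_apply (v : g) (p : ExteriorAlgebra k g × (g →ₗ[k] ExteriorAlgebra k g)) :
    adStep k g v p = (ExteriorAlgebra.ι k v * p.1,
      (LinearMap.mulRight k p.1).comp
        ((ExteriorAlgebra.ι k).comp (-(LieAlgebra.ad k g v : g →ₗ[k] g))) +
      (LinearMap.mulLeft k (ExteriorAlgebra.ι k v)).comp p.2) := rfl

/-- The map `ω ↦ (ω, x ↦ ad_x ω)`. -/
def adFold : ExteriorAlgebra k g →ₗ[k] ExteriorAlgebra k g × (g →ₗ[k] ExteriorAlgebra k g) :=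
  CliffordAlgebra.foldr (0 : QuadraticForm k g) (adStep k g) (adStep_sq k g) (1, 0)

theorem adFold_ι_mul (v : g) (ω : ExteriorAlgebra k g) :
    adFold k g (ExteriorAlgebra.ι k v * ω) = adStep k g v (adFold k g ω) :=
  (CliffordAlgebra.foldr_mul _ _ _ _ _ _).trans (CliffordAlgebra.foldr_ι _ _ _ _ _)

theorem adFold_fst (ω : ExteriorAlgebra k g) : (adFold k g ω).1 = ω := by
  induction ω using CliffordAlgebra.left_induction with
  | algebraMap r =>
    rw [adFold, CliffordAlgebra.foldr_algebraMap, Algebra.algebraMap_eq_smul_one]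
    rfl
  | add x y hx hy => rw [map_add, Prod.fst_add, hx, hy]
  | ι_mul x m hx =>
    refine (congrArg Prod.fst (adFold_ι_mul k g m x)).trans ?_
    rw [adStep_apply, hx]

/-- The adjoint action of `g` on `Λ(g)` by derivations of the exterior algebra. -/
def adExt : g →ₗ[k] ExteriorAlgebra k g →ₗ[k] ExteriorAlgebra k g :=
  ((LinearMap.snd k _ _).comp (adFold k g)).flip

theorem adExt_ι_mul (x v : g) (ω : ExteriorAlgebra k g) :
    adExt k g x (ExteriorAlgebra.ι k v * ω) =
      ExteriorAlgebra.ι k ⁅x, v⁆ * ω + ExteriorAlgebra.ι k v * adExt k g x ω := by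
  refine (congrArg (fun p : ExteriorAlgebra k g × (g →ₗ[k] ExteriorAlgebra k g) => p.2 x)
    (adFold_ι_mul k g v ω)).trans ?_
  rw [adStep_apply, adFold_fst]
  simp only [LinearMap.add_apply, LinearMap.comp_apply, LinearMap.neg_apply, LieAlgebra.ad_apply,
    lie_skew]
  rfl

/-- One step of the recursion for the Chevalley–Eilenberg differential:
`(ω, ∂ω) ↦ (v ∧ ω, - ad_v ω - v ∧ ∂ω)`. -/
def ceStep : g →ₗ[k] (ExteriorAlgebra k g × ExteriorAlgebra k g) →ₗ[k]
    (ExteriorAlgebra k g × ExteriorAlgebra k g) :=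
  LinearMap.mk₂ k
    (fun v p => (ExteriorAlgebra.ι k v * p.1,
      - adExt k g v p.1 - ExteriorAlgebra.ι k v * p.2))
    (by
      intro v w p
      ext <;> simp [add_mul]; abel)
    (by
      intro c v p
      ext <;> simp [smul_sub])
    (by
      intro v p q
      ext <;> simp [mul_add]; abel)
    (by
      intro c v p
      ext <;> simp [smul_sub])

theorem ceStep_sq (v : g) (p : ExteriorAlgebra k g × ExteriorAlgebra k g) :
    ceStep k g v (ceStep k g v p) = (0 : QuadraticForm k g) v • p := by
  have h : ∀ a : ExteriorAlgebra k g, ExteriorAlgebra.ι k v * (ExteriorAlgebra.ι k v * a) = 0 := by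
    intro a
    rw [← mul_assoc, ExteriorAlgebra.ι_sq_zero, zero_mul]
  ext <;> simp [ceStep, h, adExt_ι_mul, mul_sub]

/-- The Chevalley–Eilenberg differential on `Λ(g)`,
`∂(v₁ ∧ ⋯ ∧ v_n) = ∑_{i<j} (-1)^(i+j) [v_i, v_j] ∧ v₁ ∧ ⋯ v̂_i ⋯ v̂_j ⋯ ∧ v_n`,
determined by `∂ 1 = 0` and `∂(v ∧ ω) = - ad_v ω - v ∧ ∂ω`. -/
def ceDiff : ExteriorAlgebra k g →ₗ[k] ExteriorAlgebra k g :=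
  (LinearMap.snd k _ _).comp
    (CliffordAlgebra.foldr (0 : QuadraticForm k g) (ceStep k g) (ceStep_sq k g) (1, 0))

/-- The odd derivation `d_1` of `T(Λ⁺(g)[-1])` extending the Chevalley–Eilenberg differential:
`d_1 [ω] = [∂ω]`. -/
def koszulD₁ : Koszul k g →ₗ[k] Koszul k g :=
  oddDeriv ((kgen k g).comp ((ceDiff k g).comp (extPos k g).subtype))

/-- `T(Λ⁺(g)[-1])[ħ]`. -/
abbrev HKoszul : Type _ := k[X] ⊗[k] Koszul k g

/-- The perturbed differential `d_ħ = d_0 + ħ d_1` on `T(Λ⁺(g)[-1])[ħ]`. -/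
def koszulDh : HKoszul k g →ₗ[k[X]] HKoszul k g :=
  (koszulD₀ k g).baseChange k[X] + (Polynomial.X : k[X]) • (koszulD₁ k g).baseChange k[X]

/-- The generator of `T(Λ⁺(g)[-1])[ħ]` given by `v₁ ∧ ⋯ ∧ v_n`. -/
def hxi {n : ℕ} (v : Fin n → g) : HKoszul k g := 1 ⊗ₜ kgen k g (ExteriorAlgebra.ιMulti k n v)

/-- The component of degree `-m` of `T(Λ⁺(g)[-1])[ħ]`. -/
def hkoszulDeg (m : ℕ) : Submodule k[X] (HKoszul k g) := (koszulDeg k g m).baseChange k[X]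

/-- `a ↦ (-1)^(deg a) a` on `T(Λ⁺(g)[-1])[ħ]`. -/
def hkoszulSign : HKoszul k g →ₐ[k[X]] HKoszul k g :=
  Algebra.TensorProduct.map (AlgHom.id k[X] k[X]) (koszulSign k g)

end ChevalleyEilenberg

end

open scoped TensorProduct DirectSum Polynomial

noncomputable section

/-! ### Separatedness of the filtration by powers of `ħ` -/

section Separated

variable {k V : Type*} [Field k] [AddCommGroup V] [Module k V]

/-! Separatedness is a matter of weights. Give `ħ` and every vector weight 1. A relator `uv - vu -
ħw` with `w` a vector is then homogeneous of weight 2, so the quotient `A` has a homomorphism to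
`A[t]` that records weights and is split by `t = 1`. An element of `ħ^(m+1) A` has no component of
weight `m`, hence `⋂ Γ_ℓ = 0` (`iInf_hFilt_eq_bot`). The Jacobi identity plays no role here.

The PBW statements all come from one representation. Over a commutative ring `R`, let `L` be a Lie
algebra with a totally ordered basis `b` and let `h` be a scalar. Then `L` acts on the polynomials
in variables `x_i` with commutators `h[x, y]`, and `b i` acts as multiplication by `x_i` up to lower
degree (`pbwRep`, `pbwRep_lie`). Only the commutation relation uses Jacobi. Words in the generators,
applied to `1`, recover their leading monomials. So the evident surjection from polynomials onto
`gr_F` is injective (`exists_gr_ascData_equiv`). The choices `h = ħ` over `k[ħ]`, `h = a` over `k`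
and `h = 1` give the `ħ`-linear theorem, the specializations and the classical theorem.

For the filtration by powers of `ħ`, the extra input is that `b i` acts as multiplication by `x_i`
up to a multiple of `h` (`pbwRep_sub_mem_smul`). Modulo `ħ`, the algebra `A` therefore acts through
`S(g)`. Polynomials over `k[ħ]` have no `ħ`-torsion, so `ħ^l a ∈ ħ^(l+1) A` forces the image of `a`
in `S(g)` to vanish (`HEnv.exists_reduction`).

The perturbed Koszul differential is treated independently of all this. Squares and anticommutators
of odd derivations are ordinary derivations, so they may be checked on generators. There `d_0² = 0`
is coassociativity of the coproduct (`coprod_coassoc`), `d_0 d_1 + d_1 d_0 = 0` says that `∂` is a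
coderivation (`coprod_ceDiff`), and `d_1² = 0` is `∂² = 0` (`ceDiff_ceDiff`). No step divides by 2.
-/

theorem Polynomial.commute_monomial_of_central {A : Type*} [Ring A] {c : A}
    (hc : ∀ a, Commute c a) (n : ℕ) (p : Polynomial A) : Commute (Polynomial.monomial n c) p := by
  rw [← Polynomial.C_mul_X_pow_eq_monomial]
  refine Commute.mul_left ?_ (Polynomial.commute_X_pow p n)
  ext m
  rw [Polynomial.coeff_C_mul, Polynomial.coeff_mul_C]
  exact hc _

theorem Polynomial.commute_aeval {R A : Type*} [CommRing R] [Ring A] [Algebra R A] {t a : A}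
    (h : Commute t a) (p : R[X]) : Commute (Polynomial.aeval t p) a := by
  induction p using Polynomial.induction_on' with
  | add p q hp hq =>
    rw [map_add]
    exact hp.add_left hq
  | monomial n c =>
    rw [Polynomial.aeval_monomial]
    exact (Algebra.commute_algebraMap_left _ _).mul_left (h.pow_left n)

/-- The quotient map onto `T(V)[ħ] / S`, over `k`. -/
abbrev quotMk (S : Set (HTensor k V)) : HTensor k V →ₐ[k] QuotBy S := RingQuot.mkAlgHom k _

/-- Bridges the quotient maps over `k[ħ]` and over `k`. The latter is needed because the weight map
moves `ħ` to `ħ t` and so is only `k`-linear. -/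
theorem algebraMap_quotBy (S : Set (HTensor k V)) (p : k[X]) :
    algebraMap k[X] (QuotBy S) p = quotMk S (p ⊗ₜ 1) := by
  have h := (RingQuot.mkAlgHom k[X] (fun a b : HTensor k V => a ∈ S ∧ b = 0)).commutes p
  rw [← h]
  refine (DFunLike.congr_fun (RingQuot.mkAlgHom_coe k[X] _) _).trans
    (DFunLike.congr_fun (RingQuot.mkAlgHom_coe k _) _).symm

/-- The algebra map `T(V)[ħ] → (T(V)[ħ] / S)[t]` with `v ↦ v t` and `ħ ↦ ħ t`. -/
def weightHom (S : Set (HTensor k V)) : HTensor k V →ₐ[k] Polynomial (QuotBy S) :=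
  Algebra.TensorProduct.lift
    (Polynomial.aeval (Polynomial.monomial 1 (algebraMap k[X] (QuotBy S) Polynomial.X)))
    (TensorAlgebra.lift k (((Polynomial.monomial 1).restrictScalars k).comp
      ((quotMk S).toLinearMap.comp
        ((TensorProduct.mk k k[X] (TensorAlgebra k V) 1).comp (TensorAlgebra.ι k)))))
    fun p _ => Polynomial.commute_aeval (Polynomial.commute_monomial_of_central
      (fun a => Algebra.commute_algebraMap_left _ a) 1 _) p

theorem weightHom_hvec (S : Set (HTensor k V)) (v : V) :
    weightHom S (hvec k v) = Polynomial.monomial 1 (quotMk S (hvec k v)) := by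
  refine (Algebra.TensorProduct.lift_tmul _ _ _ _ _).trans ?_
  rw [map_one, one_mul, TensorAlgebra.lift_ι_apply]
  rfl

theorem weightHom_X (S : Set (HTensor k V)) :
    weightHom S ((Polynomial.X : k[X]) ⊗ₜ 1) =
      Polynomial.monomial 1 (algebraMap k[X] (QuotBy S) Polynomial.X) := by
  refine (Algebra.TensorProduct.lift_tmul _ _ _ _ _).trans ?_
  rw [map_one, mul_one, Polynomial.aeval_X]

/-- The relators are homogeneous of weight 2, so the weight map descends to `W : A → A[t]`. Setting
`t = 1` inverts it on the left, while `W` sends `ħ^(m+1) A` into multiples of `t^(m+1)`. -/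
theorem iInf_hFilt_eq_bot (S : Set (HTensor k V))
    (hS : ∀ s ∈ S, ∃ u v w : V, s = hvec k u * hvec k v - hvec k v * hvec k u -
      (Polynomial.X : k[X]) • hvec k w) : ⨅ l, hFilt k (QuotBy S) l = ⊥ := by
  have hX : ∀ t : HTensor k V, (Polynomial.X : k[X]) • t = ((Polynomial.X : k[X]) ⊗ₜ 1) * t := by
    intro t
    exact Algebra.smul_def (A := HTensor k V) Polynomial.X t
  -- A relator goes to `t²` times its own class in the quotient, which is zero.
  have hW : ∀ s ∈ S, weightHom S s = 0 := by
    intro s hs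
    have h0 : quotMk S s = 0 := by
      rw [← map_zero (quotMk S)]
      exact RingQuot.mkAlgHom_rel k ⟨hs, rfl⟩
    obtain ⟨u, v, w, rfl⟩ := hS s hs
    rw [hX, map_sub, map_sub, map_mul, map_mul, map_mul] at h0 ⊢
    rw [weightHom_hvec, weightHom_hvec, weightHom_hvec, weightHom_X, Polynomial.monomial_mul_monomial,
      Polynomial.monomial_mul_monomial, Polynomial.monomial_mul_monomial, ← map_sub, ← map_sub,
      algebraMap_quotBy, h0, map_zero]
  let W : QuotBy S →ₐ[k] Polynomial (QuotBy S) := RingQuot.liftAlgHom k ⟨weightHom S, by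
    rintro _ _ ⟨hs, rfl⟩
    rw [hW _ hs, map_zero]⟩
  have hWmk : ∀ t, W (quotMk S t) = weightHom S t := fun t =>
    RingQuot.liftAlgHom_mkAlgHom_apply k _ _ t
  -- Evaluation at `t = 1`, a homomorphism although the coefficients do not commute, since `1` is
  -- central.
  let ev : Polynomial (QuotBy S) →ₐ[k] QuotBy S :=
    { Polynomial.eval₂RingHom' (RingHom.id _) 1 fun _ => Commute.one_right _ with
      commutes' := fun r => Polynomial.eval₂_C _ _ }
  have hevm : ∀ a, ev (Polynomial.monomial 1 a) = a := fun a =>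
    (Polynomial.eval₂_monomial _ _).trans (by simp)
  have hev : ∀ a, ev (W a) = a := by
    have h : ev.comp W = AlgHom.id k _ := by
      refine RingQuot.ringQuot_ext' _ _ _ (Algebra.TensorProduct.ext ?_ ?_)
      · refine Polynomial.algHom_ext ?_
        change ev (W (quotMk S _)) = quotMk S _
        rw [hWmk]
        refine (congrArg ev (weightHom_X S)).trans ?_
        rw [hevm, algebraMap_quotBy]
        rfl
      · refine TensorAlgebra.hom_ext (LinearMap.ext fun v => ?_)
        change ev (W (quotMk S _)) = quotMk S _
        rw [hWmk]
        exact (congrArg ev (weightHom_hvec S v)).trans (hevm _)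
    exact fun a => DFunLike.congr_fun h a
  refine eq_bot_iff.2 fun a ha => (Submodule.mem_bot k).2 ?_
  rw [← hev a]
  suffices h : W a = 0 by rw [h, map_zero]
  ext m
  -- Divisibility by `ħ^(m+1)` is what kills the coefficient of `t^m`.
  obtain ⟨b, hb⟩ := (Submodule.mem_iInf _).1 ha (m + 1)
  have hWX : W (algebraMap k[X] (QuotBy S) Polynomial.X) =
      Polynomial.C (algebraMap k[X] (QuotBy S) Polynomial.X) * Polynomial.X := by
    conv_lhs => rw [algebraMap_quotBy, hWmk, weightHom_X]
    rw [Polynomial.C_mul_X_eq_monomial]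
  rw [← hb, LinearMap.mulLeft_apply, map_mul, map_pow, map_pow, hWX,
    (Polynomial.commute_X _).symm.mul_pow, mul_assoc, ← Polynomial.C_pow, Polynomial.coeff_C_mul,
    (Polynomial.commute_X_pow _ _).eq, Polynomial.coeff_mul_X_pow', if_neg (by omega), mul_zero,
    Polynomial.coeff_zero]

end Separated

/-! ### A representation on polynomials -/

section PBWRep

open MvPolynomial

/-- The polynomials of total degree `< d`. -/
def lowDeg (I R : Type*) [CommRing R] (d : ℕ) : Submodule R (MvPolynomial I R) :=
  restrictSupport R {m | m.degree < d}

variable {I R : Type*} [CommRing R]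

theorem monomial_mem_lowDeg {d : ℕ} {m : I →₀ ℕ} (h : m.degree < d) (r : R) :
    monomial m r ∈ lowDeg I R d :=
  (monomial_mem_restrictSupport R).2 (.inl h)

theorem lowDeg_mono {d e : ℕ} (h : d ≤ e) : lowDeg I R d ≤ lowDeg I R e :=
  restrictSupport_mono R fun _ hm => lt_of_lt_of_le (b := d) hm h

/-- Applied to a `comap` or an equalizer, this reduces linear statements on polynomials of bounded
degree to monomials. -/
theorem lowDeg_le_iff {d : ℕ} {p : Submodule R (MvPolynomial I R)} :
    lowDeg I R d ≤ p ↔ ∀ m : I →₀ ℕ, m.degree < d → monomial m 1 ∈ p := by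
  rw [lowDeg, restrictSupport_eq_span, Submodule.span_le, Set.image_subset_iff]
  rfl

theorem exists_mem_lowDeg (p : MvPolynomial I R) : ∃ d, p ∈ lowDeg I R d := by
  induction p using MvPolynomial.induction_on' with
  | monomial m r => exact ⟨_, monomial_mem_lowDeg (Nat.lt_succ_self _) r⟩
  | add p q hp hq =>
    obtain ⟨d, hd⟩ := hp
    obtain ⟨e, he⟩ := hq
    exact ⟨max d e, add_mem (lowDeg_mono (le_max_left _ _) hd) (lowDeg_mono (le_max_right _ _) he)⟩

theorem X_mul_monomial_one (i : I) (m : I →₀ ℕ) :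
    X i * monomial m (1 : R) = monomial (Finsupp.single i 1 + m) 1 := by
  rw [X, monomial_mul, one_mul]

theorem X_mul_mem_lowDeg (i : I) {d : ℕ} {p : MvPolynomial I R} (hp : p ∈ lowDeg I R d) :
    X i * p ∈ lowDeg I R (d + 1) := by
  refine (lowDeg_le_iff (p := (lowDeg I R (d + 1)).comap (LinearMap.mulLeft R (X i)))).2 ?_ hp
  intro m hm
  rw [Submodule.mem_comap, LinearMap.mulLeft_apply, X_mul_monomial_one]
  refine monomial_mem_lowDeg ?_ _
  rw [map_add, Finsupp.degree_single]
  omega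

theorem linearMap_eq_of_mem_lowDeg {N : Type*} [AddCommGroup N] [Module R N] {d : ℕ}
    {f g : MvPolynomial I R →ₗ[R] N}
    (h : ∀ m : I →₀ ℕ, m.degree < d → f (monomial m 1) = g (monomial m 1))
    {p : MvPolynomial I R} (hp : p ∈ lowDeg I R d) : f p = g p :=
  (lowDeg_le_iff (p := LinearMap.eqLocus f g)).2 h hp

theorem single_add_tsub {m : I →₀ ℕ} {j : I} (hj : j ∈ m.support) :
    Finsupp.single j 1 + (m - Finsupp.single j 1) = m := by
  refine add_tsub_cancel_of_le ?_
  rw [Finsupp.single_le_iff]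
  exact Nat.one_le_iff_ne_zero.2 (Finsupp.mem_support_iff.1 hj)

section Approximation

variable {L : Type*} [LieRing L] [LieAlgebra R L] (b : Module.Basis I R L)

/-- `F` acts by multiplication up to terms of lower degree, on polynomials of degree `< n`. -/
def IsPBWUpTo (n : ℕ) (F : L →ₗ[R] Module.End R (MvPolynomial I R)) : Prop :=
  ∀ (i : I) (m : I →₀ ℕ), m.degree < n →
    F (b i) (monomial m 1) - X i * monomial m 1 ∈ lowDeg I R (m.degree + 1)

variable {b} in
theorem IsPBWUpTo.mem {n : ℕ} {F : L →ₗ[R] Module.End R (MvPolynomial I R)}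
    (hF : IsPBWUpTo b n F) (x : L) {d : ℕ} (hd : d ≤ n) {p : MvPolynomial I R}
    (hp : p ∈ lowDeg I R d) : F x p ∈ lowDeg I R (d + 1) := by
  have key : (⊤ : Submodule R L) ≤ (lowDeg I R (d + 1)).comap (F.flip p) := by
    rw [← b.span_eq, Submodule.span_le]
    rintro _ ⟨i, rfl⟩
    refine (lowDeg_le_iff (p := (lowDeg I R (d + 1)).comap (F (b i)))).2 ?_ hp
    intro m hm
    have h1 := hF i m (hm.trans_le hd)
    have h2 := X_mul_mem_lowDeg i (monomial_mem_lowDeg hm (1 : R))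
    have := add_mem (lowDeg_mono (by omega) h1) h2
    rwa [sub_add_cancel] at this
  exact key trivial

variable {b} in
theorem apply_eq_of_mem_lowDeg {n : ℕ} {F G : L →ₗ[R] Module.End R (MvPolynomial I R)}
    (hFG : ∀ (i : I) (m : I →₀ ℕ), m.degree < n → F (b i) (monomial m 1) = G (b i) (monomial m 1))
    (x : L) {p : MvPolynomial I R} (hp : p ∈ lowDeg I R n) : F x p = G x p := by
  have : F.flip p = G.flip p := b.ext fun i => linearMap_eq_of_mem_lowDeg (hFG i) hp
  exact LinearMap.congr_fun this x

end Approximation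

/-! ### The recursion for the action and its solution -/

variable [LinearOrder I] {L : Type*} [LieRing L] [LieAlgebra R L] (b : Module.Basis I R L) (h : R)

/-- The least variable of a monomial, when it is less than `i`. -/
def leastBelow (i : I) (m : I →₀ ℕ) (hm : ∃ j ∈ m.support, j < i) : I :=
  m.support.min' ⟨hm.choose, hm.choose_spec.1⟩

theorem leastBelow_mem (i : I) (m : I →₀ ℕ) (hm : ∃ j ∈ m.support, j < i) :
    leastBelow i m hm ∈ m.support :=
  Finset.min'_mem _ _

theorem leastBelow_le (i : I) (m : I →₀ ℕ) (hm : ∃ j ∈ m.support, j < i) {l : I}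
    (hl : l ∈ m.support) : leastBelow i m hm ≤ l :=
  Finset.min'_le _ _ hl

open Classical in
/-- The value at a monomial of the recursion defining the action of `b i`. -/
def pbwVal (F : L →ₗ[R] Module.End R (MvPolynomial I R)) (i : I) (m : I →₀ ℕ) :
    MvPolynomial I R :=
  if hm : ∃ j ∈ m.support, j < i then
    let j := leastBelow i m hm
    let z := monomial (m - Finsupp.single j 1) (1 : R)
    -- The desired relation solved for `b i` on `x_j z = b j · z`: it must equal `b j · (b i · z) +
    -- h [b i, b j] · z`. Write `b i · z = x_i z + w`. As `j` is minimal, `b j` multiplies `x_i z`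
    -- by `x_j`, while `w` has lower degree and is left to the recursion.
    X j * (X i * z) + F (b j) (F (b i) z - X i * z) + h • F ⁅b i, b j⁆ z
  else X i * monomial m 1

/-- The recursion defining the action on polynomials. -/
def pbwStep (F : L →ₗ[R] Module.End R (MvPolynomial I R)) :
    L →ₗ[R] Module.End R (MvPolynomial I R) :=
  b.constr R fun i => (basisMonomials I R).constr R (pbwVal b h F i)

theorem pbwStep_apply (F : L →ₗ[R] Module.End R (MvPolynomial I R)) (i : I) (m : I →₀ ℕ) :
    pbwStep b h F (b i) (monomial m 1) = pbwVal b h F i m := by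
  rw [pbwStep, Module.Basis.constr_basis]
  exact (congrArg _ (congrFun (coe_basisMonomials I R) m).symm).trans
    (Module.Basis.constr_basis _ _ _ _)

variable {b h}

/-- The recursion at `m` consults the action only in degrees below that of `m`: on `z`, and on `b i
· z - x_i z`. The bound on the degree of the latter is the reason for carrying `IsPBWUpTo` along. -/
theorem pbwVal_congr {n : ℕ} {F G : L →ₗ[R] Module.End R (MvPolynomial I R)}
    (hF : IsPBWUpTo b n F) (hFG : ∀ x, ∀ p ∈ lowDeg I R n, F x p = G x p) (i : I) (m : I →₀ ℕ)
    (hm : m.degree ≤ n) : pbwVal b h F i m = pbwVal b h G i m := by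
  unfold pbwVal
  split_ifs with hj
  · have e := congrArg Finsupp.degree (single_add_tsub (leastBelow_mem i m hj))
    rw [map_add, Finsupp.degree_single] at e
    have hN := monomial_mem_lowDeg (R := R) (d := n)
      (m := m - Finsupp.single (leastBelow i m hj) 1) (by omega) 1
    dsimp only
    rw [← hFG _ _ hN, ← hFG _ _ hN, hFG _ _ (lowDeg_mono _ (hF i _ _))]
    · omega
    · omega
  · rfl

/-- The leading term `x_j x_i z` is `x_i m`, and the two remaining terms have degree at most that of
`m`. -/
theorem IsPBWUpTo.step {n : ℕ} {F : L →ₗ[R] Module.End R (MvPolynomial I R)}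
    (hF : IsPBWUpTo b n F) : IsPBWUpTo b (n + 1) (pbwStep b h F) := by
  intro i m hm
  rw [pbwStep_apply, pbwVal]
  split_ifs with hj
  · have e' := single_add_tsub (leastBelow_mem i m hj)
    have e := congrArg Finsupp.degree e'
    rw [map_add, Finsupp.degree_single] at e
    dsimp only
    have e2 : X i * monomial m (1 : R) = X (leastBelow i m hj) *
        (X i * monomial (m - Finsupp.single (leastBelow i m hj) 1) (1 : R)) := by
      conv_lhs => rw [← e', ← X_mul_monomial_one]
      ring
    rw [e2, add_assoc, add_sub_cancel_left]
    refine add_mem (hF.mem _ (by omega) (lowDeg_mono ?_ (hF i _ ?_)))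
      (Submodule.smul_mem _ _ (hF.mem _ (d := m.degree) (by omega)
        (monomial_mem_lowDeg (by omega) _)))
    all_goals omega
  · rw [sub_self]
    exact zero_mem _

variable (b h)

/-- Successive approximations to the action, which stabilize on polynomials of degree `< n`. -/
def pbwApprox : ℕ → L →ₗ[R] Module.End R (MvPolynomial I R)
  | 0 => 0
  | n + 1 => pbwStep b h (pbwApprox n)

theorem isPBWUpTo_pbwApprox (n : ℕ) : IsPBWUpTo b n (pbwApprox b h n) := by
  induction n with
  | zero => exact fun i m hm => absurd hm (Nat.not_lt_zero _)
  | succ n ih => exact ih.step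

/-- Once the approximations agree in degrees below `n`, the recursion makes their successors agree
in degree `n` too, since it consults nothing else. -/
theorem pbwApprox_succ (n : ℕ) (x : L) {p : MvPolynomial I R} (hp : p ∈ lowDeg I R n) :
    pbwApprox b h n x p = pbwApprox b h (n + 1) x p := by
  induction n generalizing x p with
  | zero => exact apply_eq_of_mem_lowDeg (b := b) (fun i m hm => absurd hm (Nat.not_lt_zero _)) x hp
  | succ n ih =>
    refine apply_eq_of_mem_lowDeg (b := b) (fun i m hm => ?_) x hp
    exact (pbwStep_apply b h _ i m).trans ((pbwVal_congr (isPBWUpTo_pbwApprox b h n)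
      (fun x p hp => ih x hp) i m (Nat.lt_succ_iff.1 hm)).trans (pbwStep_apply b h _ i m).symm)

theorem pbwApprox_eq {n k : ℕ} (hnk : n ≤ k) (x : L) {p : MvPolynomial I R}
    (hp : p ∈ lowDeg I R n) : pbwApprox b h n x p = pbwApprox b h k x p := by
  induction k, hnk using Nat.le_induction with
  | base => rfl
  | succ k hk ih => exact ih.trans (pbwApprox_succ b h k x (lowDeg_mono hk hp))

/-- The action of `L`, with the bracket multiplied by `h`, on polynomials. -/
def pbwRep : L →ₗ[R] Module.End R (MvPolynomial I R) :=
  b.constr R fun i => (basisMonomials I R).constr R fun m =>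
    -- The first approximation that has stabilized on `m`.
    pbwApprox b h (m.degree + 1) (b i) (monomial m 1)

theorem pbwRep_apply (i : I) (m : I →₀ ℕ) :
    pbwRep b h (b i) (monomial m 1) = pbwApprox b h (m.degree + 1) (b i) (monomial m 1) := by
  rw [pbwRep, Module.Basis.constr_basis]
  exact (congrArg _ (congrFun (coe_basisMonomials I R) m).symm).trans
    (Module.Basis.constr_basis _ _ _ _)

theorem pbwRep_eq_pbwApprox {n : ℕ} (x : L) {p : MvPolynomial I R} (hp : p ∈ lowDeg I R n) :
    pbwApprox b h n x p = pbwRep b h x p := by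
  refine apply_eq_of_mem_lowDeg (b := b) (fun i m hm => ?_) x hp
  rw [pbwRep_apply]
  exact (pbwApprox_eq b h hm (b i) (monomial_mem_lowDeg (Nat.lt_succ_self _) 1)).symm

/-- Passage to the limit in the recursion: on everything consulted at `m` the approximation already
equals the limit. -/
theorem pbwRep_eq_pbwVal (i : I) (m : I →₀ ℕ) :
    pbwRep b h (b i) (monomial m 1) = pbwVal b h (pbwRep b h) i m := by
  rw [pbwRep_apply]
  exact (pbwStep_apply b h _ i m).trans (pbwVal_congr (isPBWUpTo_pbwApprox b h _)
    (fun x p hp => pbwRep_eq_pbwApprox b h x hp) i m le_rfl)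

theorem isPBWUpTo_pbwRep (n : ℕ) : IsPBWUpTo b n (pbwRep b h) := by
  intro i m _
  rw [pbwRep_apply]
  exact isPBWUpTo_pbwApprox b h _ i m (Nat.lt_succ_self _)

theorem pbwRep_sub_mem_lowDeg (i : I) {d : ℕ} {p : MvPolynomial I R} (hp : p ∈ lowDeg I R d) :
    pbwRep b h (b i) p - X i * p ∈ lowDeg I R d := by
  have hle : lowDeg I R d ≤ (lowDeg I R d).comap
      (pbwRep b h (b i) - LinearMap.mulLeft R (X i)) := by
    refine lowDeg_le_iff.2 fun m hm => ?_
    rw [Submodule.mem_comap, LinearMap.sub_apply, LinearMap.mulLeft_apply]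
    exact lowDeg_mono (Nat.succ_le_of_lt hm)
      (isPBWUpTo_pbwRep b h (m.degree + 1) i m (Nat.lt_succ_self m.degree))
  have := hle hp
  rwa [Submodule.mem_comap, LinearMap.sub_apply, LinearMap.mulLeft_apply] at this

theorem pbwRep_mem_lowDeg (x : L) {d : ℕ} {p : MvPolynomial I R} (hp : p ∈ lowDeg I R d) :
    pbwRep b h x p ∈ lowDeg I R (d + 1) :=
  (isPBWUpTo_pbwRep b h d).mem x le_rfl hp

theorem pbwRep_of_forall_le {i : I} {m : I →₀ ℕ} (hm : ∀ j ∈ m.support, i ≤ j) :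
    pbwRep b h (b i) (monomial m 1) = X i * monomial m 1 := by
  rw [pbwRep_eq_pbwVal, pbwVal, dif_neg]
  rintro ⟨j, hj, hij⟩
  exact (hm j hj).not_gt hij

theorem pbwRep_X_mul {i j : I} (hji : j < i) {m : I →₀ ℕ} (hm : ∀ l ∈ m.support, j ≤ l) :
    pbwRep b h (b i) (X j * monomial m 1) = X j * (X i * monomial m 1) +
      pbwRep b h (b j) (pbwRep b h (b i) (monomial m 1) - X i * monomial m 1) +
      h • pbwRep b h ⁅b i, b j⁆ (monomial m 1) := by
  have hj : j ∈ (Finsupp.single j 1 + m).support := by simp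
  have hex : ∃ l ∈ (Finsupp.single j 1 + m).support, l < i := ⟨j, hj, hji⟩
  have e : leastBelow i _ hex = j := by
    refine le_antisymm (leastBelow_le _ _ _ hj) ?_
    have h1 := Finsupp.support_add (leastBelow_mem i _ hex)
    rcases Finset.mem_union.1 h1 with h2 | h2
    · exact (Finset.mem_singleton.1 (Finsupp.support_single_subset h2)).ge
    · exact hm _ h2
  rw [X_mul_monomial_one, pbwRep_eq_pbwVal, pbwVal, dif_pos hex]
  dsimp only
  rw [e, add_tsub_cancel_left]

/-- When `j` is minimal the recursion is the commutation relation itself: `b j` acts on both `m` and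
`x_i m` as multiplication by `x_j`, so the leading and correction terms recombine into `b j · (b i ·
m)`. -/
theorem pbwRep_comm_of_le {i j : I} (hji : j < i) {m : I →₀ ℕ} (hm : ∀ l ∈ m.support, j ≤ l) :
    pbwRep b h (b i) (pbwRep b h (b j) (monomial m 1)) =
      pbwRep b h (b j) (pbwRep b h (b i) (monomial m 1)) +
      h • pbwRep b h ⁅b i, b j⁆ (monomial m 1) := by
  rw [pbwRep_of_forall_le b h hm, pbwRep_X_mul b h hji hm, map_sub, X_mul_monomial_one i m,
    pbwRep_of_forall_le b h (i := j)]
  · abel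
  · intro l hl
    rcases Finset.mem_union.1 (Finsupp.support_add hl) with h2 | h2
    · rw [Finset.mem_singleton.1 (Finsupp.support_single_subset h2)]
      exact hji.le
    · exact hm _ h2

theorem monomial_eq_X_mul_of_ne_zero {m : I →₀ ℕ} (hm : m ≠ 0) :
    ∃ (j : I) (n : I →₀ ℕ), monomial m (1 : R) = X j * monomial n 1 ∧
      n.degree + 1 = m.degree ∧ j ∈ m.support ∧ (∀ l ∈ m.support, j ≤ l) ∧
      ∀ l ∈ n.support, j ≤ l := by
  have hs := Finsupp.support_nonempty_iff.2 hm
  refine ⟨m.support.min' hs, m - Finsupp.single (m.support.min' hs) 1, ?_, ?_,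
    Finset.min'_mem _ _, fun l hl => Finset.min'_le _ _ hl, fun l hl => Finset.min'_le _ _ ?_⟩
  · rw [X_mul_monomial_one, single_add_tsub (Finset.min'_mem _ _)]
  · have e := congrArg Finsupp.degree (single_add_tsub (Finset.min'_mem _ hs))
    rw [map_add, Finsupp.degree_single] at e
    omega
  · exact Finsupp.support_tsub hl

/-- The commutation relation on polynomials of degree `< n`. -/
theorem pbwRep_lie_of_mem (n : ℕ) (x y : L) {p : MvPolynomial I R} (hp : p ∈ lowDeg I R n) :
    pbwRep b h x (pbwRep b h y p) =
      pbwRep b h y (pbwRep b h x p) + h • pbwRep b h ⁅x, y⁆ p := by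
  induction n generalizing x y p with
  | zero =>
    have : lowDeg I R 0 ≤ ⊥ := lowDeg_le_iff.2 fun m hm => absurd hm (Nat.not_lt_zero _)
    rw [(Submodule.mem_bot R).1 (this hp)]
    simp
  | succ n ih =>
    have key : ∀ i j : I, ∀ m : I →₀ ℕ, m.degree < n + 1 →
        pbwRep b h (b i) (pbwRep b h (b j) (monomial m 1)) =
          pbwRep b h (b j) (pbwRep b h (b i) (monomial m 1)) +
          h • pbwRep b h ⁅b i, b j⁆ (monomial m 1) := by
      intro i j m hmn
      -- The relation is antisymmetric in `i` and `j` and trivial for `i = j`.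
      wlog hij : j < i generalizing i j
      · rcases lt_trichotomy i j with h1 | h1 | h1
        · rw [this j i h1, ← lie_skew (b i) (b j), map_neg, LinearMap.neg_apply, smul_neg,
            add_neg_cancel_right]
        · subst h1
          simp
        · exact absurd h1 hij
      by_cases hm : ∀ l ∈ m.support, j ≤ l
      · exact pbwRep_comm_of_le b h hij hm
      have hm0 : m ≠ 0 := by
        rintro rfl
        simp at hm
      -- The case not built into the recursion: the least variable `k` of `m = x_k q` lies below
      -- both `i` and `j`.
      obtain ⟨k, q, hq, hdeg, hk, hkm, hkq⟩ := monomial_eq_X_mul_of_ne_zero (R := R) hm0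
      have hkj : k < j := by
        by_contra hjk
        exact hm fun l hl => (not_lt.1 hjk).trans (hkm l hl)
      have hki : k < i := hkj.trans hij
      have hqn : monomial q (1 : R) ∈ lowDeg I R n := monomial_mem_lowDeg (by omega) 1
      -- Replaces `x_k q` by `b k · q` and moves `b k` to the left past `b v` and `b u`.
      have swap : ∀ u v : I, k < u → k < v →
          pbwRep b h (b u) (pbwRep b h (b v) (monomial m 1)) =
            pbwRep b h (b k) (pbwRep b h (b u) (pbwRep b h (b v) (monomial q 1))) +
            h • pbwRep b h ⁅b u, b k⁆ (pbwRep b h (b v) (monomial q 1)) +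
            h • (pbwRep b h ⁅b v, b k⁆ (pbwRep b h (b u) (monomial q 1)) +
              h • pbwRep b h ⁅b u, ⁅b v, b k⁆⁆ (monomial q 1)) := by
        intro u v hu hv
        -- The vector `b v · q` may have the same degree as `m`, out of reach of the induction. Its
        -- leading part `x_v q` has `k` below all its variables and is covered by the explicit case;
        -- only the rest `w` needs the induction.
        have hw : pbwRep b h (b v) (monomial q 1) - X v * monomial q 1 ∈ lowDeg I R n :=
          pbwRep_sub_mem_lowDeg b h v hqn
        have h2 : pbwRep b h (b u) (pbwRep b h (b k) (pbwRep b h (b v) (monomial q 1))) =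
            pbwRep b h (b k) (pbwRep b h (b u) (pbwRep b h (b v) (monomial q 1))) +
            h • pbwRep b h ⁅b u, b k⁆ (pbwRep b h (b v) (monomial q 1)) := by
          have h3 := ih (b u) (b k) hw
          have h4 : pbwRep b h (b u) (pbwRep b h (b k) (X v * monomial q 1)) =
              pbwRep b h (b k) (pbwRep b h (b u) (X v * monomial q 1)) +
              h • pbwRep b h ⁅b u, b k⁆ (X v * monomial q 1) := by
            rw [X_mul_monomial_one]
            refine pbwRep_comm_of_le b h hu fun l hl => ?_
            rcases Finset.mem_union.1 (Finsupp.support_add hl) with h2 | h2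
            · rw [Finset.mem_singleton.1 (Finsupp.support_single_subset h2)]
              exact hv.le
            · exact hkq _ h2
          rw [← sub_add_cancel (pbwRep b h (b v) (monomial q 1)) (X v * monomial q 1)]
          generalize pbwRep b h (b v) (monomial q 1) - X v * monomial q 1 = w at h3
          simp only [map_add, smul_add, h3, h4]
          abel
        rw [hq, ← pbwRep_of_forall_le b h hkq, ih (b v) (b k) hqn, map_add, map_smul, h2,
          ih (b u) ⁅b v, b k⁆ hqn]
      -- Antisymmetrizing in `i` and `j`, the terms quadratic in brackets cancel by Jacobi, in the
      -- form `lie_lie`.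
      rw [swap i j hki hkj, swap j i hkj hki, ih (b i) (b j) hqn, hq,
        ← pbwRep_of_forall_le b h hkq, ih ⁅b i, b j⁆ (b k) hqn, lie_lie]
      simp only [map_add, map_sub, map_smul, smul_add, smul_sub, LinearMap.sub_apply]
      abel
    have h1 : ∀ i j : I, pbwRep b h (b i) (pbwRep b h (b j) p) =
        pbwRep b h (b j) (pbwRep b h (b i) p) + h • pbwRep b h ⁅b i, b j⁆ p := fun i j =>
      linearMap_eq_of_mem_lowDeg (f := pbwRep b h (b i) * pbwRep b h (b j))
        (g := pbwRep b h (b j) * pbwRep b h (b i) + h • pbwRep b h ⁅b i, b j⁆) (key i j) hp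
    have h2 : ∀ (i : I) (y : L), pbwRep b h (b i) (pbwRep b h y p) =
        pbwRep b h y (pbwRep b h (b i) p) + h • pbwRep b h ⁅b i, y⁆ p := by
      intro i y
      induction b.mem_span y using Submodule.span_induction with
      | zero => simp
      | add u v _ _ hu hv =>
        simp only [map_add, LinearMap.add_apply, lie_add, hu, hv, smul_add]
        abel
      | smul r u _ hu => simp only [map_smul, LinearMap.smul_apply, lie_smul, hu, smul_add, smul_comm h]
      | mem _ hj =>
        obtain ⟨j, rfl⟩ := hj
        exact h1 i j
    induction b.mem_span x using Submodule.span_induction with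
    | zero => simp
    | add u v _ _ hu hv =>
      simp only [map_add, LinearMap.add_apply, add_lie, hu, hv, smul_add]
      abel
    | smul r u _ hu => simp only [map_smul, LinearMap.smul_apply, smul_lie, hu, smul_add, smul_comm h]
    | mem _ hj =>
      obtain ⟨j, rfl⟩ := hj
      exact h2 j y

theorem pbwRep_lie (x y : L) :
    pbwRep b h x * pbwRep b h y - pbwRep b h y * pbwRep b h x = h • pbwRep b h ⁅x, y⁆ := by
  refine LinearMap.ext fun p => ?_
  obtain ⟨d, hd⟩ := exists_mem_lowDeg p
  refine sub_eq_iff_eq_add'.2 ?_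
  exact pbwRep_lie_of_mem b h d x y hd

/-- In the recursion the bracket term carries a factor `h`, and the correction `b i · q - x_i q`
does so by induction on the degree. At `h = 0` the action is therefore plain multiplication. -/
theorem pbwRep_sub_mem_smul (i : I) (p : MvPolynomial I R) :
    ∃ q, pbwRep b h (b i) p - X i * p = h • q := by
  have key : ∀ n : ℕ, ∀ i, ∀ p ∈ lowDeg I R n, ∃ q, pbwRep b h (b i) p - X i * p = h • q := by
    intro n
    induction n with
    | zero =>
      intro i p hp
      have : lowDeg I R 0 ≤ ⊥ := lowDeg_le_iff.2 fun m hm => absurd hm (Nat.not_lt_zero _)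
      rw [(Submodule.mem_bot R).1 (this hp)]
      exact ⟨0, by simp⟩
    | succ n ih =>
      intro i p hp
      have hle : lowDeg I R (n + 1) ≤ (LinearMap.range (LinearMap.lsmul R (MvPolynomial I R) h)).comap
          (pbwRep b h (b i) - LinearMap.mulLeft R (X i)) := by
        refine lowDeg_le_iff.2 fun m hm => ?_
        by_cases hmi : ∀ j ∈ m.support, i ≤ j
        · refine ⟨0, ?_⟩
          rw [LinearMap.sub_apply, pbwRep_of_forall_le b h hmi]
          simp
        · have hm0 : m ≠ 0 := by
            rintro rfl
            simp at hmi
          obtain ⟨j, q, hq, hdeg, hj, hjm, hjq⟩ := monomial_eq_X_mul_of_ne_zero (R := R) hm0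
          have hji : j < i := by
            by_contra hij
            exact hmi fun l hl => (not_lt.1 hij).trans (hjm l hl)
          obtain ⟨w, hw⟩ := ih i (monomial q 1) (monomial_mem_lowDeg (by omega) 1)
          refine ⟨pbwRep b h (b j) w + pbwRep b h ⁅b i, b j⁆ (monomial q 1), ?_⟩
          rw [LinearMap.sub_apply, hq, pbwRep_X_mul b h hji hjq, hw, LinearMap.mulLeft_apply,
            map_smul, LinearMap.lsmul_apply, smul_add, mul_left_comm (X i)]
          abel
      obtain ⟨q, hq⟩ := hle hp
      exact ⟨q, hq.symm⟩
  obtain ⟨d, hd⟩ := exists_mem_lowDeg p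
  exact key d i p hd

end PBWRep

/-! ### Associated graded algebras with commuting generators -/

section Commuting

open scoped IsMulCommutative

variable {R G : Type*} [CommRing R] [Ring G] [Algebra R G]

/-- Evaluation needs a commutative target, so it is performed in the subalgebra generated by the
commuting elements. -/
theorem exists_mvPolynomial_algHom {I : Type*} (c : I → G) (hc : ∀ i j, c i * c j = c j * c i) :
    ∃ f : MvPolynomial I R →ₐ[R] G, ∀ i, f (MvPolynomial.X i) = c i := by
  have hs : ∀ a ∈ Set.range c, ∀ a' ∈ Set.range c, a * a' = a' * a := by
    rintro _ ⟨i, rfl⟩ _ ⟨j, rfl⟩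
    exact hc i j
  have := Algebra.isMulCommutative_adjoin R hs
  let F : MvPolynomial I R →ₐ[R] Algebra.adjoin R (Set.range c) :=
    MvPolynomial.aeval fun i => ⟨c i, Algebra.subset_adjoin ⟨i, rfl⟩⟩
  refine ⟨(Algebra.adjoin R (Set.range c)).val.comp F, fun i => ?_⟩
  rw [AlgHom.comp_apply, MvPolynomial.aeval_X]
  rfl

theorem exists_symmetricAlgebra_algHom {V : Type*} [AddCommGroup V] [Module R V] (c : V →ₗ[R] G)
    (hc : ∀ v w, c v * c w = c w * c v) :
    ∃ f : SymmetricAlgebra R V →ₐ[R] G, ∀ v, f (SymmetricAlgebra.ι R V v) = c v := by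
  have hs : ∀ a ∈ Set.range c, ∀ a' ∈ Set.range c, a * a' = a' * a := by
    rintro _ ⟨i, rfl⟩ _ ⟨j, rfl⟩
    exact hc i j
  have := Algebra.isMulCommutative_adjoin R hs
  let F : SymmetricAlgebra R V →ₐ[R] Algebra.adjoin R (Set.range c) :=
    SymmetricAlgebra.lift (c.codRestrict (Subalgebra.toSubmodule (Algebra.adjoin R (Set.range c)))
      fun v => Algebra.subset_adjoin ⟨v, rfl⟩)
  refine ⟨(Algebra.adjoin R (Set.range c)).val.comp F, fun v => ?_⟩
  rw [AlgHom.comp_apply, SymmetricAlgebra.lift_ι_apply]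
  rfl

end Commuting

/-! ### Symbols of elements in an associated graded algebra -/

namespace FiltData

variable {R A : Type*} [CommRing R] [Ring A] [Algebra R A] (D : FiltData R A)

theorem symb_congr {m n : ℕ} (h : m = n) {a b : A} (hab : a = b) (ha : a ∈ D.top m)
    (hb : b ∈ D.top n) : D.symb m a ha = D.symb n b hb := by
  subst h
  subst hab
  rfl

theorem symb_mul_symb {m n : ℕ} {a b : A} (ha : a ∈ D.top m) (hb : b ∈ D.top n) :
    D.symb m a ha * D.symb n b hb = D.symb (m + n) (a * b) (D.mul_mem ha hb) :=
  DirectSum.of_mul_of _ _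

theorem symb_one : D.symb 0 1 D.one_mem = 1 := rfl

theorem symb_add {n : ℕ} {a b : A} (ha : a ∈ D.top n) (hb : b ∈ D.top n) :
    D.symb n (a + b) (add_mem ha hb) = D.symb n a ha + D.symb n b hb :=
  ((DirectSum.lof R ℕ D.piece n).comp (D.cls n)).map_add ⟨a, ha⟩ ⟨b, hb⟩

theorem symb_smul {n : ℕ} (r : R) {a : A} (ha : a ∈ D.top n) :
    D.symb n (r • a) (Submodule.smul_mem _ r ha) = r • D.symb n a ha :=
  ((DirectSum.lof R ℕ D.piece n).comp (D.cls n)).map_smul r ⟨a, ha⟩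

theorem cls_eq_zero_iff {n : ℕ} {a : A} (ha : a ∈ D.top n) :
    D.cls n ⟨a, ha⟩ = 0 ↔ a ∈ D.bot n :=
  Submodule.Quotient.mk_eq_zero _

theorem symb_eq_zero {n : ℕ} {a : A} (ha : a ∈ D.bot n) : D.symb n a (D.bot_le n ha) = 0 := by
  rw [symb, (D.cls_eq_zero_iff _).2 ha, map_zero]

theorem symb_eq {n : ℕ} {a b : A} (ha : a ∈ D.top n) (hb : b ∈ D.top n) (h : a - b ∈ D.bot n) :
    D.symb n a ha = D.symb n b hb :=
  congrArg (DirectSum.lof R ℕ D.piece n) (D.cls_eq h)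

theorem symb_mem_grPiece {n : ℕ} {a : A} (ha : a ∈ D.top n) : D.symb n a ha ∈ D.grPiece n :=
  ⟨_, rfl⟩

theorem exists_symb_of_mem_grPiece {n : ℕ} {x : D.gr} (hx : x ∈ D.grPiece n) :
    ∃ (a : A) (ha : a ∈ D.top n), D.symb n a ha = x := by
  obtain ⟨y, rfl⟩ := hx
  obtain ⟨a, rfl⟩ := D.cls_surjective n y
  exact ⟨a, a.2, rfl⟩

theorem eq_top_of_grPiece_le {p : Submodule R D.gr} (h : ∀ n, D.grPiece n ≤ p) : p = ⊤ := by
  refine eq_top_iff.2 fun x _ => ?_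
  induction x using DirectSum.induction_on with
  | zero => exact zero_mem p
  | of n y => exact h n ⟨y, rfl⟩
  | add x y hx hy => exact add_mem (hx trivial) (hy trivial)

theorem mem_bot_of_sum_symb_eq_zero (s : Finset ℕ) (a : ℕ → A) (ha : ∀ n, a n ∈ D.top n)
    (h : ∑ n ∈ s, D.symb n (a n) (ha n) = 0) {n : ℕ} (hn : n ∈ s) : a n ∈ D.bot n := by
  rw [← D.cls_eq_zero_iff (ha n)]
  have h1 := congrArg (DirectSum.component R ℕ D.piece n) h
  rw [map_sum, map_zero, Finset.sum_eq_single n, symb, DirectSum.component.lof_self] at h1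
  · exact h1
  · intro m _ hmn
    rw [symb, DirectSum.component.of, dif_neg hmn]
  · exact fun h2 => absurd hn h2

end FiltData

/-! ### The associated graded algebra of a filtration by degree -/

section Asc

variable {R V B I : Type*} [CommRing R] [Ring B] [Algebra R B]

/-- Basis vectors generate the same filtration. The span is over `R`, which may be larger than the
field over which `V` is a vector space: over `k[ħ]` the generating map is not linear over the ground
ring. -/
theorem wordFilt_comp_eq (gen : V → B) (g : I → V)
    (hspan : ∀ v, gen v ∈ Submodule.span R (Set.range (gen ∘ g))) (n : ℕ) :
    wordFilt R (gen ∘ g) n = wordFilt R gen n := by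
  refine le_antisymm (Submodule.span_mono ?_) (Submodule.span_le.2 ?_)
  · rintro _ ⟨l, hl, rfl⟩
    exact ⟨l.map g, by simpa using hl, by simp⟩
  · rintro _ ⟨l, hl, rfl⟩
    induction l generalizing n with
    | nil => exact Submodule.subset_span ⟨[], hl, rfl⟩
    | cons v l ih =>
      obtain ⟨n, rfl⟩ : ∃ m, n = 1 + m := ⟨n - 1, by simp at hl; omega⟩
      have h1 : gen v ∈ wordFilt R (gen ∘ g) 1 := by
        refine (Submodule.span_le.2 ?_ : Submodule.span R (Set.range (gen ∘ g)) ≤ _) (hspan v)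
        rintro _ ⟨i, rfl⟩
        exact gen_mem_wordFilt R (gen ∘ g) i
      rw [List.map_cons, List.prod_cons]
      exact wordFilt_mul_mem R _ h1 (ih n (by simp at hl; omega))

theorem word_mem_wordFilt (gen : V → B) (l : List V) :
    (l.map gen).prod ∈ wordFilt R gen l.length :=
  Submodule.subset_span ⟨l, le_rfl, rfl⟩

open MvPolynomial in
theorem exists_list_prod_eq_monomial (m : I →₀ ℕ) :
    ∃ l : List I, l.length = m.degree ∧ (l.map X).prod = monomial m (1 : R) := by
  induction m using Finsupp.induction_linear with
  | zero => exact ⟨[], by simp, rfl⟩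
  | add m n hm hn =>
    obtain ⟨l, h1, h2⟩ := hm
    obtain ⟨l', h3, h4⟩ := hn
    refine ⟨l ++ l', by simp [h1, h3], ?_⟩
    rw [List.map_append, List.prod_append, h2, h4, monomial_mul, one_mul]
  | single i n =>
    exact ⟨List.replicate n i, by simp, by simp [X_pow_eq_monomial]⟩

open MvPolynomial in
theorem degree_eq_of_mem_homogeneousSubmodule {n : ℕ} {p : MvPolynomial I R}
    (hp : p ∈ homogeneousSubmodule I R n) {m : I →₀ ℕ} (hm : p.coeff m ≠ 0) : m.degree = n := by
  have := hp hm
  rwa [Finsupp.degree_eq_weight_one]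

open MvPolynomial in
theorem homogeneousSubmodule_eq_span (n : ℕ) : homogeneousSubmodule I R n =
    Submodule.span R {p | ∃ l : List I, l.length = n ∧ (l.map X).prod = p} := by
  refine le_antisymm ?_ (Submodule.span_le.2 ?_)
  · intro p hp
    rw [p.as_sum]
    refine Submodule.sum_mem _ fun m hm => ?_
    rw [← mul_one (p.coeff m), ← smul_eq_mul, ← smul_monomial]
    obtain ⟨l, h1, h2⟩ := exists_list_prod_eq_monomial (R := R) m
    exact Submodule.smul_mem _ _ (Submodule.subset_span
      ⟨l, h1.trans (degree_eq_of_mem_homogeneousSubmodule hp (mem_support_iff.1 hm)), h2⟩)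
  · rintro _ ⟨l, rfl, rfl⟩
    induction l with
    | nil => exact isHomogeneous_one _ _
    | cons i l ih =>
      rw [List.map_cons, List.prod_cons, List.length_cons, add_comm]
      exact (isHomogeneous_X R i).mul ih

open MvPolynomial in
theorem eq_zero_of_mem_homogeneousSubmodule_of_mem_lowDeg {n : ℕ} {p : MvPolynomial I R}
    (hp : p ∈ homogeneousSubmodule I R n) (hl : p ∈ lowDeg I R n) : p = 0 := by
  ext m
  by_contra hm
  rw [coeff_zero] at hm
  have h1 : m.degree < n := hl (mem_support_iff.2 hm)
  exact h1.ne (degree_eq_of_mem_homogeneousSubmodule hp hm)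

open MvPolynomial in
theorem prod_map_X_mem_lowDeg (l : List I) :
    (l.map (X (R := R))).prod ∈ lowDeg I R (l.length + 1) := by
  induction l with
  | nil => exact monomial_mem_lowDeg (by simp) 1
  | cons i l ih =>
    rw [List.map_cons, List.prod_cons]
    exact X_mul_mem_lowDeg i ih

open MvPolynomial in
-- Commutators of generators fall into `F_1`, so classes of generators commute and polynomials map
-- onto `gr_F`. The linear map `σ` reads leading terms off words and thereby detects injectivity; it
-- need not respect products.
theorem exists_gr_ascData_equiv (gen : V → B) (g : I → V)
    (hspan : ∀ v, gen v ∈ Submodule.span R (Set.range (gen ∘ g)))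
    (hcomm : ∀ i j, gen (g i) * gen (g j) - gen (g j) * gen (g i) ∈ wordFilt R gen 1)
    (σ : B →ₗ[R] MvPolynomial I R)
    (hσ : ∀ l : List I, σ (l.map (gen ∘ g)).prod - (l.map X).prod ∈ lowDeg I R l.length) :
    ∃ e : (ascData R gen).gr ≃ₐ[R] MvPolynomial I R,
      (∀ n, ((ascData R gen).grPiece n).map e.toLinearMap = homogeneousSubmodule I R n) ∧
      ∀ i, e ((ascData R gen).symb 1 (gen (g i)) (gen_mem_wordFilt R gen (g i))) = X i := by
  let D := ascData R gen
  have hgen : ∀ i, gen (g i) ∈ D.top 1 := fun i => gen_mem_wordFilt R gen (g i)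
  have hword : ∀ l : List I, (l.map (gen ∘ g)).prod ∈ D.top l.length := fun l => by
    have := word_mem_wordFilt (R := R) gen (l.map g)
    rwa [List.length_map, List.map_map] at this
  obtain ⟨j, hj⟩ := exists_mvPolynomial_algHom (R := R)
    (fun i => D.symb 1 (gen (g i)) (hgen i))
    (fun i i' => by
      rw [D.symb_mul_symb, D.symb_mul_symb]
      exact D.symb_eq _ _ (hcomm i i'))
  have hjw : ∀ l : List I, j (l.map X).prod = D.symb l.length _ (hword l) := by
    intro l
    induction l with
    | nil => exact (map_one j).trans D.symb_one.symm
    | cons i l ih =>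
      rw [List.map_cons, List.prod_cons, map_mul, hj, ih, D.symb_mul_symb]
      exact D.symb_congr (add_comm _ _) (by simp) _ _
  -- One lift `a` witnesses both facts: its class is `j s`, and `σ a` has leading part `s`.
  -- Comparing them gives injectivity.
  have hlift : ∀ (n : ℕ), ∀ s ∈ homogeneousSubmodule I R n,
      ∃ (a : B) (ha : a ∈ D.top n), j s = D.symb n a ha ∧ σ a - s ∈ lowDeg I R n := by
    intro n s hs
    rw [homogeneousSubmodule_eq_span] at hs
    induction hs using Submodule.span_induction with
    | mem s hs =>
      obtain ⟨l, rfl, rfl⟩ := hs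
      exact ⟨_, hword l, hjw l, hσ l⟩
    | zero => exact ⟨0, zero_mem _, by rw [map_zero, D.symb_eq_zero (zero_mem _)], by simp⟩
    | add s t _ _ hs ht =>
      obtain ⟨a, ha, h1, h2⟩ := hs
      obtain ⟨b, hb, h3, h4⟩ := ht
      refine ⟨a + b, add_mem ha hb, by rw [map_add, h1, h3, D.symb_add], ?_⟩
      rw [map_add, add_sub_add_comm]
      exact add_mem h2 h4
    | smul r s _ hs =>
      obtain ⟨a, ha, h1, h2⟩ := hs
      refine ⟨r • a, Submodule.smul_mem _ r ha, by rw [map_smul, h1, D.symb_smul], ?_⟩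
      rw [map_smul, ← smul_sub]
      exact Submodule.smul_mem _ r h2
  have hpiece : ∀ n, (homogeneousSubmodule I R n).map j.toLinearMap = D.grPiece n := by
    intro n
    apply le_antisymm
    · rintro _ ⟨s, hs, rfl⟩
      obtain ⟨a, ha, h1, -⟩ := hlift n s hs
      exact h1 ▸ D.symb_mem_grPiece ha
    · intro x hx
      obtain ⟨a, ha, rfl⟩ := D.exists_symb_of_mem_grPiece hx
      have ha' : a ∈ wordFilt R (gen ∘ g) n := by
        rw [wordFilt_comp_eq gen g hspan]
        exact ha
      clear hx
      have htop : ∀ a ∈ wordFilt R (gen ∘ g) n, a ∈ D.top n := fun a h => by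
        rwa [wordFilt_comp_eq gen g hspan] at h
      induction ha' using Submodule.span_induction with
      | mem a h =>
        obtain ⟨l, hl, rfl⟩ := h
        -- A word shorter than `n` has zero class in degree `n`.
        rcases hl.lt_or_eq with hl | rfl
        · obtain ⟨n, rfl⟩ : ∃ m, n = m + 1 := ⟨n - 1, by omega⟩
          rw [D.symb_eq_zero (n := n + 1)]
          · exact zero_mem _
          · exact wordFilt_mono R gen (Nat.lt_succ_iff.1 hl) (hword l)
        · rw [← hjw]
          refine Submodule.mem_map_of_mem ?_
          rw [homogeneousSubmodule_eq_span]
          exact Submodule.subset_span ⟨l, rfl, rfl⟩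
      | zero =>
        rw [D.symb_eq_zero (zero_mem _)]
        exact zero_mem _
      | add a b h1 h2 iha ihb =>
        rw [D.symb_add (htop a h1) (htop b h2)]
        exact add_mem (iha _) (ihb _)
      | smul r a h1 iha =>
        rw [D.symb_smul r (htop a h1)]
        exact Submodule.smul_mem _ r (iha _)
  have hσlow : ∀ n, ∀ a ∈ D.bot n, σ a ∈ lowDeg I R n := by
    intro n a ha
    cases n with
    | zero =>
      rw [(Submodule.mem_bot R).1 ha, map_zero]
      exact zero_mem _
    | succ n =>
      have ha' : a ∈ wordFilt R (gen ∘ g) n := by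
        rw [wordFilt_comp_eq gen g hspan]
        exact ha
      refine (Submodule.span_le.2 ?_ : wordFilt R (gen ∘ g) n ≤ (lowDeg I R (n + 1)).comap σ) ha'
      rintro _ ⟨l, hl, rfl⟩
      have h1 := hσ l
      have h3 := add_mem (lowDeg_mono (by omega : l.length ≤ n + 1) h1)
        (lowDeg_mono (by omega : l.length + 1 ≤ n + 1) (prod_map_X_mem_lowDeg l))
      rwa [sub_add_cancel] at h3
  have hinj : Function.Injective j := by
    rw [injective_iff_map_eq_zero]
    intro p hp
    choose a ha h1 h2 using fun n => hlift n _ (homogeneousComponent_mem n p)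
    have h3 : ∑ n ∈ Finset.range (p.totalDegree + 1), D.symb n (a n) (ha n) = 0 := by
      rw [← hp, Finset.sum_congr rfl fun n _ => (h1 n).symm, ← map_sum, sum_homogeneousComponent]
    rw [← sum_homogeneousComponent p]
    refine Finset.sum_eq_zero fun n hn => ?_
    -- Vanishing of the class puts `a n` in `F_(n-1)`, so `σ (a n)` has degree `< n`. It differs
    -- from the component of degree `n` by degree `< n`, so that component is zero.
    refine eq_zero_of_mem_homogeneousSubmodule_of_mem_lowDeg (homogeneousComponent_mem n p) ?_
    have h4 := sub_mem (hσlow n _ (D.mem_bot_of_sum_symb_eq_zero _ a ha h3 hn)) (h2 n)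
    rwa [sub_sub_cancel] at h4
  have hsurj : Function.Surjective j := by
    have : LinearMap.range j.toLinearMap = ⊤ := D.eq_top_of_grPiece_le fun n => by
      rw [← hpiece n]
      exact LinearMap.map_le_range
    exact LinearMap.range_eq_top.1 this
  let e := AlgEquiv.ofBijective j ⟨hinj, hsurj⟩
  refine ⟨e.symm, fun n => ?_, fun i => ?_⟩
  · have h1 : e.symm.toLinearMap ∘ₗ j.toLinearMap = LinearMap.id :=
      LinearMap.ext fun p => e.symm_apply_apply p
    exact (congrArg _ (hpiece n).symm).trans (by rw [← Submodule.map_comp, h1, Submodule.map_id])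
  · rw [← hj i]
    exact e.symm_apply_apply (X i)

end Asc

/-! ### The PBW theorem over a commutative ring -/

section Rep

open MvPolynomial

variable {I R L : Type*} [CommRing R] [LinearOrder I] [LieRing L] [LieAlgebra R L]
  (b : Module.Basis I R L) (h : R)

/-- Each letter multiplies by its variable up to lower degree. Acting on `1` thus supplies the
leading-term map `σ` of `exists_gr_ascData_equiv`. -/
theorem pbwRep_word_sub_mem_lowDeg (l : List I) :
    (l.map (pbwRep b h ∘ b)).prod 1 - (l.map X).prod ∈ lowDeg I R l.length := by
  induction l with
  | nil => simp
  | cons i l ih =>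
    have h1 := pbwRep_mem_lowDeg b h (b i) ih
    have h2 := pbwRep_sub_mem_lowDeg b h i (prod_map_X_mem_lowDeg (R := R) l)
    have h3 := add_mem h1 h2
    rw [map_sub, sub_add_sub_cancel] at h3
    simpa using h3

/-- An algebra with generators satisfying the commutation relations, and acting on polynomials
through them, has the polynomial algebra as its associated graded algebra. -/
theorem exists_gr_equiv_of_pbwRep {V B : Type*} [Ring B] [Algebra R B] (gen : V → B) (g : I → V)
    (hspan : ∀ v, gen v ∈ Submodule.span R (Set.range (gen ∘ g)))
    (hcomm : ∀ i j, gen (g i) * gen (g j) - gen (g j) * gen (g i) ∈ wordFilt R gen 1)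
    (φ : B →ₐ[R] Module.End R (MvPolynomial I R)) (hφ : ∀ i, φ (gen (g i)) = pbwRep b h (b i)) :
    ∃ e : (ascData R gen).gr ≃ₐ[R] MvPolynomial I R,
      (∀ n, ((ascData R gen).grPiece n).map e.toLinearMap = homogeneousSubmodule I R n) ∧
      ∀ i, e ((ascData R gen).symb 1 (gen (g i)) (gen_mem_wordFilt R gen (g i))) = X i := by
  refine exists_gr_ascData_equiv gen g hspan hcomm
    ((LinearMap.applyₗ (1 : MvPolynomial I R)).comp φ.toLinearMap) fun l => ?_
  have h1 : φ (l.map (gen ∘ g)).prod = (l.map (pbwRep b h ∘ b)).prod := by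
    rw [map_list_prod, List.map_map]
    exact congrArg (fun f => (l.map f).prod) (funext hφ)
  rw [LinearMap.comp_apply, AlgHom.toLinearMap_apply, h1]
  exact pbwRep_word_sub_mem_lowDeg b h l

end Rep

/-! ### Symmetric powers as homogeneous polynomials -/

section Sym

variable {k V I : Type*} [Field k] [AddCommGroup V] [Module k V] (b : Module.Basis I k V)

theorem symPow_eq_map_homogeneousSubmodule (n : ℕ) :
    symPow k V n = (MvPolynomial.homogeneousSubmodule I k n).map
      (SymmetricAlgebra.equivMvPolynomial b).symm.toLinearMap := by
  rw [← MvPolynomial.homogeneousSubmodule_one_pow]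
  refine Eq.trans ?_ (Submodule.map_pow _ (SymmetricAlgebra.equivMvPolynomial b).symm.toAlgHom n).symm
  rw [symPow, MvPolynomial.homogeneousSubmodule_one_eq_span_X, Submodule.map_span,
    LinearMap.range_eq_map, ← b.span_eq, Submodule.map_span, ← Set.range_comp, ← Set.range_comp]
  congr 3
  ext1 i
  simp

theorem symPow_eq_span (n : ℕ) :
    symPow k V n = Submodule.span k {p | ∃ l : List I, l.length = n ∧
      (l.map (SymmetricAlgebra.ι k V ∘ b)).prod = p} := by
  rw [symPow_eq_map_homogeneousSubmodule b, homogeneousSubmodule_eq_span, Submodule.map_span]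
  congr 1
  ext p
  simp only [Set.mem_image, Set.mem_ofPred_eq]
  have key : ∀ l : List I, (SymmetricAlgebra.equivMvPolynomial b).symm.toLinearMap
      (l.map MvPolynomial.X).prod = (l.map (SymmetricAlgebra.ι k V ∘ b)).prod := by
    intro l
    rw [AlgEquiv.toLinearMap_apply, map_list_prod, List.map_map]
    congr 2
    ext1 i
    simp
  constructor
  · rintro ⟨_, ⟨l, hl, rfl⟩, rfl⟩
    exact ⟨l, hl, (key l).symm⟩
  · rintro ⟨l, hl, rfl⟩
    exact ⟨_, ⟨l, hl, rfl⟩, key l⟩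

/-- `k[ħ] ⊗ S(V)` as an algebra of polynomials. -/
def hSymEquiv : MvPolynomial I k[X] ≃ₐ[k[X]] k[X] ⊗[k] SymmetricAlgebra k V :=
  (MvPolynomial.algebraTensorAlgEquiv k k[X]).symm.trans
    (Algebra.TensorProduct.congr AlgEquiv.refl (SymmetricAlgebra.equivMvPolynomial b).symm)

theorem hSymEquiv_X (i : I) :
    hSymEquiv b (MvPolynomial.X i) = 1 ⊗ₜ SymmetricAlgebra.ι k V (b i) := by
  simp [hSymEquiv]

theorem map_hSymEquiv_homogeneousSubmodule (n : ℕ) :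
    (MvPolynomial.homogeneousSubmodule I k[X] n).map (hSymEquiv b).toLinearMap =
      (symPow k V n).baseChange k[X] := by
  rw [symPow_eq_span b, homogeneousSubmodule_eq_span, Submodule.map_span, Submodule.baseChange_span]
  congr 1
  have key : ∀ l : List I, (hSymEquiv b).toLinearMap
      (l.map MvPolynomial.X).prod = 1 ⊗ₜ (l.map (SymmetricAlgebra.ι k V ∘ b)).prod := by
    intro l
    rw [AlgEquiv.toLinearMap_apply]
    induction l with
    | nil => exact map_one _
    | cons i l ih =>
      rw [List.map_cons, List.prod_cons, map_mul, ih, hSymEquiv_X,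
        Algebra.TensorProduct.tmul_mul_tmul, one_mul]
      rfl
  ext p
  constructor
  · rintro ⟨_, ⟨l, hl, rfl⟩, rfl⟩
    exact ⟨_, ⟨l, hl, rfl⟩, (key l).symm⟩
  · rintro ⟨_, ⟨l, hl, rfl⟩, rfl⟩
    exact ⟨_, ⟨l, hl, rfl⟩, key l⟩

end Sym

/-! ### The PBW criterion over a field -/

section PBW

variable {k g I : Type*} [Field k] [LieRing g] [LieAlgebra k g] [LinearOrder I]
  (b : Module.Basis I k g)

/-- The common criterion for `ScaledEnv`, `SpecEnv` and the universal enveloping algebra: the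
relations bound `gr_F` from above, the action on polynomials from below. -/
theorem hasPBW_of_pbwRep {B : Type*} [Ring B] [Algebra k B] {gen : g → B} (genₗ : g →ₗ[k] B)
    (hgen : ∀ x, genₗ x = gen x) (a : k)
    (hrel : ∀ x y, gen x * gen y - gen y * gen x = a • gen ⁅x, y⁆)
    (φ : B →ₐ[k] Module.End k (MvPolynomial I k)) (hφ : ∀ x, φ (gen x) = pbwRep b a x) :
    HasPBW k gen := by
  obtain rfl : ⇑genₗ = gen := funext hgen
  obtain ⟨e, h1, h2⟩ := exists_gr_equiv_of_pbwRep b a genₗ b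
    (fun v => by
      rw [Set.range_comp, ← Submodule.map_span, b.span_eq]
      exact ⟨v, trivial, rfl⟩)
    (fun i j => by
      rw [hrel]
      exact Submodule.smul_mem _ _ (gen_mem_wordFilt k genₗ _)) φ (fun i => hφ (b i))
  refine ⟨e.trans (SymmetricAlgebra.equivMvPolynomial b).symm, fun n => ?_, fun v => ?_⟩
  · rw [symPow_eq_map_homogeneousSubmodule b, ← h1 n, ← Submodule.map_comp]
    rfl
  · let S : g →ₗ[k] (ascData k genₗ).gr := (DirectSum.lof k ℕ (ascData k genₗ).piece 1).comp
      (((ascData k genₗ).cls 1).comp (genₗ.codRestrict _ (gen_mem_wordFilt k genₗ)))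
    have h3 : ((e.trans (SymmetricAlgebra.equivMvPolynomial b).symm).toLinearMap).comp S =
        SymmetricAlgebra.ι k g := by
      refine b.ext fun i => ?_
      refine (congrArg (SymmetricAlgebra.equivMvPolynomial b).symm (h2 i)).trans ?_
      exact SymmetricAlgebra.equivMvPolynomial_symm_X b i
    exact LinearMap.congr_fun h3 v

end PBW

/-! ### The algebra `HEnv` -/

section HEnv

variable {k g : Type*} [Field k] [LieRing g] [LieAlgebra k g]

theorem hvec_add (x y : g) : hvec k (x + y) = hvec k x + hvec k y := by
  rw [hvec, map_add, TensorProduct.tmul_add]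
  rfl

theorem hvec_smul (c : k) (x : g) : hvec k (c • x) = (Polynomial.C c : k[X]) • hvec k x := by
  rw [hvec, map_smul, ← TensorProduct.smul_tmul, hvec, TensorProduct.smul_tmul']
  simp [Polynomial.smul_eq_C_mul]

theorem HEnv.gen_add (x y : g) : HEnv.gen k g (x + y) = HEnv.gen k g x + HEnv.gen k g y := by
  simp only [HEnv.gen, hvec_add, map_add]

theorem HEnv.gen_smul (c : k) (x : g) :
    HEnv.gen k g (c • x) = (Polynomial.C c : k[X]) • HEnv.gen k g x := by
  simp only [HEnv.gen, hvec_smul, map_smul]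

theorem HEnv.gen_mul_sub (x y : g) : HEnv.gen k g x * HEnv.gen k g y -
    HEnv.gen k g y * HEnv.gen k g x = (Polynomial.X : k[X]) • HEnv.gen k g ⁅x, y⁆ := by
  have h := RingQuot.mkAlgHom_rel k[X] (s := fun a b : HTensor k g => a ∈ hLieRelators k g ∧ b = 0)
    ⟨⟨x, y, rfl⟩, rfl⟩
  rw [map_zero, map_sub, map_sub, map_mul, map_mul, map_smul, sub_eq_zero] at h
  exact h

theorem HEnv.exists_lift {C : Type*} [Ring C] [Algebra k C] [Algebra k[X] C]
    [IsScalarTower k k[X] C] (f : g →ₗ[k] C)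
    (hf : ∀ x y, f x * f y - f y * f x = (Polynomial.X : k[X]) • f ⁅x, y⁆) :
    ∃ φ : HEnv k g →ₐ[k[X]] C, ∀ x, φ (HEnv.gen k g x) = f x := by
  let F : HTensor k g →ₐ[k[X]] C := Algebra.TensorProduct.lift (Algebra.ofId k[X] C)
    (TensorAlgebra.lift k f) fun p t => Algebra.commutes p _
  have hF : ∀ x, F (hvec k x) = f x := fun x => by
    refine (Algebra.TensorProduct.lift_tmul _ _ _ _ _).trans ?_
    rw [map_one, one_mul, TensorAlgebra.lift_ι_apply]
  refine ⟨RingQuot.liftAlgHom k[X] ⟨F, ?_⟩, fun x => ?_⟩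
  · rintro _ _ ⟨⟨x, y, rfl⟩, rfl⟩
    rw [map_zero, map_sub, map_sub, map_mul, map_mul, map_smul, hF, hF, hF, hf, sub_self]
  · rw [HEnv.gen, RingQuot.liftAlgHom_mkAlgHom_apply, hF]

/-- Permits induction over elements of the algebra from its generators. -/
theorem HEnv.adjoin_range_gen : Algebra.adjoin k[X] (Set.range (HEnv.gen k g)) = ⊤ := by
  refine eq_top_iff.2 fun t _ => ?_
  obtain ⟨t, rfl⟩ := RingQuot.mkAlgHom_surjective k[X] _ t
  induction t using TensorProduct.induction_on with
  | zero =>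
    rw [map_zero]
    exact zero_mem _
  | add s t hs ht =>
    rw [map_add]
    exact add_mem (hs trivial) (ht trivial)
  | tmul p t =>
    have h1 : p ⊗ₜ t = p • ((1 : k[X]) ⊗ₜ[k] t) := by
      rw [TensorProduct.smul_tmul', smul_eq_mul, mul_one]
    rw [h1, map_smul]
    clear h1
    refine Subalgebra.smul_mem _ ?_ p
    induction t using TensorAlgebra.induction with
    | algebraMap c =>
      have h2 : (1 : k[X]) ⊗ₜ[k] algebraMap k (TensorAlgebra k g) c =
          algebraMap k[X] (HTensor k g) (Polynomial.C c) := by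
        rw [Algebra.algebraMap_eq_smul_one, ← TensorProduct.smul_tmul]
        simp [Polynomial.smul_eq_C_mul]
      rw [h2, AlgHom.commutes]
      exact Subalgebra.algebraMap_mem _ _
    | ι x => exact Algebra.subset_adjoin ⟨x, rfl⟩
    | mul a b ha hb =>
      have h2 : (1 : k[X]) ⊗ₜ[k] (a * b) = (1 ⊗ₜ a) * (1 ⊗ₜ b) := by
        rw [Algebra.TensorProduct.tmul_mul_tmul, one_mul]
      rw [h2, map_mul]
      exact mul_mem (ha trivial) (hb trivial)
    | add a b ha hb =>
      rw [TensorProduct.tmul_add, map_add]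
      exact add_mem (ha trivial) (hb trivial)

/-- Evaluation at `ħ = a` makes `C` a `k[ħ]`-algebra in a way that depends on `a`. A ring
homomorphism with equations keeps that structure inside the proof. -/
theorem HEnv.exists_specialization (a : k) {C : Type*} [Ring C] [Algebra k C] (f : g →ₗ[k] C)
    (hf : ∀ x y, f x * f y - f y * f x = a • f ⁅x, y⁆) :
    ∃ φ : HEnv k g →+* C, (∀ x, φ (HEnv.gen k g x) = f x) ∧
      ∀ p : k[X], φ (algebraMap k[X] _ p) = algebraMap k C (p.eval a) := by
  let _ : Algebra k[X] C := ((algebraMap k C).comp (Polynomial.evalRingHom a)).toAlgebra'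
    fun p t => Algebra.commutes _ t
  have hp : ∀ p : k[X], algebraMap k[X] C p = algebraMap k C (p.eval a) := fun p => rfl
  have : IsScalarTower k k[X] C := .of_algebraMap_eq fun c => by
    rw [hp, Polynomial.algebraMap_apply, Algebra.algebraMap_self_apply, Polynomial.eval_C]
  obtain ⟨φ, hφ⟩ := HEnv.exists_lift f fun x y => by
    rw [hf, Algebra.smul_def, Algebra.smul_def, hp, Polynomial.eval_X]
  exact ⟨φ, hφ, fun p => (φ.commutes p).trans (hp p)⟩

theorem HEnv.gen_mem_span {I : Type*} (b : Module.Basis I k g) (v : g) :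
    HEnv.gen k g v ∈ Submodule.span k[X] (Set.range (HEnv.gen k g ∘ b)) := by
  induction b.mem_span v using Submodule.span_induction with
  | mem _ h =>
    obtain ⟨i, rfl⟩ := h
    exact Submodule.subset_span ⟨i, rfl⟩
  | zero =>
    have h := HEnv.gen_smul (0 : k) (0 : g)
    rw [zero_smul, map_zero, zero_smul] at h
    rw [h]
    exact zero_mem _
  | add x y _ _ hx hy =>
    rw [HEnv.gen_add]
    exact add_mem hx hy
  | smul c x _ hx =>
    rw [HEnv.gen_smul]
    exact Submodule.smul_mem _ _ hx

variable {I : Type*} [LinearOrder I] (b : Module.Basis I k g)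

/-- The action of `k[ħ] ⊗ g` on polynomials. -/
abbrev hRep : k[X] ⊗[k] g →ₗ[k[X]] Module.End k[X] (MvPolynomial I k[X]) :=
  pbwRep (b.baseChange k[X]) Polynomial.X

/-- The bracket on `g` is extended to `k[ħ]` and the scalar of the action is taken to be `ħ`, so the
relators act by zero. -/
theorem HEnv.exists_hRep : ∃ φ : HEnv k g →ₐ[k[X]] Module.End k[X] (MvPolynomial I k[X]),
    ∀ x, φ (HEnv.gen k g x) = hRep b (1 ⊗ₜ x) := by
  refine HEnv.exists_lift (C := Module.End k[X] (MvPolynomial I k[X])) (((hRep b).restrictScalars k).comp (TensorProduct.mk k k[X] g 1))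
    fun x y => ?_
  refine (pbwRep_lie (b.baseChange k[X]) Polynomial.X _ _).trans ?_
  rw [TensorProduct.mk_apply, TensorProduct.mk_apply, LieAlgebra.ExtendScalars.bracket_tmul, one_mul]
  rfl

theorem hasHPBW_HEnv : HasHPBW k (HEnv.gen k g) := by
  let b := Module.Basis.ofVectorSpace k g
  -- Any total order on the basis will do; that this one is a well-order is discarded.
  obtain ⟨_, -⟩ := exists_wellFoundedLT (Module.Basis.ofVectorSpaceIndex k g)
  obtain ⟨φ, hφ⟩ := HEnv.exists_hRep b
  obtain ⟨e, h1, h2⟩ := exists_gr_equiv_of_pbwRep (b.baseChange k[X]) Polynomial.X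
    (HEnv.gen k g) b (HEnv.gen_mem_span b)
    (fun i j => by
      rw [HEnv.gen_mul_sub]
      exact Submodule.smul_mem _ _ (gen_mem_wordFilt k[X] _ _))
    φ (fun i => by rw [hφ, Module.Basis.baseChange_apply])
  refine ⟨e.trans (hSymEquiv b), fun n => ?_, fun v => ?_⟩
  · rw [← map_hSymEquiv_homogeneousSubmodule b, ← h1 n, ← Submodule.map_comp]
    rfl
  · let D := ascData k[X] (HEnv.gen k g)
    have hg : ∀ v, HEnv.gen k g v ∈ D.top 1 := gen_mem_wordFilt k[X] _
    change (e.trans (hSymEquiv b)) (D.symb 1 (HEnv.gen k g v) (hg v)) = _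
    -- The generating map is only `k`-linear while `gr_F` is a `k[ħ]`-algebra, so linearity of the
    -- symbol is checked by hand.
    induction b.mem_span v using Submodule.span_induction with
    | mem _ h =>
      obtain ⟨i, rfl⟩ := h
      exact (congrArg (hSymEquiv b) (h2 i)).trans (hSymEquiv_X b i)
    | zero =>
      have h := HEnv.gen_smul (0 : k) (0 : g)
      rw [zero_smul, map_zero, zero_smul] at h
      rw [map_zero, TensorProduct.tmul_zero, D.symb_congr rfl h _ (zero_mem _),
        D.symb_eq_zero (zero_mem _), map_zero]
    | add x y _ _ hx hy =>
      rw [D.symb_congr rfl (HEnv.gen_add x y) _ (add_mem (hg x) (hg y)), D.symb_add (hg x) (hg y), map_add, hx,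
        hy, map_add, TensorProduct.tmul_add]
    | smul c x _ hx =>
      rw [D.symb_congr rfl (HEnv.gen_smul c x) _ (Submodule.smul_mem _ _ (hg x)), D.symb_smul _ (hg x),
        map_smul, hx, map_smul, ← TensorProduct.smul_tmul, TensorProduct.smul_tmul']
      simp [Polynomial.smul_eq_C_mul]

end HEnv

/-! ### The filtration by powers of `ħ` -/

section Desc

variable {k g : Type*} [Field k] [LieRing g] [LieAlgebra k g]

/-- The action of a basis vector differs from multiplication by a multiple of `ħ`, which dies at `ħ
= 0`. -/
theorem evalZero_hRep {I : Type*} [LinearOrder I] (b : Module.Basis I k g) (x : g)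
    (p : MvPolynomial I k[X]) :
    MvPolynomial.map (Polynomial.evalRingHom 0) (hRep b (1 ⊗ₜ x) p) =
      SymmetricAlgebra.equivMvPolynomial b (SymmetricAlgebra.ι k g x) *
        MvPolynomial.map (Polynomial.evalRingHom 0) p := by
  induction b.mem_span x using Submodule.span_induction with
  | mem _ h =>
    obtain ⟨i, rfl⟩ := h
    obtain ⟨q, hq⟩ := pbwRep_sub_mem_smul (b.baseChange k[X]) (Polynomial.X : k[X]) i p
    rw [Module.Basis.baseChange_apply, sub_eq_iff_eq_add] at hq
    rw [hq, SymmetricAlgebra.equivMvPolynomial_ι_apply]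
    simp [MvPolynomial.smul_eq_C_mul]
  | zero => simp
  | add x y _ _ hx hy =>
    simp only [TensorProduct.tmul_add, map_add, LinearMap.add_apply, hx, hy, add_mul]
  | smul c x _ hx =>
    have h1 : (1 : k[X]) ⊗ₜ[k] (c • x) = Polynomial.C c • ((1 : k[X]) ⊗ₜ[k] x) := by
      rw [← TensorProduct.smul_tmul, TensorProduct.smul_tmul']
      simp [Polynomial.smul_eq_C_mul]
    rw [h1, map_smul, LinearMap.smul_apply, MvPolynomial.smul_eq_C_mul, map_mul, hx, map_smul,
      map_smul, MvPolynomial.smul_eq_C_mul, MvPolynomial.map_C]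
    simp [mul_assoc]

/-- Reduction modulo `ħ`, together with the fact that `ħ` is not a zero divisor modulo `ħ`. -/
theorem HEnv.exists_reduction : ∃ π : HEnv k g →+* SymmetricAlgebra k g,
    (∀ x, π (HEnv.gen k g x) = SymmetricAlgebra.ι k g x) ∧
    (∀ p : k[X], π (algebraMap k[X] _ p) = algebraMap k _ (p.eval 0)) ∧
    ∀ (l : ℕ) (a a' : HEnv k g), algebraMap k[X] _ (Polynomial.X ^ l) * a =
      algebraMap k[X] _ (Polynomial.X ^ (l + 1)) * a' → π a = 0 := by
  obtain ⟨π, h1, h2⟩ := HEnv.exists_specialization (0 : k) (SymmetricAlgebra.ι k g)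
    fun x y => by rw [mul_comm, sub_self, zero_smul]
  refine ⟨π, h1, h2, fun l a a' h => ?_⟩
  let b := Module.Basis.ofVectorSpace k g
  obtain ⟨_, -⟩ := exists_wellFoundedLT (Module.Basis.ofVectorSpaceIndex k g)
  obtain ⟨φ, hφ⟩ := HEnv.exists_hRep b
  -- At `ħ = 0` generators act by multiplication, hence all of `A` acts through `π`.
  have key : ∀ (a : HEnv k g) (p : MvPolynomial _ k[X]),
      MvPolynomial.map (Polynomial.evalRingHom 0) (φ a p) =
        SymmetricAlgebra.equivMvPolynomial b (π a) *
          MvPolynomial.map (Polynomial.evalRingHom 0) p := by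
    intro a
    have ha : a ∈ Algebra.adjoin k[X] (Set.range (HEnv.gen k g)) :=
      HEnv.adjoin_range_gen (k := k) (g := g) ▸ trivial
    induction ha using Algebra.adjoin_induction with
    | mem _ h =>
      obtain ⟨x, rfl⟩ := h
      intro p
      rw [hφ, h1, evalZero_hRep]
    | algebraMap r =>
      intro p
      rw [AlgHom.commutes, h2, AlgEquiv.commutes, Module.algebraMap_end_apply,
        MvPolynomial.smul_eq_C_mul, map_mul, MvPolynomial.map_C]
      rfl
    | add a b _ _ ha hb =>
      intro p
      rw [map_add, LinearMap.add_apply, map_add, ha, hb, map_add, map_add, add_mul]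
    | mul a b _ _ ha hb =>
      intro p
      rw [map_mul, Module.End.mul_apply, ha, hb, map_mul, map_mul, mul_assoc]
  have h3 := congrArg (fun a => φ a 1) h
  simp only [map_mul, AlgHom.commutes, Module.End.mul_apply, Module.algebraMap_end_apply] at h3
  rw [pow_succ, mul_smul] at h3
  -- The factor `ħ^l` is cancelled among polynomials over `k[ħ]`, where torsion-freeness is evident,
  -- rather than in the algebra.
  have h4 : φ a 1 = (Polynomial.X : k[X]) • φ a' 1 :=
    smul_right_injective _ (pow_ne_zero l Polynomial.X_ne_zero) h3
  have h5 := key a 1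
  rw [h4, map_one (MvPolynomial.map _), mul_one, MvPolynomial.smul_eq_C_mul, map_mul, MvPolynomial.map_C] at h5
  simpa using h5.symm

/-- Multiplication by `ħ^l` carries `A / ħA` onto `Γ_l / Γ_(l+1)`, and `A / ħA` is a quotient of
`S(g)`. The last clause of `HEnv.exists_reduction` says that nothing more is lost in any degree. -/
theorem hasDescPBW_HEnv : HasDescPBW k (HEnv.gen k g) := by
  obtain ⟨π, hπ, hπC, hπ0⟩ := HEnv.exists_reduction (k := k) (g := g)
  let D := descData k (HEnv k g)
  have h0 : ∀ a, a ∈ D.top 0 := mem_hFilt_zero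
  have h1 : algebraMap k[X] (HEnv k g) Polynomial.X ∈ D.top 1 := h_mem_hFilt
  have hl : ∀ (l : ℕ) (a : HEnv k g), algebraMap k[X] _ (Polynomial.X ^ l) * a ∈ D.top l :=
    fun l a => ⟨a, rfl⟩
  have hCk : ∀ c : k, algebraMap k (HEnv k g) c = algebraMap k[X] _ (Polynomial.C c) := fun c => by
    rw [IsScalarTower.algebraMap_apply k k[X] (HEnv k g)]
    rfl
  let t : D.gr := D.symb 1 _ h1
  let F : HEnv k g →ₐ[k] D.gr :=
    { toFun := fun a => D.symb 0 a (h0 a)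
      map_one' := rfl
      map_mul' := fun a b => (D.symb_mul_symb (h0 a) (h0 b)).symm
      map_zero' := D.symb_eq_zero (zero_mem _)
      map_add' := fun a b => D.symb_add (h0 a) (h0 b)
      commutes' := fun c => by
        rw [Algebra.algebraMap_eq_smul_one, Algebra.algebraMap_eq_smul_one, D.symb_smul c (h0 1)]
        rfl }
  -- `ħA` is `Γ_1`, the denominator of the piece of degree 0.
  have hFX : ∀ a, F (algebraMap k[X] _ Polynomial.X * a) = 0 := fun a =>
    D.symb_eq_zero ⟨a, by simp⟩
  have hgenl : ∀ (c : k) (x : g), HEnv.gen k g (c • x) = c • HEnv.gen k g x := fun c x => by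
    rw [HEnv.gen_smul, Algebra.smul_def, Algebra.smul_def, hCk]
  obtain ⟨f, hf⟩ := exists_symmetricAlgebra_algHom (R := k)
    ({ toFun := fun x => F (HEnv.gen k g x)
       map_add' := fun x y => by rw [HEnv.gen_add, map_add]
       map_smul' := fun c x => by rw [hgenl, map_smul, RingHom.id_apply] } : g →ₗ[k] D.gr)
    (fun v w => by
      change F _ * F _ = F _ * F _
      rw [← map_mul, ← map_mul, ← sub_eq_zero, ← map_sub, HEnv.gen_mul_sub, Algebra.smul_def, hFX])
  have hfπ : ∀ a, F a = f (π a) := by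
    intro a
    have ha : a ∈ Algebra.adjoin k[X] (Set.range (HEnv.gen k g)) :=
      HEnv.adjoin_range_gen (k := k) (g := g) ▸ trivial
    induction ha using Algebra.adjoin_induction with
    | mem _ h =>
      obtain ⟨x, rfl⟩ := h
      rw [hπ, hf]
      rfl
    | algebraMap r =>
      rw [hπC, AlgHom.commutes]
      conv_lhs => rw [← Polynomial.X_mul_divX_add r]
      rw [map_add, map_mul, map_add, hFX, zero_add, ← hCk, AlgHom.commutes,
        Polynomial.coeff_zero_eq_eval_zero]
    | add a b _ _ ha hb => rw [map_add, map_add, map_add, ha, hb]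
    | mul a b _ _ ha hb => rw [map_mul, map_mul, map_mul, ha, hb]
  have htl : ∀ l, t ^ l = D.symb l (algebraMap k[X] _ (Polynomial.X ^ l) * 1) (hl l 1) := by
    intro l
    induction l with
    | zero =>
      rw [pow_zero, ← D.symb_one]
      exact D.symb_congr rfl (by simp) _ _
    | succ l ih =>
      rw [pow_succ, ih, D.symb_mul_symb]
      exact D.symb_congr rfl (by simp [pow_succ]) _ _
  have htF : ∀ l a, t ^ l * F a = D.symb l (algebraMap k[X] _ (Polynomial.X ^ l) * a) (hl l a) := by
    intro l a
    rw [htl]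
    refine (D.symb_mul_symb _ (h0 a)).trans ?_
    exact D.symb_congr (add_zero l) (by simp) _ _
  have hcomm : ∀ a, Commute t (F a) := by
    intro a
    refine (D.symb_mul_symb h1 (h0 a)).trans (Eq.trans ?_ (D.symb_mul_symb (h0 a) h1).symm)
    exact D.symb_congr (by simp) (Algebra.commutes _ a) _ _
  have hπs : Function.Surjective π := by
    intro s
    induction s using SymmetricAlgebra.induction with
    | algebraMap r => exact ⟨algebraMap k[X] _ (Polynomial.C r), by rw [hπC, Polynomial.eval_C]⟩
    | ι x => exact ⟨_, hπ x⟩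
    | mul a b ha hb =>
      obtain ⟨a, rfl⟩ := ha
      obtain ⟨b, rfl⟩ := hb
      exact ⟨a * b, map_mul _ _ _⟩
    | add a b ha hb =>
      obtain ⟨a, rfl⟩ := ha
      obtain ⟨b, rfl⟩ := hb
      exact ⟨a + b, map_add _ _ _⟩
  -- The target is not yet known to be commutative; it suffices that `t` commutes with the classes
  -- from degree 0.
  let j : k[X] ⊗[k] SymmetricAlgebra k g →ₐ[k] D.gr :=
    Algebra.TensorProduct.lift (Polynomial.aeval t) f (by
      intro p s
      obtain ⟨a, rfl⟩ := hπs s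
      rw [← hfπ]
      exact Polynomial.commute_aeval (hcomm a) p)
  have hj : ∀ l a, j ((Polynomial.X ^ l) ⊗ₜ π a) =
      D.symb l (algebraMap k[X] _ (Polynomial.X ^ l) * a) (hl l a) := by
    intro l a
    refine (Algebra.TensorProduct.lift_tmul _ _ _ _ _).trans ?_
    rw [map_pow, Polynomial.aeval_X, ← hfπ, htF]
  have hpiece : ∀ l, (LinearMap.range (TensorProduct.mk k k[X] (SymmetricAlgebra k g)
      (Polynomial.X ^ l))).map j.toLinearMap = D.grPiece l := by
    intro l
    apply le_antisymm
    · rintro _ ⟨_, ⟨s, rfl⟩, rfl⟩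
      obtain ⟨a, rfl⟩ := hπs s
      exact (hj l a) ▸ D.symb_mem_grPiece (hl l a)
    · intro x hx
      obtain ⟨_, ⟨a, rfl⟩, rfl⟩ := D.exists_symb_of_mem_grPiece hx
      exact ⟨_, ⟨π a, rfl⟩, hj l a⟩
  have hinj : Function.Injective j := by
    rw [injective_iff_map_eq_zero]
    intro p hp
    -- Write `p = ∑ ħ^l ⊗ c_l` and lift `c_l` to `a_l`. Vanishing in degree `l` means `ħ^l a_l ∈
    -- Γ_(l+1)`, whence `c_l = π a_l = 0`.
    obtain ⟨c, rfl⟩ := TensorProduct.eq_repr_basis_left (Polynomial.basisMonomials k) p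
    choose a ha using fun l => hπs (c l)
    rw [Finsupp.sum, map_sum] at hp
    have h2 : ∀ l, j (Polynomial.basisMonomials k l ⊗ₜ c l) =
        D.symb l (algebraMap k[X] _ (Polynomial.X ^ l) * a l) (hl l (a l)) := fun l => by
      rw [← hj, ha, Polynomial.coe_basisMonomials, Polynomial.X_pow_eq_monomial]
    rw [Finset.sum_congr rfl fun l _ => h2 l] at hp
    refine Finset.sum_eq_zero fun l hls => ?_
    obtain ⟨a', ha'⟩ := D.mem_bot_of_sum_symb_eq_zero _ _ (fun l => hl l (a l)) hp hls
    rw [← ha l, hπ0 l (a l) a' ha'.symm]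
    exact TensorProduct.tmul_zero _ _
  have hsurj : Function.Surjective j := by
    have : LinearMap.range j.toLinearMap = ⊤ := D.eq_top_of_grPiece_le fun n => by
      rw [← hpiece n]
      exact LinearMap.map_le_range
    exact LinearMap.range_eq_top.1 this
  let e := AlgEquiv.ofBijective j ⟨hinj, hsurj⟩
  refine ⟨e.symm, fun n => ?_, fun x => ?_, ?_⟩
  · have h1 : e.symm.toLinearMap ∘ₗ j.toLinearMap = LinearMap.id :=
      LinearMap.ext fun p => e.symm_apply_apply p
    exact (congrArg _ (hpiece n).symm).trans (by rw [← Submodule.map_comp, h1, Submodule.map_id])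
  · refine e.symm_apply_eq.2 (Eq.symm ?_)
    exact (congrArg j (by rw [hπ, pow_zero])).trans ((hj 0 (HEnv.gen k g x)).trans
      (D.symb_congr rfl (by simp) _ (h0 (HEnv.gen k g x))))
  · refine e.symm_apply_eq.2 (Eq.symm ?_)
    exact (congrArg j (by rw [map_one, pow_one])).trans ((hj 1 1).trans
      (D.symb_congr rfl (by simp) _ h1))

end Desc

/-! ### Specializations -/

section Specializations

attribute [local instance] LieRing.ofAssociativeRing

variable {k g : Type*} [Field k] [LieRing g] [LieAlgebra k g]

theorem ScaledEnv.gen_mul_sub (a : k) (x y : g) :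
    ScaledEnv.gen k g a x * ScaledEnv.gen k g a y -
      ScaledEnv.gen k g a y * ScaledEnv.gen k g a x = a • ScaledEnv.gen k g a ⁅x, y⁆ := by
  have h := RingQuot.mkAlgHom_rel k (s := fun s t : TensorAlgebra k g => s ∈ lieRelators k g a ∧ t = 0)
    ⟨⟨x, y, rfl⟩, rfl⟩
  rw [map_zero, map_sub, map_sub, map_mul, map_mul, map_smul, sub_eq_zero] at h
  exact h

/-- The generators of `ScaledEnv` as a linear map. -/
def ScaledEnv.genₗ (a : k) : g →ₗ[k] ScaledEnv k g a :=
  (RingQuot.mkAlgHom k _).toLinearMap.comp (TensorAlgebra.ι k)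

theorem ScaledEnv.exists_lift (a : k) {C : Type*} [Ring C] [Algebra k C] (f : g →ₗ[k] C)
    (hf : ∀ x y, f x * f y - f y * f x = a • f ⁅x, y⁆) :
    ∃ φ : ScaledEnv k g a →ₐ[k] C, ∀ x, φ (ScaledEnv.gen k g a x) = f x := by
  refine ⟨RingQuot.liftAlgHom k ⟨TensorAlgebra.lift k f, ?_⟩, fun x => ?_⟩
  · rintro _ _ ⟨⟨x, y, rfl⟩, rfl⟩
    simp only [map_zero, map_sub, map_mul, map_smul, TensorAlgebra.lift_ι_apply, hf, sub_self]
  · rw [ScaledEnv.gen, RingQuot.liftAlgHom_mkAlgHom_apply, TensorAlgebra.lift_ι_apply]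

theorem ScaledEnv.algHom_ext (a : k) {C : Type*} [Ring C] [Algebra k C]
    {φ ψ : ScaledEnv k g a →ₐ[k] C}
    (h : ∀ x, φ (ScaledEnv.gen k g a x) = ψ (ScaledEnv.gen k g a x)) : φ = ψ := by
  refine RingQuot.ringQuot_ext' _ _ _ (TensorAlgebra.hom_ext (LinearMap.ext h))

theorem hasPBW_ScaledEnv (a : k) : HasPBW k (ScaledEnv.gen k g a) := by
  let b := Module.Basis.ofVectorSpace k g
  obtain ⟨_, -⟩ := exists_wellFoundedLT (Module.Basis.ofVectorSpaceIndex k g)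
  obtain ⟨φ, hφ⟩ := ScaledEnv.exists_lift a (pbwRep b a) (pbwRep_lie b a)
  exact hasPBW_of_pbwRep b (ScaledEnv.genₗ a) (fun _ => rfl) a (ScaledEnv.gen_mul_sub a) φ hφ

theorem hasPBW_universalEnvelopingAlgebra :
    HasPBW k (fun x : g => UniversalEnvelopingAlgebra.ι k x) := by
  let b := Module.Basis.ofVectorSpace k g
  obtain ⟨_, -⟩ := exists_wellFoundedLT (Module.Basis.ofVectorSpaceIndex k g)
  let ρ : g →ₗ⁅k⁆ Module.End k (MvPolynomial (Module.Basis.ofVectorSpaceIndex k g) k) :=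
    { pbwRep b (1 : k) with
      map_lie' := fun {x y} => by
        rw [LieRing.of_associative_ring_bracket]
        exact ((pbwRep_lie b 1 x y).trans (one_smul _ _)).symm }
  refine hasPBW_of_pbwRep b (gen := fun x => UniversalEnvelopingAlgebra.ι k x)
    (UniversalEnvelopingAlgebra.ι k).toLinearMap (fun _ => rfl) 1 (fun x y => ?_)
    (UniversalEnvelopingAlgebra.lift k ρ) (fun x => UniversalEnvelopingAlgebra.lift_ι_apply k ρ x)
  rw [one_smul, ← LieRing.of_associative_ring_bracket]
  exact (LieHom.map_lie _ x y).symm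

/-- The generators of `SpecEnv` as a linear map. -/
def SpecEnv.genₗ (a : k) : g →ₗ[k] SpecEnv k g a where
  toFun := SpecEnv.gen k g a
  map_add' x y := by rw [SpecEnv.gen, HEnv.gen_add, TensorProduct.tmul_add]; rfl
  map_smul' c x := by
    have h : (Polynomial.C c : k[X]) • (1 : k[X] ⧸ Ideal.span {(Polynomial.X - Polynomial.C a : k[X])})
        = c • 1 := algebraMap_smul k[X] c _
    rw [SpecEnv.gen, HEnv.gen_smul, ← TensorProduct.smul_tmul, h, RingHom.id_apply, SpecEnv.gen,
      TensorProduct.smul_tmul']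

theorem smul_one_quotient_X_sub_C (a : k) (p : k[X]) :
    p • (1 : k[X] ⧸ Ideal.span {(Polynomial.X - Polynomial.C a : k[X])}) =
      algebraMap k _ (p.eval a) := by
  rw [← Algebra.algebraMap_eq_smul_one, IsScalarTower.algebraMap_apply k k[X],
    Ideal.Quotient.algebraMap_eq, Ideal.Quotient.eq, Ideal.mem_span_singleton,
    Polynomial.dvd_iff_isRoot, Polynomial.IsRoot, Polynomial.eval_sub]
  simp

theorem SpecEnv.one_tmul_smul (a : k) (p : k[X]) (t : HEnv k g) :
    (1 ⊗ₜ (p • t) : SpecEnv k g a) = p.eval a • (1 ⊗ₜ t) := by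
  rw [← TensorProduct.smul_tmul, smul_one_quotient_X_sub_C, Algebra.algebraMap_eq_smul_one,
    TensorProduct.smul_tmul']

theorem SpecEnv.gen_mul_sub (a : k) (x y : g) :
    SpecEnv.gen k g a x * SpecEnv.gen k g a y -
      SpecEnv.gen k g a y * SpecEnv.gen k g a x = a • SpecEnv.gen k g a ⁅x, y⁆ := by
  simp only [SpecEnv.gen]
  rw [Algebra.TensorProduct.tmul_mul_tmul, Algebra.TensorProduct.tmul_mul_tmul,
    ← TensorProduct.tmul_sub, one_mul, HEnv.gen_mul_sub, SpecEnv.one_tmul_smul, Polynomial.eval_X]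

/-- A map that evaluates scalars at `ħ = a` kills `ħ - a`, hence factors through the fibre. -/
theorem SpecEnv.exists_lift (a : k) {C : Type*} [Ring C] [Algebra k C] (φ : HEnv k g →+* C)
    (hφ : ∀ p : k[X], φ (algebraMap k[X] _ p) = algebraMap k C (p.eval a)) :
    ∃ G : SpecEnv k g a →ₐ[k] C, ∀ t, G (1 ⊗ₜ t) = φ t := by
  let _ : Algebra k[X] C := ((algebraMap k C).comp (Polynomial.evalRingHom a)).toAlgebra'
    fun p t => Algebra.commutes (p.eval a) t
  have hp : ∀ p : k[X], algebraMap k[X] C p = algebraMap k _ (p.eval a) := fun p => rfl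
  let f : (k[X] ⧸ Ideal.span {(Polynomial.X - Polynomial.C a : k[X])}) →ₐ[k[X]] C :=
    Ideal.Quotient.liftₐ _ (Algebra.ofId _ _) fun p hpI => by
      obtain ⟨q, rfl⟩ := Ideal.mem_span_singleton.1 hpI
      rw [Algebra.ofId_apply, hp]
      simp
  let φ' : HEnv k g →ₐ[k[X]] C := { φ with commutes' := hφ }
  have hc : ∀ q t, Commute (f q) (φ' t) := fun q t => by
    obtain ⟨p, rfl⟩ := Ideal.Quotient.mk_surjective q
    exact Algebra.commutes (A := C) p _
  let G := Algebra.TensorProduct.lift f φ' hc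
  have hG : ∀ q t, G (q ⊗ₜ t) = f q * φ' t := Algebra.TensorProduct.lift_tmul f φ' hc
  refine ⟨{ G.toRingHom with commutes' := fun c => ?_ }, fun t => ?_⟩
  · refine (hG _ 1).trans ?_
    rw [map_one, mul_one]
    refine (f.commutes (Polynomial.C c)).trans ?_
    rw [hp, Polynomial.eval_C]
  · exact (hG 1 t).trans (by rw [map_one, one_mul]; rfl)

/-- The universal properties give maps both ways. Their composite on `ScaledEnv` is the identity on
generators, and generation of the fibre gives surjectivity. -/
theorem SpecEnv.exists_equiv (a : k) : ∃ e : SpecEnv k g a ≃ₐ[k] ScaledEnv k g a,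
    ∀ x, e (SpecEnv.gen k g a x) = ScaledEnv.gen k g a x := by
  obtain ⟨ψ, hψ⟩ := ScaledEnv.exists_lift a (C := SpecEnv k g a) (SpecEnv.genₗ a)
    fun x y => SpecEnv.gen_mul_sub a x y
  obtain ⟨φ, hφ, hφp⟩ := HEnv.exists_specialization a (C := ScaledEnv k g a)
    (ScaledEnv.genₗ a) fun x y => ScaledEnv.gen_mul_sub a x y
  obtain ⟨G, hG⟩ := SpecEnv.exists_lift a φ hφp
  have hsurj : Function.Surjective ψ := by
    have h1 : ∀ t : HEnv k g, (1 ⊗ₜ t : SpecEnv k g a) ∈ ψ.range := by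
      intro t
      have ht : t ∈ Algebra.adjoin k[X] (Set.range (HEnv.gen k g)) :=
        HEnv.adjoin_range_gen (k := k) (g := g) ▸ trivial
      induction ht using Algebra.adjoin_induction with
      | mem _ h =>
        obtain ⟨x, rfl⟩ := h
        exact ⟨_, hψ x⟩
      | algebraMap p =>
        rw [Algebra.algebraMap_eq_smul_one, SpecEnv.one_tmul_smul]
        exact Subalgebra.smul_mem _ (one_mem _) _
      | add s t _ _ hs ht =>
        rw [TensorProduct.tmul_add]
        exact add_mem hs ht
      | mul s t _ _ hs ht =>
        have h2 : (1 ⊗ₜ (s * t) : SpecEnv k g a) = 1 ⊗ₜ s * 1 ⊗ₜ t := by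
          rw [Algebra.TensorProduct.tmul_mul_tmul, one_mul]
        rw [h2]
        exact mul_mem hs ht
    intro s
    change s ∈ ψ.range
    induction s using TensorProduct.induction_on with
    | zero => exact zero_mem _
    | add s t hs ht => exact add_mem hs ht
    | tmul q t =>
      obtain ⟨p, rfl⟩ := Ideal.Quotient.mk_surjective q
      have h2 : Ideal.Quotient.mk (Ideal.span {(Polynomial.X - Polynomial.C a : k[X])}) p =
          p • 1 := by
        rw [← Algebra.algebraMap_eq_smul_one]
        rfl
      rw [h2, TensorProduct.smul_tmul]
      exact h1 _
  have hinj : Function.Injective ψ := by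
    have hGψ : G.comp ψ = AlgHom.id k _ :=
      ScaledEnv.algHom_ext a fun x => (congrArg G (hψ x)).trans ((hG _).trans (hφ x))
    exact Function.LeftInverse.injective (g := G) fun s => DFunLike.congr_fun hGψ s
  let e := AlgEquiv.ofBijective ψ ⟨hinj, hsurj⟩
  exact ⟨e.symm, fun x => e.symm_apply_eq.2 (hψ x).symm⟩

theorem hasPBW_SpecEnv (a : k) : HasPBW k (SpecEnv.gen k g a) := by
  let b := Module.Basis.ofVectorSpace k g
  obtain ⟨_, -⟩ := exists_wellFoundedLT (Module.Basis.ofVectorSpaceIndex k g)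
  obtain ⟨φ, hφ⟩ := ScaledEnv.exists_lift a (pbwRep b a) (pbwRep_lie b a)
  obtain ⟨e, he⟩ := SpecEnv.exists_equiv (g := g) a
  refine hasPBW_of_pbwRep b (SpecEnv.genₗ a) (fun _ => rfl) a (SpecEnv.gen_mul_sub a) (φ.comp e.toAlgHom)
    fun x => (congrArg φ (he x)).trans (hφ x)

end Specializations

/-! ### Identities in the coalgebra `Λ(V)` -/

section Coalgebra

variable {k V : Type*} [Field k] [AddCommGroup V] [Module k V]

theorem ExteriorAlgebra.left_induction {P : ExteriorAlgebra k V → Prop}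
    (algebraMap : ∀ r, P (algebraMap k _ r)) (add : ∀ x y, P x → P y → P (x + y))
    (ι_mul : ∀ v ω, P ω → P (ExteriorAlgebra.ι k v * ω)) (ω : ExteriorAlgebra k V) : P ω := by
  induction ω using CliffordAlgebra.left_induction with
  | algebraMap r => exact algebraMap r
  | add x y hx hy => exact add x y hx hy
  | ι_mul ω v h => exact ι_mul v ω h

/-- The induction behind the exterior identities below: each operator is known by its value at `1`
and by how it passes a vector on the left. -/
theorem ExteriorAlgebra.linearMap_ext_of_ι_mul {N : Type*} [AddCommGroup N] [Module k N]
    {f g : ExteriorAlgebra k V →ₗ[k] N} (one : f 1 = g 1)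
    (ι_mul : ∀ v ω, f ω = g ω → f (ExteriorAlgebra.ι k v * ω) = g (ExteriorAlgebra.ι k v * ω)) :
    f = g := by
  refine LinearMap.ext fun ω => ?_
  induction ω using ExteriorAlgebra.left_induction with
  | algebraMap r => rw [Algebra.algebraMap_eq_smul_one, map_smul, map_smul, one]
  | add x y hx hy => rw [map_add, map_add, hx, hy]
  | ι_mul v ω h => exact ι_mul v ω h

variable (k V) in
/-- The grade involution of the exterior algebra. -/
abbrev extInv : ExteriorAlgebra k V →ₐ[k] ExteriorAlgebra k V :=
  CliffordAlgebra.involute (Q := (0 : QuadraticForm k V))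

theorem extInv_ι (v : V) : extInv k V (ExteriorAlgebra.ι k v) = -ExteriorAlgebra.ι k v :=
  CliffordAlgebra.involute_ι v

theorem extInv_extInv (ω : ExteriorAlgebra k V) : extInv k V (extInv k V ω) = ω :=
  CliffordAlgebra.involute_involute ω

theorem coprod_one : coprod k V 1 = 1 ⊗ₜ 1 := by
  rw [coprod, CliffordAlgebra.foldr_one]

theorem coprod_ι_mul (v : V) (ω : ExteriorAlgebra k V) :
    coprod k V (ExteriorAlgebra.ι k v * ω) = coprodStep k V v (coprod k V ω) :=
  (CliffordAlgebra.foldr_mul _ _ _ _ _ _).trans (CliffordAlgebra.foldr_ι _ _ _ _ _)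

theorem coprod_ι (v : V) : coprod k V (ExteriorAlgebra.ι k v) =
    ExteriorAlgebra.ι k v ⊗ₜ 1 + 1 ⊗ₜ ExteriorAlgebra.ι k v := by
  have h := coprod_ι_mul v (1 : ExteriorAlgebra k V)
  rwa [coprod_one, coprodStep_tmul, mul_one, map_one] at h

theorem coprod_extInv (ω : ExteriorAlgebra k V) : coprod k V (extInv k V ω) =
    TensorProduct.map (extInv k V).toLinearMap (extInv k V).toLinearMap (coprod k V ω) := by
  have key : ∀ (v : V) (t : ExteriorAlgebra k V ⊗[k] ExteriorAlgebra k V),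
      TensorProduct.map (extInv k V).toLinearMap (extInv k V).toLinearMap (coprodStep k V v t) =
      -coprodStep k V v
        (TensorProduct.map (extInv k V).toLinearMap (extInv k V).toLinearMap t) := by
    intro v t
    induction t with
    | zero => simp
    | add s t hs ht => rw [map_add, map_add, hs, ht, map_add, map_add, neg_add]
    | tmul a b =>
      simp only [coprodStep_tmul, map_add, TensorProduct.map_tmul, AlgHom.toLinearMap_apply,
        map_mul, extInv_ι, neg_mul, TensorProduct.neg_tmul, TensorProduct.tmul_neg, neg_add]
  have h : (coprod k V).comp (extInv k V).toLinearMap =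
      (TensorProduct.map (extInv k V).toLinearMap (extInv k V).toLinearMap).comp (coprod k V) := by
    refine ExteriorAlgebra.linearMap_ext_of_ι_mul ?_ fun v ω h => ?_
    · simp [coprod_one]
    · simp only [LinearMap.comp_apply, AlgHom.toLinearMap_apply] at h ⊢
      rw [map_mul, extInv_ι, neg_mul, map_neg, coprod_ι_mul, coprod_ι_mul, h, key]
  exact LinearMap.congr_fun h ω

/-- Coassociativity of the coproduct. -/
theorem coprod_coassoc (ω : ExteriorAlgebra k V) :
    TensorProduct.assoc k _ _ _ (TensorProduct.map (coprod k V) LinearMap.id (coprod k V ω)) =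
      TensorProduct.map LinearMap.id (coprod k V) (coprod k V ω) := by
  -- Signed multiplication by `v ⊗ 1 ⊗ 1 + 1 ⊗ v ⊗ 1 + 1 ⊗ 1 ⊗ v`. Both iterated coproducts
  -- intertwine `coprodStep` with it.
  let st : V → ExteriorAlgebra k V ⊗[k] (ExteriorAlgebra k V ⊗[k] ExteriorAlgebra k V) →ₗ[k]
      ExteriorAlgebra k V ⊗[k] (ExteriorAlgebra k V ⊗[k] ExteriorAlgebra k V) := fun v =>
    TensorProduct.map (LinearMap.mulLeft k (ExteriorAlgebra.ι k v)) LinearMap.id +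
      TensorProduct.map (extInv k V).toLinearMap (coprodStep k V v)
  have hst : ∀ v a t, st v (a ⊗ₜ t) =
      (ExteriorAlgebra.ι k v * a) ⊗ₜ t + extInv k V a ⊗ₜ coprodStep k V v t := fun _ _ _ => rfl
  have key1 : ∀ v t, TensorProduct.map LinearMap.id (coprod k V) (coprodStep k V v t) =
      st v (TensorProduct.map LinearMap.id (coprod k V) t) := by
    intro v t
    induction t with
    | zero => simp
    | add s t hs ht => simp only [map_add, hs, ht]
    | tmul a b =>
      simp only [coprodStep_tmul, map_add, TensorProduct.map_tmul, LinearMap.id_apply,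
        coprod_ι_mul, hst]
  -- To reach the third slot `v` passes both earlier factors, hence an involution on each.
  have key2 : ∀ v t (b : ExteriorAlgebra k V), TensorProduct.assoc k _ _ _
      (coprodStep k V v t ⊗ₜ b + TensorProduct.map (extInv k V).toLinearMap
        (extInv k V).toLinearMap t ⊗ₜ (ExteriorAlgebra.ι k v * b)) =
      st v (TensorProduct.assoc k _ _ _ (t ⊗ₜ b)) := by
    intro v t b
    induction t with
    | zero => simp
    | add s t hs ht =>
      simp only [map_add, TensorProduct.add_tmul] at hs ht ⊢
      rw [← hs, ← ht]
      abel
    | tmul x y =>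
      simp only [coprodStep_tmul, TensorProduct.map_tmul, TensorProduct.add_tmul, map_add,
        TensorProduct.assoc_tmul, hst, AlgHom.toLinearMap_apply, TensorProduct.tmul_add, add_assoc]
  have key3 : ∀ v t, TensorProduct.assoc k _ _ _
      (TensorProduct.map (coprod k V) LinearMap.id (coprodStep k V v t)) =
      st v (TensorProduct.assoc k _ _ _ (TensorProduct.map (coprod k V) LinearMap.id t)) := by
    intro v t
    induction t with
    | zero => simp
    | add s t hs ht => simp only [map_add, hs, ht]
    | tmul a b =>
      rw [coprodStep_tmul, map_add, TensorProduct.map_tmul, TensorProduct.map_tmul,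
        TensorProduct.map_tmul, LinearMap.id_apply, LinearMap.id_apply, coprod_ι_mul, ← key2]
      rw [← coprod_extInv]
  have h : ((TensorProduct.assoc k _ _ _).toLinearMap.comp
      (TensorProduct.map (coprod k V) LinearMap.id)).comp (coprod k V) =
      (TensorProduct.map LinearMap.id (coprod k V)).comp (coprod k V) := by
    refine ExteriorAlgebra.linearMap_ext_of_ι_mul ?_ fun v ω h => ?_
    · simp [coprod_one]
    · simp only [LinearMap.comp_apply, LinearEquiv.coe_coe] at h ⊢
      rw [coprod_ι_mul, key1, key3, h]
  exact LinearMap.congr_fun h ω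

end Coalgebra

/-! ### Identities for the Chevalley–Eilenberg differential -/

section CE

variable {k g : Type*} [Field k] [LieRing g] [LieAlgebra k g]

theorem adExt_one (x : g) : adExt k g x 1 = 0 := by
  have h : adFold k g 1 = (1, 0) := CliffordAlgebra.foldr_one _ _ _ _
  exact congrArg (fun p : ExteriorAlgebra k g × (g →ₗ[k] ExteriorAlgebra k g) => p.2 x) h

theorem ceDiff_one : ceDiff k g 1 = 0 :=
  congrArg Prod.snd (CliffordAlgebra.foldr_one (0 : QuadraticForm k g) (ceStep k g) _ _)

theorem ceDiff_ι_mul (v : g) (ω : ExteriorAlgebra k g) :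
    ceDiff k g (ExteriorAlgebra.ι k v * ω) =
      -adExt k g v ω - ExteriorAlgebra.ι k v * ceDiff k g ω := by
  let F := CliffordAlgebra.foldr (0 : QuadraticForm k g) (ceStep k g) (ceStep_sq k g) (1, 0)
  have hF : ∀ v ω, F (ExteriorAlgebra.ι k v * ω) = ceStep k g v (F ω) := fun v ω =>
    (CliffordAlgebra.foldr_mul _ _ _ _ _ _).trans (CliffordAlgebra.foldr_ι _ _ _ _ _)
  -- The fold carries `ω` along with `∂ω`, because the recursion for `∂` needs `ω` itself.
  have hfst : (LinearMap.fst k _ _).comp F = LinearMap.id := by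
    refine ExteriorAlgebra.linearMap_ext_of_ι_mul ?_ fun v ω h => ?_
    · exact congrArg Prod.fst (CliffordAlgebra.foldr_one (0 : QuadraticForm k g) (ceStep k g) _ _)
    · exact (congrArg Prod.fst (hF v ω)).trans (congrArg (ExteriorAlgebra.ι k v * ·) h)
  refine (congrArg Prod.snd (hF v ω)).trans ?_
  change -adExt k g v (F ω).1 - _ = _
  rw [show (F ω).1 = ω from LinearMap.congr_fun hfst ω]
  rfl

theorem adExt_extInv (x : g) (ω : ExteriorAlgebra k g) :
    adExt k g x (extInv k g ω) = extInv k g (adExt k g x ω) := by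
  have h : (adExt k g x).comp (extInv k g).toLinearMap =
      (extInv k g).toLinearMap.comp (adExt k g x) := by
    refine ExteriorAlgebra.linearMap_ext_of_ι_mul ?_ fun v ω h => ?_
    · simp [adExt_one]
    · simp only [LinearMap.comp_apply, AlgHom.toLinearMap_apply] at h ⊢
      simp only [map_mul, extInv_ι, neg_mul, map_neg, adExt_ι_mul, map_add, h, neg_add]
  exact LinearMap.congr_fun h ω

theorem adExt_lie (x y : g) (ω : ExteriorAlgebra k g) :
    adExt k g ⁅x, y⁆ ω = adExt k g x (adExt k g y ω) - adExt k g y (adExt k g x ω) := by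
  have h : adExt k g ⁅x, y⁆ = (adExt k g x).comp (adExt k g y) -
      (adExt k g y).comp (adExt k g x) := by
    refine ExteriorAlgebra.linearMap_ext_of_ι_mul ?_ fun v ω h => ?_
    · simp [adExt_one]
    · simp only [LinearMap.sub_apply, LinearMap.comp_apply] at h ⊢
      simp only [adExt_ι_mul, map_add, h, lie_lie, map_sub, sub_mul, mul_sub]
      abel
  exact LinearMap.congr_fun h ω

/-- Invariance of `∂`, which rests on Jacobi through `adExt_lie`. Given it, the two adjoint terms in
`∂∂(v ∧ ω)` cancel. -/
theorem ceDiff_adExt (x : g) (ω : ExteriorAlgebra k g) :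
    ceDiff k g (adExt k g x ω) = adExt k g x (ceDiff k g ω) := by
  have h : (ceDiff k g).comp (adExt k g x) = (adExt k g x).comp (ceDiff k g) := by
    refine ExteriorAlgebra.linearMap_ext_of_ι_mul ?_ fun v ω h => ?_
    · simp [adExt_one, ceDiff_one]
    · simp only [LinearMap.comp_apply] at h ⊢
      simp only [adExt_ι_mul, ceDiff_ι_mul, map_add, map_sub, map_neg, adExt_lie, h]
      abel
  exact LinearMap.congr_fun h ω

theorem ceDiff_ceDiff (ω : ExteriorAlgebra k g) : ceDiff k g (ceDiff k g ω) = 0 := by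
  have h : (ceDiff k g).comp (ceDiff k g) = 0 := by
    refine ExteriorAlgebra.linearMap_ext_of_ι_mul ?_ fun v ω h => ?_
    · simp [ceDiff_one]
    · simp only [LinearMap.comp_apply, LinearMap.zero_apply] at h ⊢
      simp only [ceDiff_ι_mul, map_sub, map_neg, ceDiff_adExt, h]
      simp
  exact LinearMap.congr_fun h ω

theorem ceDiff_extInv (ω : ExteriorAlgebra k g) :
    ceDiff k g (extInv k g ω) = -extInv k g (ceDiff k g ω) := by
  have h : (ceDiff k g).comp (extInv k g).toLinearMap =
      -(extInv k g).toLinearMap.comp (ceDiff k g) := by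
    refine ExteriorAlgebra.linearMap_ext_of_ι_mul ?_ fun v ω h => ?_
    · simp [ceDiff_one]
    · simp only [LinearMap.comp_apply, LinearMap.neg_apply, AlgHom.toLinearMap_apply] at h ⊢
      simp only [map_mul, extInv_ι, neg_mul, map_neg, ceDiff_ι_mul, map_sub, h, adExt_extInv]
      simp
  exact LinearMap.congr_fun h ω

theorem coprod_adExt (x : g) (ω : ExteriorAlgebra k g) : coprod k g (adExt k g x ω) =
    TensorProduct.map (adExt k g x) LinearMap.id (coprod k g ω) +
      TensorProduct.map LinearMap.id (adExt k g x) (coprod k g ω) := by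
  have key : ∀ v t, TensorProduct.map (adExt k g x) LinearMap.id (coprodStep k g v t) +
      TensorProduct.map LinearMap.id (adExt k g x) (coprodStep k g v t) =
      coprodStep k g ⁅x, v⁆ t + coprodStep k g v (TensorProduct.map (adExt k g x) LinearMap.id t +
        TensorProduct.map LinearMap.id (adExt k g x) t) := by
    intro v t
    induction t with
    | zero => simp
    | add s t hs ht =>
      simp only [map_add] at hs ht ⊢
      rw [add_add_add_comm, hs, ht]
      abel
    | tmul a b =>
      simp only [coprodStep_tmul, map_add, TensorProduct.map_tmul, LinearMap.id_apply,
        adExt_ι_mul, adExt_extInv, TensorProduct.add_tmul, TensorProduct.tmul_add]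
      abel
  have h : (coprod k g).comp (adExt k g x) =
      (TensorProduct.map (adExt k g x) LinearMap.id +
        TensorProduct.map LinearMap.id (adExt k g x)).comp (coprod k g) := by
    refine ExteriorAlgebra.linearMap_ext_of_ι_mul ?_ fun v ω h => ?_
    · simp [adExt_one, coprod_one]
    · simp only [LinearMap.comp_apply, LinearMap.add_apply] at h ⊢
      simp only [adExt_ι_mul, map_add, coprod_ι_mul, h, key]
  exact LinearMap.congr_fun h ω

/-- The Chevalley–Eilenberg differential is a coderivation. -/
theorem coprod_ceDiff (ω : ExteriorAlgebra k g) : coprod k g (ceDiff k g ω) =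
    TensorProduct.map (ceDiff k g) LinearMap.id (coprod k g ω) +
      TensorProduct.map (extInv k g).toLinearMap (ceDiff k g) (coprod k g ω) := by
  -- On the tensor square the candidate obeys the same recursion as `∂`, with the adjoint action by
  -- derivations; `coprod_adExt` matches the latter with the coproduct.
  have key : ∀ v t, TensorProduct.map (ceDiff k g) LinearMap.id (coprodStep k g v t) +
      TensorProduct.map (extInv k g).toLinearMap (ceDiff k g) (coprodStep k g v t) =
      -(TensorProduct.map (adExt k g v) LinearMap.id t +
        TensorProduct.map LinearMap.id (adExt k g v) t) -
      coprodStep k g v (TensorProduct.map (ceDiff k g) LinearMap.id t +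
        TensorProduct.map (extInv k g).toLinearMap (ceDiff k g) t) := by
    intro v t
    induction t with
    | zero => simp
    | add s t hs ht =>
      simp only [map_add] at hs ht ⊢
      rw [add_add_add_comm, hs, ht]
      abel
    | tmul a b =>
      simp only [coprodStep_tmul, map_add, TensorProduct.map_tmul, LinearMap.id_apply,
        ceDiff_ι_mul, ceDiff_extInv,
        AlgHom.toLinearMap_apply, map_mul, extInv_ι, extInv_extInv, TensorProduct.sub_tmul,
        TensorProduct.tmul_sub, TensorProduct.neg_tmul, TensorProduct.tmul_neg, neg_mul]
      abel
  have h : (coprod k g).comp (ceDiff k g) =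
      (TensorProduct.map (ceDiff k g) LinearMap.id +
        TensorProduct.map (extInv k g).toLinearMap (ceDiff k g)).comp (coprod k g) := by
    refine ExteriorAlgebra.linearMap_ext_of_ι_mul ?_ fun v ω h => ?_
    · simp [ceDiff_one, coprod_one]
    · simp only [LinearMap.comp_apply, LinearMap.add_apply] at h ⊢
      simp only [ceDiff_ι_mul, map_sub, map_neg, coprod_ι_mul, h, key, coprod_adExt]
  exact LinearMap.congr_fun h ω

end CE

/-! ### The Koszul differentials -/

section KoszulDiff

variable {k V : Type*} [Field k] [AddCommGroup V] [Module k V]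

theorem coe_toPos (ω : ExteriorAlgebra k V) : (toPos k V ω : ExteriorAlgebra k V) =
    ω - ExteriorAlgebra.algebraMapInv ω • 1 := by
  rw [← Algebra.algebraMap_eq_smul_one]
  rfl

theorem kgen_one : kgen k V 1 = 0 := by
  have h : toPos k V 1 = 0 := by
    ext1
    rw [coe_toPos, map_one, one_smul, sub_self]
    rfl
  rw [kgen, LinearMap.comp_apply, h, map_zero]

theorem kgen_coe (w : extPos k V) : kgen k V w = TensorAlgebra.ι k w := by
  rw [kgen, LinearMap.comp_apply]
  congr 1
  ext1
  rw [coe_toPos, show ExteriorAlgebra.algebraMapInv (w : ExteriorAlgebra k V) = 0 from w.2,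
    zero_smul, sub_zero]

theorem koszul_induction {P : Koszul k V → Prop} (algebraMap : ∀ r, P (algebraMap k _ r))
    (kgen : ∀ ω, P (kgen k V ω)) (mul : ∀ a b, P a → P b → P (a * b))
    (add : ∀ a b, P a → P b → P (a + b)) (a : Koszul k V) : P a := by
  induction a using TensorAlgebra.induction with
  | algebraMap r => exact algebraMap r
  | ι w => exact kgen_coe w ▸ kgen w
  | mul a b ha hb => exact mul a b ha hb
  | add a b ha hb => exact add a b ha hb

theorem koszulSign_kgen (ω : ExteriorAlgebra k V) :
    koszulSign k V (kgen k V ω) = -kgen k V (extInv k V ω) := by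
  have h : koszulSign k V (kgen k V ω) =
      -kgen k V (extInv k V (toPos k V ω : ExteriorAlgebra k V)) :=
    TensorAlgebra.lift_ι_apply _ _
  rw [h, coe_toPos, map_sub, map_smul, map_one, map_sub, map_smul, kgen_one, smul_zero, sub_zero]

theorem koszulSign_koszulSign (a : Koszul k V) : koszulSign k V (koszulSign k V a) = a := by
  induction a using koszul_induction with
  | algebraMap r => rw [AlgHom.commutes, AlgHom.commutes]
  | kgen ω => rw [koszulSign_kgen, map_neg, koszulSign_kgen, extInv_extInv, neg_neg]
  | mul a b ha hb => rw [map_mul, map_mul, ha, hb]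
  | add a b ha hb => rw [map_add, map_add, ha, hb]

theorem oddDerivMatrix_entries (D : extPos k V →ₗ[k] Koszul k V) (a : Koszul k V) :
    oddDerivMatrix D a 0 0 = koszulSign k V a ∧ oddDerivMatrix D a 1 0 = 0 ∧
      oddDerivMatrix D a 1 1 = a := by
  induction a using TensorAlgebra.induction with
  | algebraMap r => simp [Matrix.algebraMap_matrix_apply]
  | ι w => simp [oddDerivMatrix]
  | mul a b ha hb => simp [Matrix.mul_apply, Fin.sum_univ_two, ha, hb]
  | add a b ha hb => simp [ha, hb]

theorem oddDeriv_apply (D : extPos k V →ₗ[k] Koszul k V) (a : Koszul k V) :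
    oddDeriv D a = oddDerivMatrix D a 0 1 := rfl

theorem oddDeriv_mul (D : extPos k V →ₗ[k] Koszul k V) (a b : Koszul k V) :
    oddDeriv D (a * b) = oddDeriv D a * b + koszulSign k V a * oddDeriv D b := by
  rw [oddDeriv_apply, map_mul, Matrix.mul_apply, Fin.sum_univ_two, (oddDerivMatrix_entries D a).1,
    (oddDerivMatrix_entries D b).2.2, add_comm]
  rfl

theorem oddDeriv_ι (D : extPos k V →ₗ[k] Koszul k V) (w : extPos k V) :
    oddDeriv D (TensorAlgebra.ι k w) = D w := by
  simp [oddDeriv_apply, oddDerivMatrix]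

theorem oddDeriv_algebraMap (D : extPos k V →ₗ[k] Koszul k V) (r : k) :
    oddDeriv D (algebraMap k _ r) = 0 := by
  simp [oddDeriv_apply, Matrix.algebraMap_matrix_apply]

/-- Since `[1] = 0`, the generator `[ω]` forgets the scalar part of `ω`; a formula on all of `Λ(V)`
must do the same. -/
theorem oddDeriv_kgen {E : ExteriorAlgebra k V →ₗ[k] Koszul k V} (hE : E 1 = 0)
    (ω : ExteriorAlgebra k V) :
    oddDeriv (E.comp (extPos k V).subtype) (kgen k V ω) = E ω := by
  refine (oddDeriv_ι _ (toPos k V ω)).trans ?_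
  rw [LinearMap.comp_apply, Submodule.subtype_apply, coe_toPos, map_sub, map_smul, hE, smul_zero,
    sub_zero]

/-- An odd derivation anticommutes with the sign automorphism as soon as it does so on
generators. -/
theorem oddDeriv_koszulSign {D : extPos k V →ₗ[k] Koszul k V}
    (h : ∀ ω, oddDeriv D (kgen k V (extInv k V ω)) = koszulSign k V (oddDeriv D (kgen k V ω)))
    (a : Koszul k V) : oddDeriv D (koszulSign k V a) = -koszulSign k V (oddDeriv D a) := by
  induction a using koszul_induction with
  | algebraMap r => simp [oddDeriv_algebraMap]
  | kgen ω => rw [koszulSign_kgen, map_neg, h]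
  | mul a b ha hb =>
    rw [map_mul, oddDeriv_mul, oddDeriv_mul, ha, hb, map_add, map_mul, map_mul, neg_mul, mul_neg,
      neg_add]
  | add a b ha hb => rw [map_add, map_add, ha, hb, map_add, map_add, neg_add]

/-- A derivation vanishing on generators vanishes. -/
theorem koszul_derivation_eq_zero {T : Koszul k V →ₗ[k] Koszul k V}
    (hmul : ∀ a b, T (a * b) = T a * b + a * T b) (hgen : ∀ ω, T (kgen k V ω) = 0)
    (a : Koszul k V) : T a = 0 := by
  induction a using koszul_induction with
  | algebraMap r =>
    -- The Leibniz rule at `1 * 1` forces `T 1 = 0`.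
    have h := hmul 1 1
    rw [mul_one, mul_one, one_mul, left_eq_add] at h
    rw [Algebra.algebraMap_eq_smul_one, map_smul, h, smul_zero]
  | kgen ω => exact hgen ω
  | mul a b ha hb => rw [hmul, ha, hb, zero_mul, mul_zero, add_zero]
  | add a b ha hb => rw [map_add, ha, hb, add_zero]

/-- The composite of two odd derivations which anticommute with the sign. -/
theorem oddDeriv_oddDeriv_mul {D D' : extPos k V →ₗ[k] Koszul k V}
    (h : ∀ a, oddDeriv D' (koszulSign k V a) = -koszulSign k V (oddDeriv D' a))
    (a b : Koszul k V) : oddDeriv D' (oddDeriv D (a * b)) =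
      oddDeriv D' (oddDeriv D a) * b + a * oddDeriv D' (oddDeriv D b) +
        (koszulSign k V (oddDeriv D a) * oddDeriv D' b -
          koszulSign k V (oddDeriv D' a) * oddDeriv D b) := by
  -- The sign automorphism is applied twice to `a`, so `a` returns unsigned. The bracketed cross
  -- terms cancel when `D = D'`, and also in an anticommutator.
  rw [oddDeriv_mul, map_add, oddDeriv_mul, oddDeriv_mul, h, koszulSign_koszulSign]
  noncomm_ring

variable (k V) in
/-- The value of the Koszul differential on generators, on all of `Λ(V)`. -/
abbrev koszulPairing : ExteriorAlgebra k V ⊗[k] ExteriorAlgebra k V →ₗ[k] Koszul k V :=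
  (LinearMap.mul' k (Koszul k V)).comp (TensorProduct.map
    ((kgen k V).comp (extInv k V).toLinearMap) (kgen k V))

theorem koszulPairing_tmul (a b : ExteriorAlgebra k V) :
    koszulPairing k V (a ⊗ₜ b) = kgen k V (extInv k V a) * kgen k V b := rfl

theorem koszulD₀_kgen (ω : ExteriorAlgebra k V) :
    koszulD₀ k V (kgen k V ω) = -koszulPairing k V (coprod k V ω) := by
  refine oddDeriv_kgen (E := -((LinearMap.mul' k (Koszul k V)).comp ((TensorProduct.map
    ((kgen k V).comp (extInv k V).toLinearMap) (kgen k V)).comp (coprod k V)))) ?_ ω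
  simp [coprod_one, kgen_one]

theorem koszulSign_koszulPairing (t : ExteriorAlgebra k V ⊗[k] ExteriorAlgebra k V) :
    koszulSign k V (koszulPairing k V t) = koszulPairing k V
      (TensorProduct.map (extInv k V).toLinearMap (extInv k V).toLinearMap t) := by
  induction t with
  | zero => simp
  | add s t hs ht => rw [map_add, map_add, hs, ht, map_add, map_add]
  | tmul a b =>
    rw [koszulPairing_tmul, TensorProduct.map_tmul, koszulPairing_tmul, map_mul, koszulSign_kgen,
      koszulSign_kgen, neg_mul_neg]
    rfl

theorem koszulD₀_koszulSign (a : Koszul k V) :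
    koszulD₀ k V (koszulSign k V a) = -koszulSign k V (koszulD₀ k V a) := by
  refine oddDeriv_koszulSign (fun ω => ?_) a
  have h1 := koszulD₀_kgen (extInv k V ω)
  have h2 := congrArg (koszulSign k V) (koszulD₀_kgen ω)
  rw [map_neg, koszulSign_koszulPairing, ← coprod_extInv] at h2
  exact h1.trans h2.symm

/-- Applying `d_0` to the left or the right factor of `d_0 [ω]` yields the two iterated coproducts
with opposite signs; coassociativity cancels them. -/
theorem koszulD₀_koszulD₀_kgen (ω : ExteriorAlgebra k V) :
    koszulD₀ k V (koszulD₀ k V (kgen k V ω)) = 0 := by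
  let tri : ExteriorAlgebra k V ⊗[k] (ExteriorAlgebra k V ⊗[k] ExteriorAlgebra k V) →ₗ[k]
      Koszul k V := (LinearMap.mul' k (Koszul k V)).comp
        (TensorProduct.map (kgen k V) (koszulPairing k V))
  have htri : ∀ a t, tri (a ⊗ₜ t) = kgen k V a * koszulPairing k V t := fun _ _ => rfl
  have h1 : ∀ t b, tri (TensorProduct.assoc k _ _ _ (t ⊗ₜ b)) = koszulPairing k V
      (TensorProduct.map (extInv k V).toLinearMap (extInv k V).toLinearMap t) * kgen k V b := by
    intro t b
    induction t with
    | zero => simp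
    | add s t hs ht => simp only [TensorProduct.add_tmul, map_add, hs, ht, add_mul]
    | tmul x y =>
      rw [TensorProduct.assoc_tmul, htri, koszulPairing_tmul, TensorProduct.map_tmul,
        koszulPairing_tmul, mul_assoc]
      simp only [AlgHom.toLinearMap_apply, extInv_extInv]
  have h2 : ∀ t, koszulD₀ k V (koszulPairing k V t) =
      tri (TensorProduct.map LinearMap.id (coprod k V) t) -
      tri (TensorProduct.assoc k _ _ _ (TensorProduct.map (coprod k V) LinearMap.id t)) := by
    intro t
    induction t with
    | zero => simp
    | add s t hs ht =>
      simp only [map_add, hs, ht]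
      abel
    | tmul a b =>
      rw [koszulPairing_tmul]
      refine (oddDeriv_mul _ _ _).trans ?_
      change koszulD₀ k V _ * _ + _ * koszulD₀ k V _ = _
      rw [koszulSign_kgen, extInv_extInv, koszulD₀_kgen, koszulD₀_kgen, TensorProduct.map_tmul,
        TensorProduct.map_tmul, htri, h1, coprod_extInv, LinearMap.id_apply, LinearMap.id_apply]
      noncomm_ring
  rw [koszulD₀_kgen, map_neg, h2, coprod_coassoc, sub_self, neg_zero]

theorem koszulD₀_koszulD₀ (a : Koszul k V) : koszulD₀ k V (koszulD₀ k V a) = 0 :=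
  koszul_derivation_eq_zero (T := (koszulD₀ k V).comp (koszulD₀ k V))
    (fun a b => (oddDeriv_oddDeriv_mul koszulD₀_koszulSign a b).trans
      (by rw [sub_self, add_zero]; rfl))
    koszulD₀_koszulD₀_kgen a

end KoszulDiff

/-! ### The square of the perturbed differential -/

section KoszulCE

variable {k g : Type*} [Field k] [LieRing g] [LieAlgebra k g]

theorem koszulD₁_kgen (ω : ExteriorAlgebra k g) :
    koszulD₁ k g (kgen k g ω) = kgen k g (ceDiff k g ω) := by
  refine oddDeriv_kgen (E := (kgen k g).comp (ceDiff k g)) ?_ ω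
  rw [LinearMap.comp_apply, ceDiff_one, map_zero]

theorem koszulD₁_koszulSign (a : Koszul k g) :
    koszulD₁ k g (koszulSign k g a) = -koszulSign k g (koszulD₁ k g a) := by
  refine oddDeriv_koszulSign (fun ω => ?_) a
  have h1 := koszulD₁_kgen (extInv k g ω)
  have h2 := congrArg (koszulSign k g) (koszulD₁_kgen ω)
  rw [ceDiff_extInv, map_neg, ← koszulSign_kgen] at h1
  exact h1.trans h2.symm

theorem koszulD₁_koszulD₁ (a : Koszul k g) : koszulD₁ k g (koszulD₁ k g a) = 0 :=
  koszul_derivation_eq_zero (T := (koszulD₁ k g).comp (koszulD₁ k g))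
    (fun a b => (oddDeriv_oddDeriv_mul koszulD₁_koszulSign a b).trans
      (by rw [sub_self, add_zero]; rfl))
    (fun ω => by
      rw [LinearMap.comp_apply, koszulD₁_kgen, koszulD₁_kgen, ceDiff_ceDiff, map_zero]) a

/-- On products of two generators `d_1` is minus the coderivation extending `∂`, the sign coming
from the shift; so this is the coderivation property of `∂`. -/
theorem koszulD₀_koszulD₁_kgen (ω : ExteriorAlgebra k g) :
    koszulD₀ k g (koszulD₁ k g (kgen k g ω)) + koszulD₁ k g (koszulD₀ k g (kgen k g ω)) = 0 := by
  have h : ∀ t, koszulD₁ k g (koszulPairing k g t) =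
      -koszulPairing k g (TensorProduct.map (ceDiff k g) LinearMap.id t +
        TensorProduct.map (extInv k g).toLinearMap (ceDiff k g) t) := by
    intro t
    induction t with
    | zero => simp
    | add s t hs ht =>
      simp only [map_add, hs, ht]
      abel
    | tmul a b =>
      rw [koszulPairing_tmul]
      refine (oddDeriv_mul _ _ _).trans ?_
      change koszulD₁ k g _ * _ + _ * koszulD₁ k g _ = _
      rw [koszulSign_kgen, extInv_extInv, koszulD₁_kgen, koszulD₁_kgen, TensorProduct.map_tmul,
        TensorProduct.map_tmul, map_add, koszulPairing_tmul, koszulPairing_tmul, ceDiff_extInv,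
        AlgHom.toLinearMap_apply, extInv_extInv, LinearMap.id_apply, map_neg]
      noncomm_ring
  rw [koszulD₁_kgen, koszulD₀_kgen, koszulD₀_kgen, map_neg, h, coprod_ceDiff, neg_neg,
    neg_add_cancel]

theorem koszulD₀_koszulD₁ (a : Koszul k g) :
    koszulD₀ k g (koszulD₁ k g a) + koszulD₁ k g (koszulD₀ k g a) = 0 := by
  refine koszul_derivation_eq_zero (T := (koszulD₀ k g).comp (koszulD₁ k g) +
    (koszulD₁ k g).comp (koszulD₀ k g)) (fun a b => ?_) koszulD₀_koszulD₁_kgen a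
  have h1 : koszulD₀ k g (koszulD₁ k g (a * b)) = _ :=
    oddDeriv_oddDeriv_mul koszulD₀_koszulSign a b
  have h2 : koszulD₁ k g (koszulD₀ k g (a * b)) = _ :=
    oddDeriv_oddDeriv_mul koszulD₁_koszulSign a b
  simp only [LinearMap.add_apply, LinearMap.comp_apply]
  rw [h1, h2, add_mul, mul_add]
  change (koszulD₀ k g (koszulD₁ k g a) * b + a * koszulD₀ k g (koszulD₁ k g b) +
    (koszulSign k g (koszulD₁ k g a) * koszulD₀ k g b -
      koszulSign k g (koszulD₀ k g a) * koszulD₁ k g b)) +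
    (koszulD₁ k g (koszulD₀ k g a) * b + a * koszulD₁ k g (koszulD₀ k g b) +
    (koszulSign k g (koszulD₀ k g a) * koszulD₁ k g b -
      koszulSign k g (koszulD₁ k g a) * koszulD₀ k g b)) = _
  abel

theorem koszulDh_tmul (p : k[X]) (a : Koszul k g) : koszulDh k g (p ⊗ₜ a) =
    p ⊗ₜ koszulD₀ k g a + (Polynomial.X * p) ⊗ₜ koszulD₁ k g a := rfl

theorem koszulDh_koszulDh (t : HKoszul k g) : koszulDh k g (koszulDh k g t) = 0 := by
  induction t using TensorProduct.induction_on with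
  | zero => simp
  | add s t hs ht => rw [map_add, map_add, hs, ht, add_zero]
  | tmul p a =>
    rw [koszulDh_tmul, map_add, koszulDh_tmul, koszulDh_tmul, koszulD₀_koszulD₀,
      koszulD₁_koszulD₁, TensorProduct.tmul_zero, TensorProduct.tmul_zero, zero_add, add_zero,
      ← TensorProduct.tmul_add, add_comm, koszulD₀_koszulD₁, TensorProduct.tmul_zero]

theorem koszulDh_mul (s t : HKoszul k g) : koszulDh k g (s * t) =
    koszulDh k g s * t + hkoszulSign k g s * koszulDh k g t := by
  induction s using TensorProduct.induction_on with
  | zero => simp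
  | add s s' hs hs' =>
    simp only [map_add, add_mul, hs, hs']
    abel
  | tmul p a =>
    induction t using TensorProduct.induction_on with
    | zero => simp
    | add t t' ht ht' =>
      simp only [map_add, mul_add, ht, ht']
      abel
    | tmul q b =>
      have h0 : koszulD₀ k g (a * b) = koszulD₀ k g a * b + koszulSign k g a * koszulD₀ k g b :=
        oddDeriv_mul _ _ _
      have h1 : koszulD₁ k g (a * b) = koszulD₁ k g a * b + koszulSign k g a * koszulD₁ k g b :=
        oddDeriv_mul _ _ _
      have hs : hkoszulSign k g (p ⊗ₜ a) = p ⊗ₜ koszulSign k g a := rfl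
      simp only [Algebra.TensorProduct.tmul_mul_tmul, koszulDh_tmul, hs, h0, h1, add_mul, mul_add,
        TensorProduct.tmul_add, mul_assoc, mul_left_comm p]
      abel

end KoszulCE

/-! ### Degrees of the Koszul differentials -/

section KoszulDegrees

variable {k V : Type*} [Field k] [AddCommGroup V] [Module k V]

theorem kgen_mem_koszulDeg {n : ℕ} {ω : ExteriorAlgebra k V} (h : ω ∈ ⋀[k]^(n + 1) V) :
    kgen k V ω ∈ koszulDeg k V n := by
  rw [← ExteriorAlgebra.ιMulti_span_fixedDegree] at h
  refine (Submodule.span_le (p := (koszulDeg k V n).comap (kgen k V))).2 ?_ h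
  rintro _ ⟨v, rfl⟩
  exact Submodule.subset_span ⟨[⟨n, v⟩], by simp, by simp⟩

theorem koszulDeg_mul_mem {m n : ℕ} {a b : Koszul k V} (ha : a ∈ koszulDeg k V m)
    (hb : b ∈ koszulDeg k V n) : a * b ∈ koszulDeg k V (m + n) := by
  refine (Submodule.mul_le.1 ?_) a ha b hb
  rw [koszulDeg, koszulDeg, Submodule.span_mul_span, Submodule.span_le]
  rintro _ ⟨_, ⟨l, hl, rfl⟩, _, ⟨l', hl', rfl⟩, rfl⟩
  exact Submodule.subset_span ⟨l ++ l', by simp [hl, hl'], by simp⟩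

variable (k V) in
/-- The component of `T(Λ⁺(V)[-1])` of degree `-m + 1`, which vanishes for `m = 0`. -/
def koszulDegPred : ℕ → Submodule k (Koszul k V)
  | 0 => ⊥
  | m + 1 => koszulDeg k V m

theorem koszulDegPred_mul_mem {m n : ℕ} {a b : Koszul k V} (ha : a ∈ koszulDegPred k V m)
    (hb : b ∈ koszulDeg k V n) : a * b ∈ koszulDegPred k V (m + n) := by
  cases m with
  | zero =>
    rw [(Submodule.mem_bot k).1 ha, zero_mul]
    exact zero_mem _
  | succ m =>
    rw [Nat.succ_add]
    exact koszulDeg_mul_mem ha hb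

theorem koszulDeg_mul_pred_mem {m n : ℕ} {a b : Koszul k V} (ha : a ∈ koszulDeg k V m)
    (hb : b ∈ koszulDegPred k V n) : a * b ∈ koszulDegPred k V (m + n) := by
  cases n with
  | zero =>
    rw [(Submodule.mem_bot k).1 hb, mul_zero]
    exact zero_mem _
  | succ n => exact koszulDeg_mul_mem ha hb

theorem exteriorPower_succ_le {n : ℕ} {S : Submodule k (ExteriorAlgebra k V)}
    (h : ∀ v, ∀ ω ∈ ⋀[k]^n V, ExteriorAlgebra.ι k v * ω ∈ S) : ⋀[k]^(n + 1) V ≤ S := by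
  rw [ExteriorAlgebra.exteriorPower, pow_succ', Submodule.mul_le]
  rintro _ ⟨v, rfl⟩ ω hω
  exact h v ω hω

theorem exists_eq_smul_one_of_mem {ω : ExteriorAlgebra k V} (h : ω ∈ ⋀[k]^0 V) :
    ∃ r : k, ω = r • 1 := by
  rw [ExteriorAlgebra.exteriorPower, pow_zero, Submodule.mem_one] at h
  obtain ⟨r, rfl⟩ := h
  exact ⟨r, Algebra.algebraMap_eq_smul_one r⟩

theorem one_mem_exteriorPower_zero : (1 : ExteriorAlgebra k V) ∈ ⋀[k]^0 V := by
  rw [ExteriorAlgebra.exteriorPower, pow_zero]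
  exact Submodule.one_le.1 le_rfl

theorem ι_mul_mem_exteriorPower (v : V) {n : ℕ} {ω : ExteriorAlgebra k V} (h : ω ∈ ⋀[k]^n V) :
    ExteriorAlgebra.ι k v * ω ∈ ⋀[k]^(n + 1) V := by
  rw [ExteriorAlgebra.exteriorPower, pow_succ']
  exact Submodule.mul_mem_mul ⟨v, rfl⟩ h

theorem extInv_mem_exteriorPower {n : ℕ} {ω : ExteriorAlgebra k V} (h : ω ∈ ⋀[k]^n V) :
    extInv k V ω ∈ ⋀[k]^n V := by
  induction n generalizing ω with
  | zero =>
    obtain ⟨r, rfl⟩ := exists_eq_smul_one_of_mem h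
    rwa [map_smul, map_one]
  | succ n ih =>
    refine exteriorPower_succ_le
      (S := (⋀[k]^(n + 1) V).comap (extInv k V).toLinearMap) (fun v ω hω => ?_) h
    rw [Submodule.mem_comap, AlgHom.toLinearMap_apply, map_mul, extInv_ι, neg_mul]
    exact neg_mem (ι_mul_mem_exteriorPower v (ih hω))

variable (k V) in
/-- The elements of total degree `n` of `Λ(V) ⊗ Λ(V)`. -/
def extTensorDeg (n : ℕ) : Submodule k (ExteriorAlgebra k V ⊗[k] ExteriorAlgebra k V) :=
  Submodule.span k {t | ∃ p q, p + q = n ∧ ∃ a ∈ ⋀[k]^p V, ∃ b ∈ ⋀[k]^q V, a ⊗ₜ b = t}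

theorem coprod_mem_extTensorDeg {n : ℕ} {ω : ExteriorAlgebra k V} (h : ω ∈ ⋀[k]^n V) :
    coprod k V ω ∈ extTensorDeg k V n := by
  induction n generalizing ω with
  | zero =>
    obtain ⟨r, rfl⟩ := exists_eq_smul_one_of_mem h
    rw [map_smul, coprod_one]
    exact Submodule.smul_mem _ _ (Submodule.subset_span
      ⟨0, 0, rfl, 1, one_mem_exteriorPower_zero, 1, one_mem_exteriorPower_zero, rfl⟩)
  | succ n ih =>
    refine exteriorPower_succ_le
      (S := (extTensorDeg k V (n + 1)).comap (coprod k V)) (fun v ω hω => ?_) h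
    rw [Submodule.mem_comap, coprod_ι_mul]
    refine (Submodule.span_le
      (p := (extTensorDeg k V (n + 1)).comap (coprodStep k V v))).2 ?_ (ih hω)
    rintro _ ⟨p, q, hpq, a, ha, b, hb, rfl⟩
    rw [SetLike.mem_coe, Submodule.mem_comap, coprodStep_tmul]
    exact add_mem (Submodule.subset_span
        ⟨p + 1, q, by omega, _, ι_mul_mem_exteriorPower v ha, b, hb, rfl⟩)
      (Submodule.subset_span ⟨p, q + 1, by omega, _, extInv_mem_exteriorPower ha, _,
        ι_mul_mem_exteriorPower v hb, rfl⟩)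

theorem koszulD₀_kgen_mem {n : ℕ} {ω : ExteriorAlgebra k V} (h : ω ∈ ⋀[k]^(n + 1) V) :
    koszulD₀ k V (kgen k V ω) ∈ koszulDegPred k V n := by
  rw [koszulD₀_kgen]
  refine neg_mem ((Submodule.span_le
    (p := (koszulDegPred k V n).comap (koszulPairing k V))).2 ?_ (coprod_mem_extTensorDeg h))
  rintro _ ⟨p, q, hpq, a, ha, b, hb, rfl⟩
  rw [SetLike.mem_coe, Submodule.mem_comap, koszulPairing_tmul]
  -- Terms of the coproduct with a scalar factor vanish because `[1] = 0`.
  rcases p with _ | p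
  · obtain ⟨r, rfl⟩ := exists_eq_smul_one_of_mem ha
    rw [map_smul, map_one, map_smul, kgen_one, smul_zero, zero_mul]
    exact zero_mem _
  rcases q with _ | q
  · obtain ⟨r, rfl⟩ := exists_eq_smul_one_of_mem hb
    rw [map_smul, kgen_one, smul_zero, mul_zero]
    exact zero_mem _
  -- Factors of exterior degrees `p + 1` and `q + 1` have degrees `-p` and `-q`: splitting one
  -- generator in two raises the degree by one.
  obtain rfl : n = p + q + 1 := by omega
  exact koszulDeg_mul_mem (kgen_mem_koszulDeg (extInv_mem_exteriorPower ha))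
    (kgen_mem_koszulDeg hb)

/-- An odd derivation lowers degrees by one as soon as it does so on generators. -/
theorem oddDeriv_mem_koszulDegPred {D : extPos k V →ₗ[k] Koszul k V}
    (hD : ∀ n, ∀ ω ∈ ⋀[k]^(n + 1) V, oddDeriv D (kgen k V ω) ∈ koszulDegPred k V n)
    {m : ℕ} {a : Koszul k V} (h : a ∈ koszulDeg k V m) : oddDeriv D a ∈ koszulDegPred k V m := by
  refine (Submodule.span_le (p := (koszulDegPred k V m).comap (oddDeriv D))).2 ?_ h
  clear h
  rintro _ ⟨l, rfl, rfl⟩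
  rw [SetLike.mem_coe, Submodule.mem_comap]
  induction l with
  | nil =>
    rw [show (([] : List (Σ n : ℕ, (Fin (n + 1) → V))).map fun p =>
      kgen k V (ExteriorAlgebra.ιMulti k (p.1 + 1) p.2)).prod = 1 from rfl, ← map_one (algebraMap k (Koszul k V)), oddDeriv_algebraMap]
    exact zero_mem _
  | cons p l ih =>
    have hp := ExteriorAlgebra.ιMulti_range k (p.1 + 1) (M := V) ⟨p.2, rfl⟩
    have key : ∀ b ∈ koszulDeg k V (l.map Sigma.fst).sum,
        oddDeriv D b ∈ koszulDegPred k V (l.map Sigma.fst).sum →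
        oddDeriv D (kgen k V (ExteriorAlgebra.ιMulti k (p.1 + 1) p.2) * b) ∈
          koszulDegPred k V (p.1 + (l.map Sigma.fst).sum) := by
      intro b hb hDb
      rw [oddDeriv_mul, koszulSign_kgen]
      exact add_mem (koszulDegPred_mul_mem (hD _ _ hp) hb) (koszulDeg_mul_pred_mem
        (neg_mem (kgen_mem_koszulDeg (extInv_mem_exteriorPower hp))) hDb)
    exact key _ (Submodule.subset_span ⟨l, rfl, rfl⟩) ih

end KoszulDegrees

/-! ### Degrees of the Chevalley–Eilenberg part and of the perturbed differential -/

section HKoszulDegrees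

variable {k g : Type*} [Field k] [LieRing g] [LieAlgebra k g]

theorem adExt_mem_exteriorPower (x : g) {n : ℕ} {ω : ExteriorAlgebra k g} (h : ω ∈ ⋀[k]^n g) :
    adExt k g x ω ∈ ⋀[k]^n g := by
  induction n generalizing ω with
  | zero =>
    obtain ⟨r, rfl⟩ := exists_eq_smul_one_of_mem h
    rw [map_smul, adExt_one, smul_zero]
    exact zero_mem _
  | succ n ih =>
    refine exteriorPower_succ_le
      (S := (⋀[k]^(n + 1) g).comap (adExt k g x)) (fun v ω hω => ?_) h
    rw [Submodule.mem_comap, adExt_ι_mul]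
    exact add_mem (ι_mul_mem_exteriorPower _ hω) (ι_mul_mem_exteriorPower v (ih hω))

theorem ceDiff_eq_zero_of_mem {ω : ExteriorAlgebra k g} (h : ω ∈ ⋀[k]^0 g) :
    ceDiff k g ω = 0 := by
  obtain ⟨r, rfl⟩ := exists_eq_smul_one_of_mem h
  rw [map_smul, ceDiff_one, smul_zero]

theorem ceDiff_mem_exteriorPower {n : ℕ} {ω : ExteriorAlgebra k g} (h : ω ∈ ⋀[k]^(n + 1) g) :
    ceDiff k g ω ∈ ⋀[k]^n g := by
  induction n generalizing ω with
  | zero =>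
    refine exteriorPower_succ_le
      (S := (⋀[k]^0 g).comap (ceDiff k g)) (fun v ω hω => ?_) h
    rw [Submodule.mem_comap, ceDiff_ι_mul, ceDiff_eq_zero_of_mem hω, mul_zero, sub_zero]
    exact neg_mem (adExt_mem_exteriorPower v hω)
  | succ n ih =>
    refine exteriorPower_succ_le
      (S := (⋀[k]^(n + 1) g).comap (ceDiff k g)) (fun v ω hω => ?_) h
    rw [Submodule.mem_comap, ceDiff_ι_mul]
    exact sub_mem (neg_mem (adExt_mem_exteriorPower v hω)) (ι_mul_mem_exteriorPower v (ih hω))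

theorem koszulD₁_kgen_mem {n : ℕ} {ω : ExteriorAlgebra k g} (h : ω ∈ ⋀[k]^(n + 1) g) :
    koszulD₁ k g (kgen k g ω) ∈ koszulDegPred k g n := by
  rw [koszulD₁_kgen]
  have h1 := ceDiff_mem_exteriorPower h
  cases n with
  | zero =>
    obtain ⟨r, hr⟩ := exists_eq_smul_one_of_mem h1
    rw [hr, map_smul, kgen_one, smul_zero]
    exact zero_mem _
  | succ n => exact kgen_mem_koszulDeg h1

/-- Covers all degrees at once: at `m = 0` the target is zero, so it also gives vanishing on degree
0. -/
theorem koszulDh_mem_baseChange {m : ℕ} {t : HKoszul k g} (h : t ∈ hkoszulDeg k g m) :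
    koszulDh k g t ∈ (koszulDegPred k g m).baseChange k[X] := by
  rw [hkoszulDeg, Submodule.baseChange_eq_span] at h
  refine (Submodule.span_le
    (p := ((koszulDegPred k g m).baseChange k[X]).comap (koszulDh k g))).2 ?_ h
  rintro _ ⟨a, ha, rfl⟩
  have h0 : koszulD₀ k g a ∈ koszulDegPred k g m :=
    oddDeriv_mem_koszulDegPred (fun n ω => koszulD₀_kgen_mem) ha
  have h1 : koszulD₁ k g a ∈ koszulDegPred k g m :=
    oddDeriv_mem_koszulDegPred (fun n ω => koszulD₁_kgen_mem) ha
  exact add_mem (Submodule.tmul_mem_baseChange_of_mem _ h0)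
    (Submodule.tmul_mem_baseChange_of_mem _ h1)

theorem map_koszulDh_hkoszulDeg_le (m : ℕ) :
    (hkoszulDeg k g (m + 1)).map (koszulDh k g) ≤ hkoszulDeg k g m :=
  Submodule.map_le_iff_le_comap.2 fun _ => koszulDh_mem_baseChange

theorem koszulDh_eq_zero_of_mem {t : HKoszul k g} (h : t ∈ hkoszulDeg k g 0) :
    koszulDh k g t = 0 := by
  have h1 := koszulDh_mem_baseChange h
  rwa [koszulDegPred, Submodule.baseChange_bot, Submodule.mem_bot] at h1

end HKoszulDegrees

/-! ### The lowest components of the perturbed differential -/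

section LowDegrees

variable {k g : Type*} [Field k] [LieRing g] [LieAlgebra k g]

theorem koszulDh_one_tmul (a : Koszul k g) : koszulDh k g (1 ⊗ₜ a) =
    1 ⊗ₜ koszulD₀ k g a + (Polynomial.X : k[X]) • (1 ⊗ₜ koszulD₁ k g a) := rfl

theorem hxi_singleton (x : g) : hxi k g ![x] = 1 ⊗ₜ kgen k g (ExteriorAlgebra.ι k x) := by
  simp [hxi, ExteriorAlgebra.ιMulti_apply]

theorem hxi_pair (x y : g) : hxi k g ![x, y] =
    1 ⊗ₜ kgen k g (ExteriorAlgebra.ι k x * ExteriorAlgebra.ι k y) := by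
  simp [hxi, ExteriorAlgebra.ιMulti_apply]

theorem hxi_triple (x y z : g) : hxi k g ![x, y, z] =
    1 ⊗ₜ kgen k g (ExteriorAlgebra.ι k x * (ExteriorAlgebra.ι k y * ExteriorAlgebra.ι k z)) := by
  simp [hxi, ExteriorAlgebra.ιMulti_apply]

theorem ι_mul_ι_swap (x y : g) : ExteriorAlgebra.ι k x * ExteriorAlgebra.ι k y =
    -(ExteriorAlgebra.ι k y * ExteriorAlgebra.ι k x) :=
  eq_neg_of_add_eq_zero_left (ExteriorAlgebra.ι_add_mul_swap x y)

theorem ceDiff_ι (x : g) : ceDiff k g (ExteriorAlgebra.ι k x) = 0 := by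
  have h := ceDiff_ι_mul (k := k) x 1
  rwa [mul_one, adExt_one, ceDiff_one, mul_zero, neg_zero, sub_zero] at h

theorem adExt_ι (x y : g) :
    adExt k g x (ExteriorAlgebra.ι k y) = ExteriorAlgebra.ι k ⁅x, y⁆ := by
  have h := adExt_ι_mul k g x y 1
  rwa [mul_one, adExt_one, mul_one, mul_zero, add_zero] at h

theorem ceDiff_ι_mul_ι (x y : g) : ceDiff k g (ExteriorAlgebra.ι k x * ExteriorAlgebra.ι k y) =
    -ExteriorAlgebra.ι k ⁅x, y⁆ := by
  rw [ceDiff_ι_mul, ceDiff_ι, adExt_ι, mul_zero, sub_zero]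

theorem coprod_ι_mul_ι (x y : g) :
    coprod k g (ExteriorAlgebra.ι k x * ExteriorAlgebra.ι k y) =
      (ExteriorAlgebra.ι k x * ExteriorAlgebra.ι k y) ⊗ₜ 1 -
        ExteriorAlgebra.ι k y ⊗ₜ ExteriorAlgebra.ι k x +
        ExteriorAlgebra.ι k x ⊗ₜ ExteriorAlgebra.ι k y +
        1 ⊗ₜ (ExteriorAlgebra.ι k x * ExteriorAlgebra.ι k y) := by
  rw [coprod_ι_mul, coprod_ι, map_add, coprodStep_tmul, coprodStep_tmul, extInv_ι, map_one,
    mul_one, TensorProduct.neg_tmul]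
  abel

theorem koszulDh_hxi_pair (x y : g) : koszulDh k g (hxi k g ![x, y]) =
    hxi k g ![x] * hxi k g ![y] - hxi k g ![y] * hxi k g ![x]
      - (Polynomial.X : k[X]) • hxi k g ![⁅x, y⁆] := by
  simp only [hxi_singleton, hxi_pair, koszulDh_one_tmul, koszulD₀_kgen, koszulD₁_kgen,
    coprod_ι_mul_ι, ceDiff_ι_mul_ι, Algebra.TensorProduct.tmul_mul_tmul, mul_one, map_add, map_sub,
    map_neg, koszulPairing_tmul, map_one, kgen_one, extInv_ι, mul_zero, zero_mul,
    TensorProduct.tmul_neg, smul_neg, ← TensorProduct.tmul_sub, ← sub_eq_add_neg]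
  congr 1
  rw [← TensorProduct.tmul_neg]
  congr 1
  noncomm_ring

theorem koszulDh_hxi_triple (x y z : g) : koszulDh k g (hxi k g ![x, y, z]) =
    (hxi k g ![x] * hxi k g ![y, z] - hxi k g ![y, z] * hxi k g ![x])
      + (hxi k g ![y] * hxi k g ![z, x] - hxi k g ![z, x] * hxi k g ![y])
      + (hxi k g ![z] * hxi k g ![x, y] - hxi k g ![x, y] * hxi k g ![z])
      - (Polynomial.X : k[X]) •
        (hxi k g ![⁅x, y⁆, z] + hxi k g ![⁅y, z⁆, x] + hxi k g ![⁅z, x⁆, y]) := by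
  have h1 : ceDiff k g (ExteriorAlgebra.ι k x * (ExteriorAlgebra.ι k y * ExteriorAlgebra.ι k z)) =
      -(ExteriorAlgebra.ι k ⁅x, y⁆ * ExteriorAlgebra.ι k z +
        ExteriorAlgebra.ι k ⁅y, z⁆ * ExteriorAlgebra.ι k x +
        ExteriorAlgebra.ι k ⁅z, x⁆ * ExteriorAlgebra.ι k y) := by
    -- Antisymmetry of the wedge and of the bracket turns the recursive formula into the cyclic one.
    rw [ceDiff_ι_mul, adExt_ι_mul, adExt_ι, ceDiff_ι_mul_ι, ι_mul_ι_swap ⁅y, z⁆ x,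
      ι_mul_ι_swap ⁅z, x⁆ y, ← lie_skew x z, map_neg]
    noncomm_ring
  have h2 : koszulPairing k g (coprod k g
      (ExteriorAlgebra.ι k x * (ExteriorAlgebra.ι k y * ExteriorAlgebra.ι k z))) =
      -((kgen k g (ExteriorAlgebra.ι k x) *
            kgen k g (ExteriorAlgebra.ι k y * ExteriorAlgebra.ι k z) -
          kgen k g (ExteriorAlgebra.ι k y * ExteriorAlgebra.ι k z) *
            kgen k g (ExteriorAlgebra.ι k x)) +
        (kgen k g (ExteriorAlgebra.ι k y) *
            kgen k g (ExteriorAlgebra.ι k z * ExteriorAlgebra.ι k x) -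
          kgen k g (ExteriorAlgebra.ι k z * ExteriorAlgebra.ι k x) *
            kgen k g (ExteriorAlgebra.ι k y)) +
        (kgen k g (ExteriorAlgebra.ι k z) *
            kgen k g (ExteriorAlgebra.ι k x * ExteriorAlgebra.ι k y) -
          kgen k g (ExteriorAlgebra.ι k x * ExteriorAlgebra.ι k y) *
            kgen k g (ExteriorAlgebra.ι k z))) := by
    rw [coprod_ι_mul, coprod_ι_mul_ι, ι_mul_ι_swap z x]
    simp only [map_add, map_sub, map_mul, map_neg, coprodStep_tmul, koszulPairing_tmul, map_one,
      extInv_ι, kgen_one, mul_one, mul_zero, zero_mul, neg_mul_neg, neg_neg]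
    noncomm_ring
  simp only [hxi_singleton, hxi_pair, hxi_triple, koszulDh_one_tmul, koszulD₀_kgen, koszulD₁_kgen,
    h1, h2, Algebra.TensorProduct.tmul_mul_tmul, mul_one, map_neg, neg_neg, map_add,
    TensorProduct.tmul_neg, smul_neg, TensorProduct.tmul_add, TensorProduct.tmul_sub,
    ← sub_eq_add_neg]

end LowDegrees
end

/-! ### The assembled theorem -/

theorem mainTheorem5 (k : Type*) [Field k] :
    -- linear right-hand sides, without any Jacobi identity: `⋂ Γ_ℓ = 0`
    (∀ (V I : Type*) [AddCommGroup V] [Module k V] [LinearOrder I] (x : Module.Basis I k V)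
        (c : I → I → V),
      ⨅ l, hFilt k (QuotBy (pairRelators x fun i j => (Polynomial.X : k[X]) • hvec k (c i j))) l
        = ⊥) ∧
    ∀ (g : Type*) [LieRing g] [LieAlgebra k g],
      -- `d_ħ = d_0 + ħ d_1` makes `T(Λ⁺(g)[-1])[ħ]` a dg algebra in degrees `≤ 0`
      (∀ m, (hkoszulDeg k g (m + 1)).map (koszulDh k g) ≤ hkoszulDeg k g m) ∧
      (∀ t ∈ hkoszulDeg k g 0, koszulDh k g t = 0) ∧
      (∀ s t, koszulDh k g (s * t) =
        koszulDh k g s * t + hkoszulSign k g s * koszulDh k g t) ∧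
      (∀ t, koszulDh k g (koszulDh k g t) = 0) ∧
      -- its two lowest components
      (∀ x y : g, koszulDh k g (hxi k g ![x, y]) =
        hxi k g ![x] * hxi k g ![y] - hxi k g ![y] * hxi k g ![x]
          - (Polynomial.X : k[X]) • hxi k g ![⁅x, y⁆]) ∧
      (∀ x y z : g, koszulDh k g (hxi k g ![x, y, z]) =
        (hxi k g ![x] * hxi k g ![y, z] - hxi k g ![y, z] * hxi k g ![x])
          + (hxi k g ![y] * hxi k g ![z, x] - hxi k g ![z, x] * hxi k g ![y])
          + (hxi k g ![z] * hxi k g ![x, y] - hxi k g ![x, y] * hxi k g ![z])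
          - (Polynomial.X : k[X]) •
            (hxi k g ![⁅x, y⁆, z] + hxi k g ![⁅y, z⁆, x] + hxi k g ![⁅z, x⁆, y])) ∧
      -- the two PBW properties of `A = T(g)[ħ]/(xy - yx - ħ[x,y])`
      HasDescPBW k (HEnv.gen k g) ∧
      (⨅ l, hFilt k (HEnv k g) l = ⊥) ∧
      HasHPBW k (HEnv.gen k g) ∧
      -- all specializations
      (∀ a : k, HasPBW k (SpecEnv.gen k g a) ∧
        (∃ e : SpecEnv k g a ≃ₐ[k] ScaledEnv k g a,
          ∀ x, e (SpecEnv.gen k g a x) = ScaledEnv.gen k g a x) ∧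
        HasPBW k (ScaledEnv.gen k g a)) ∧
      -- the classical theorem
      HasPBW k (fun x : g => UniversalEnvelopingAlgebra.ι k x) := by
  refine ⟨fun V I _ _ _ x c => iInf_hFilt_eq_bot _ ?_, fun g _ _ =>
    ⟨map_koszulDh_hkoszulDeg_le, fun t => koszulDh_eq_zero_of_mem, koszulDh_mul, koszulDh_koszulDh,
      koszulDh_hxi_pair, koszulDh_hxi_triple, hasDescPBW_HEnv, iInf_hFilt_eq_bot _ ?_,
      hasHPBW_HEnv, fun a => ⟨hasPBW_SpecEnv a, SpecEnv.exists_equiv a, hasPBW_ScaledEnv a⟩,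
      hasPBW_universalEnvelopingAlgebra⟩⟩
  · rintro _ ⟨i, j, -, rfl⟩
    exact ⟨x i, x j, c i j, rfl⟩
  · rintro _ ⟨x, y, rfl⟩
    exact ⟨x, y, ⁅x, y⁆, rfl⟩
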